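/- **Setting.** Let $N$ be a lattice of finite rank $r\ge 0$, $M=\mathrm{Hom}(N,\mathbb Z)$, $N_{\mathbb R}=N\otimes\mathbb R$, $\overline N=N/\{\pm\mathrm{id}\}$. For a linear subspace $W\subset N_{\mathbb R}$ write $W_N=W\cap N$. *The category $\mathrm{Trop}$.* Objects are finite index sets $I$ with a map $c:I\to\overline N$. A morphism $(I,c)\to(J,d)$ is a finite graph whose edges carry weighted directions in $\overline N$ and whose vertices carry genera in $\mathbb Z_{\ge 0}$, with ends of edges marked by $I\sqcup J$, the marked edges having directions $c,d$; such graphs are taken up to isomorphism, up to contraction of compact edges of direction $0$ (contracting a loop raises the genus by one), and up to insertion of auxiliary bivalent points in the interior of edges. Composition glues marked ends, and the monoidal product is disjoint union. A tropical quantum field theory (TrQFT) is a symmetric monoidal functor from $\mathrm{Trop}$. *The multiplicity TrQFT.* For $n\in N$ let $n^\perp\subset M_{\mathbb Q}=M\otimes\mathbb Q$ and let $\mathcal C_{n}=\Lambda^*(n^\perp\oplus n^\perp)$, a super commutative algebra over $\mathbb Q$ depending only on $\pm n$. For $\alpha\in\Lambda^d$ put $\alpha^\Box=(-1)^{d(d-1)/2}(\alpha,0)\wedge(0,\alpha)$.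 Let $\Theta_0$ be a generator of $\Lambda^{r}M$. Let $\kappa_n:\mathcal C_n\hookrightarrow\mathcal C_0$ be the inclusion and, for $n\neq0$, let $\kappa_n^\vee=\iota_{(n,0)\wedge(0,n)}:\mathcal C_0\to\mathcal C_n$ be the contraction (first with $(n,0)$, then with $(0,n)$); $\kappa_0=\kappa_0^\vee=\mathrm{id}$. Equip $\mathcal C_n$ with the Frobenius trace $\mathrm{Tr}_n$ given by projection to the top degree followed by the linear form with $\mathrm{Tr}_0(\Theta_0^\Box)=1$ and, for $n\ne0$, $\mathrm{Tr}_n\big(\iota_{(n,0)\wedge(0,n)}\Theta_0^\Box\big)=1$. Let $F_{\mathrm{Mult}}:\mathrm{Trop}\to s\mathbb Q\text{-Mod}$ be the TrQFT given by these data: it sends $(I,c)$ to $\bigotimes_{i\in I}\mathcal C_{c(i)}$; a genus-$0$ vertex with incoming edges $(I,c)$ and one outgoing edge of direction $0$ to $\bigotimes x_i\mapsto\bigwedge_i\kappa_{c(i)}(x_i)$; the genus-$0$ vertex with one incoming edge of direction $0$ and no outgoing edge to $\mathrm{Tr}_0$; the genus-$0$ bivalent vertex from direction $0$ to direction $n$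 to $\kappa_n^\vee$; and the vertexless edge $[n]\sqcup[n]\to\emptyset$ to $x\otimes y\mapsto\mathrm{Tr}_n(x\wedge y)$. *Tropical curves.* Let $h:\Gamma\to N_{\mathbb R}$ be a tropical curve with at least one vertex: $\Gamma$ is a finite connected graph with vertex set $\Gamma^{[0]}$, compact edges $\Gamma^{[1]}_c$ and non-compact edges $E_i$ indexed by a finite set $I$, weights $w(E)\ge0$ and vertex genera $g(V)\ge0$ (positive if $V$ is uni- or bivalent); $h$ contracts the edges of weight $0$, embeds each other edge $E$ properly in a line with primitive direction $u_E\in N$ ($u_E=0$ if $w(E)=0$), and the balancing condition holds at each vertex. Its degree is $\Delta(i)=w(E_i)u_{E_i}$ and its genus $g$ is $b_1(\Gamma)+\sum_Vg(V)$. With $\mathrm{ov}(V)=\mathrm{val}(V)+3g(V)-3$, the expected dimension is $\#I+(r-3)(1-g)-\sum_V\mathrm{ov}(V)$, and $\Gamma$ is non-superabundant if it has no loops and no vertices of positive genus and the dimension of the space of tropical curves of its type is the expected one. Let $A_i\subset N_{\mathbb R}$ $(i\in I)$ be affine subspaces with rational slope and weights $w_i\in\mathbb Z_{>0}$, with parallel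 linear spaces $\mathbb L(A_i)$, and let $s_i\ge 0$ for those $i$ with $w(E_i)=0$. Suppose that $\Gamma$ is non-superabundant and rigid for these constraints: $h(E_i)\subset A_i$ for all $i$; $\mathrm{ov}(V)\ge\sum s_i$ at each vertex $V$, the sum running over the contracted $E_i\ni V$; and $\sum_i\mathrm{codim}(A_i)$ equals the expected dimension. Let $$\Phi:\prod_{V\in\Gamma^{[0]}}N\to\prod_{E\in\Gamma^{[1]}_c}N/(\mathbb Ru_E)_N\times\prod_{i\in I}N/\mathbb L(A_i)_N,\qquad H\mapsto\big((H_{\partial^+E}-H_{\partial^-E})_E,(H_{\partial E_i})_i\big),$$ $$\mathrm{Mult}(\Gamma)=[\mathrm{codomain}:\mathrm{im}\,\Phi]\cdot\prod_{E\in\Gamma_c^{[1]}}w(E)\cdot\prod_{i\in I}w_i,$$ where the index is read as $0$ if it is infinite (for generic translates $A_i$ it is finite). Let $\alpha_i\in\Lambda^{\mathrm{codim}A_i}M$ be the element of index $w_i$, unique up to sign, that vanishes along $\mathbb L(A_i)$ (that is, $w_i$ times the wedge product of a basis of the annihilator of $\mathbb L(A_i)$ in $M$), so that $\alpha_i^\Box\in\mathcal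 C_{\Delta(i)}$. **Theorem.** The TrQFT $F_{\mathrm{Mult}}$ exists, and if $\Gamma$ is regarded as a morphism from $(I,\overline\Delta)$ to $\emptyset$ in $\mathrm{Trop}$, then $$F_{\mathrm{Mult}}(\Gamma)\Big(\bigotimes_{i\in I}\alpha_i^\Box\Big)=\mathrm{Mult}(\Gamma)^2 .$$ -/

import Mathlib

open scoped TensorProduct

noncomputable section

namespace TropQFT

universe u

/-! ### Weighted directions up to sign, and the Frobenius algebras `C_n`

`N` is the cocharacter lattice, `Hom(N, ℚ) = N →ₗ[ℤ] ℚ` is `M ⊗ ℚ` for the dual lattice `M`. -/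

section Algebra

variable (N : Type u) [AddCommGroup N]

/-- The equivalence relation `n ~ ± n` on `N`. -/
def signSetoid : Setoid N where
  r a b := a = b ∨ a = -b
  iseqv :=
    { refl := fun _ => Or.inl rfl
      symm := by
        rintro a b (h | h)
        · exact Or.inl h.symm
        · exact Or.inr (by rw [h, neg_neg])
      trans := by
        rintro a b c (h | h) (h' | h')
        · exact Or.inl (h.trans h')
        · exact Or.inr (h.trans h')
        · exact Or.inr (by rw [h, h'])
        · exact Or.inl (by rw [h, h', neg_neg]) }

/-- `N / {± id}`, the set of weighted directions up to sign. -/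
def Nbar : Type u := Quotient (signSetoid N)

variable {N}

/-- The class of `n` in `N / {± id}`. -/
def Nbar.mk (n : N) : Nbar N := Quotient.mk (signSetoid N) n

/-- The class of `0`. -/
def Nbar.zero : Nbar N := Nbar.mk 0

/-- Evaluation at `n`, as a linear form on `M ⊗ ℚ = Hom(N, ℚ)`. -/
def evalAt (n : N) : (N →ₗ[ℤ] ℚ) →ₗ[ℚ] ℚ := LinearMap.applyₗ' ℚ n

/-- `n^⊥ ⊆ M ⊗ ℚ`; it only depends on `± n`. -/
def perp : Nbar N → Submodule ℚ (N →ₗ[ℤ] ℚ) :=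
  Quotient.lift (s := signSetoid N) (fun n => LinearMap.ker (evalAt n)) (by
    rintro a b (h | h)
    · rw [h]
    · ext m
      simp [h, evalAt])

theorem perp_le_perp_zero (c : Nbar N) : perp c ≤ perp (Nbar.zero : Nbar N) := by
  intro m _
  change m ∈ LinearMap.ker (evalAt (0 : N))
  simp [evalAt]

/-- The doubled space `n^⊥ ⊕ n^⊥`. -/
abbrev Dbl (c : Nbar N) : Type u := perp c × perp c

/-- The Frobenius algebra `C_n = Λ^*(n^⊥ ⊕ n^⊥)`. -/
abbrev Frob (c : Nbar N) : Type u := ExteriorAlgebra ℚ (Dbl c)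

/-- The inclusion `n^⊥ ⊕ n^⊥ ⊆ M ⊕ M`. -/
def dblIncl (c : Nbar N) : Dbl c →ₗ[ℚ] Dbl (Nbar.zero : Nbar N) :=
  (Submodule.inclusion (perp_le_perp_zero c)).prodMap
    (Submodule.inclusion (perp_le_perp_zero c))

/-- The inclusion `κ_n : C_n ⊆ C_0`. -/
def kappa (c : Nbar N) : Frob c →ₐ[ℚ] Frob (Nbar.zero : Nbar N) :=
  ExteriorAlgebra.map (dblIncl c)

/-- The linear form `(n, 0)` on `M ⊕ M`. -/
def pairFst (n : N) : Module.Dual ℚ (Dbl (Nbar.zero : Nbar N)) :=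
  evalAt n ∘ₗ (perp Nbar.zero).subtype ∘ₗ LinearMap.fst ℚ _ _

/-- The linear form `(0, n)` on `M ⊕ M`. -/
def pairSnd (n : N) : Module.Dual ℚ (Dbl (Nbar.zero : Nbar N)) :=
  evalAt n ∘ₗ (perp Nbar.zero).subtype ∘ₗ LinearMap.snd ℚ _ _

/-- The contraction `ι_{(n,0) ∧ (0,n)} : C_0 → C_0`, contracting first with `(n,0)` and then
with `(0,n)`.  In this order `ι_{(n,0) ∧ (0,n)} Θ_0^□ = k² Θ_n^□` for `n` of index `k`. -/
def contract (n : N) :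
    Frob (Nbar.zero : Nbar N) →ₗ[ℚ] Frob (Nbar.zero : Nbar N) :=
  (CliffordAlgebra.contractLeft (pairSnd n)) ∘ₗ (CliffordAlgebra.contractLeft (pairFst n))

/-- The squared element `(m, 0) ∧ (0, m)` of `C_0`. -/
def squareOne (m : N →ₗ[ℤ] ℚ) : Frob (Nbar.zero : Nbar N) :=
  ExteriorAlgebra.ι ℚ
      ((⟨m, by change m ∈ LinearMap.ker (evalAt (0 : N)); simp [evalAt]⟩, 0) : Dbl Nbar.zero) *
    ExteriorAlgebra.ι ℚ
      ((0, ⟨m, by change m ∈ LinearMap.ker (evalAt (0 : N)); simp [evalAt]⟩) : Dbl Nbar.zero)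

/-- The squared element `α^□ = (-1)^{d(d-1)/2} (α, 0) ∧ (0, α)` of `α ∈ Λ^d`. -/
def square {P : Type u} [AddCommGroup P] [Module ℚ P] (d : ℕ) (α : ExteriorAlgebra ℚ P) :
    ExteriorAlgebra ℚ (P × P) :=
  (-1 : ℚ) ^ (d * (d - 1) / 2) •
    (ExteriorAlgebra.map (LinearMap.inl ℚ P P) α * ExteriorAlgebra.map (LinearMap.inr ℚ P P) α)

variable [Module.Free ℤ N] [Module.Finite ℤ N]

/-- The linear forms `(ν_1, 0), (0, ν_1), (ν_2, 0), (0, ν_2), …` on `M ⊕ M`, for a lattice basis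
`ν_1, …, ν_r` of `N`, as the coordinates of one map to `ℚ^{2r}`. -/
def coords : Dbl (Nbar.zero : Nbar N) →ₗ[ℚ] (Fin (Module.finrank ℤ N * 2) → ℚ) :=
  LinearMap.pi fun a =>
    if (finProdFinEquiv.symm a).2 = 0 then
      pairFst (Module.finBasis ℤ N (finProdFinEquiv.symm a).1)
    else pairSnd (Module.finBasis ℤ N (finProdFinEquiv.symm a).1)

/-- The Frobenius trace of `C_0`: the projection to top degree `2r`, normalized by
`Θ_0^□ = (e_1, 0) ∧ (0, e_1) ∧ ⋯ ∧ (e_r, 0) ∧ (0, e_r) ↦ 1` for a lattice basis `e` of `M`. -/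
def trZero : Frob (Nbar.zero : Nbar N) →ₗ[ℚ] ℚ :=
  ExteriorAlgebra.liftAlternating
    (Pi.single (Module.finrank ℤ N * 2) (Matrix.detRowAlternating.compLinearMap coords))

open Classical in
/-- The Frobenius trace of `C_n`.  For `n ≠ 0` it is the linear form on `C_n`, supported in top
degree `2r - 2`, with `Tr_n (ι_{(n,0) ∧ (0,n)} Θ_0^□) = 1`.  It is computed as
`Tr_n b = Tr_0 ((m, 0) ∧ (0, m) ∧ b)` with any `m ∈ M ⊗ ℚ` such that `m(n) = 1`. -/
def tr (c : Nbar N) : Frob c →ₗ[ℚ] ℚ :=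
  if c = Nbar.zero then trZero ∘ₗ (kappa c).toLinearMap
  else
    trZero ∘ₗ
      LinearMap.mulLeft ℚ
        (squareOne (Classical.epsilon fun m : N →ₗ[ℤ] ℚ => m (Quotient.out c) = 1)) ∘ₗ
      (kappa c).toLinearMap

end Algebra

/-! ### Super tensor products -/

section State

variable {N : Type u} [AddCommGroup N]

/-- The (super) tensor product `⨂_{i ∈ I} C_{c i}` over an unordered finite index set, realized
as the exterior algebra of `⨁_{i ∈ I} (c(i)^⊥ ⊕ c(i)^⊥)`.  An elementary tensor `⨂ x_i`
is the product of the `x_i`, and the Koszul signs of the braiding are those of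
the exterior product. -/
abbrev State {I : Type} (c : I → Nbar N) : Type u :=
  ExteriorAlgebra ℚ ((i : I) → Dbl (c i))

open Classical in
/-- The inclusion of the `i`-th tensor factor. -/
def factor {I : Type} (c : I → Nbar N) (i : I) : Frob (c i) →ₐ[ℚ] State c :=
  ExteriorAlgebra.map (LinearMap.single ℚ (fun i => Dbl (c i)) i)

/-- The elementary tensor `⨂ x_i`.  It is used for even `x_i` only, for which the order of the
factors is irrelevant. -/
def tensor {I : Type} [Fintype I] (c : I → Nbar N) (x : (i : I) → Frob (c i)) : State c :=
  ((Finset.univ.toList (α := I)).map fun i => factor c i (x i)).prod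

/-- The parity involution of a super module. -/
def parity {I : Type} (c : I → Nbar N) : State c →ₐ[ℚ] State c :=
  ExteriorAlgebra.map (-LinearMap.id)

/-- The first tensor factor `⨂_I → ⨂_{I ⊔ I'}`. -/
def leftPart {I I' : Type} (c : I → Nbar N) (c' : I' → Nbar N) :
    State c →ₐ[ℚ] State (Sum.elim c c') :=
  ExteriorAlgebra.map
    (((LinearEquiv.sumPiEquivProdPi ℚ I I' fun x => Dbl (Sum.elim c c' x)).symm).toLinearMap ∘ₗ
      LinearMap.inl ℚ ((i : I) → Dbl (c i)) ((i : I') → Dbl (c' i)))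

/-- The second tensor factor `⨂_{I'} → ⨂_{I ⊔ I'}`. -/
def rightPart {I I' : Type} (c : I → Nbar N) (c' : I' → Nbar N) :
    State c' →ₐ[ℚ] State (Sum.elim c c') :=
  ExteriorAlgebra.map
    (((LinearEquiv.sumPiEquivProdPi ℚ I I' fun x => Dbl (Sum.elim c c' x)).symm).toLinearMap ∘ₗ
      LinearMap.inr ℚ ((i : I) → Dbl (c i)) ((i : I') → Dbl (c' i)))

/-- Relabelling tensor factors along a bijection (for instance the braiding). -/
def reindex {I J : Type} (σ : I ≃ J) (d : J → Nbar N) :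
    State (fun i => d (σ i)) →ₐ[ℚ] State d :=
  ExteriorAlgebra.map (LinearEquiv.piCongrLeft ℚ (fun j => Dbl (d j)) σ).toLinearMap

end State

/-! ### The category of tropical cobordisms -/

section Trop

variable {N : Type u} [AddCommGroup N]

/-- A tropical cobordism from `(I, c)` to `(J, d)`: a finite graph with edges `Edge`, each of whose
two ends is either
* attached to a vertex (this end is then one of the flags `f : Flag`, at the vertex `root f`), or
* a marked end, indexed by `I ⊔ J` (every mark is used exactly once), or
* one of the two sides of a joint.

Joints are auxiliary bivalent points in the interior of an edge.  They allow to glue two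
cobordisms end to end; cobordisms that differ by inserting joints are identified below.
Each edge has a weighted direction `dir` and each vertex a genus. -/
structure Cob {I J : Type} (c : I → Nbar N) (d : J → Nbar N) where
  Vert : Type
  Flag : Type
  Joint : Type
  Edge : Type
  finite_vert : Finite Vert
  finite_flag : Finite Flag
  finite_joint : Finite Joint
  finite_edge : Finite Edge
  root : Flag → Vert
  genus : Vert → ℕ
  dir : Edge → Nbar N
  ends : Edge × Bool ≃ Flag ⊕ (Joint × Bool) ⊕ (I ⊕ J)
  dir_in : ∀ i, dir (ends.symm (Sum.inr (Sum.inr (Sum.inl i)))).1 = c i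
  dir_out : ∀ j, dir (ends.symm (Sum.inr (Sum.inr (Sum.inr j)))).1 = d j
  dir_joint : ∀ j, dir (ends.symm (Sum.inr (Sum.inl (j, false)))).1 =
    dir (ends.symm (Sum.inr (Sum.inl (j, true)))).1

namespace Cob

variable {I J K : Type} {c : I → Nbar N} {d : J → Nbar N} {k : K → Nbar N}

/-- Isomorphism of tropical cobordisms (edges and joints may be reversed). -/
def IsIso (Γ Γ' : Cob c d) : Prop :=
  ∃ (a : Γ.Vert ≃ Γ'.Vert) (f : Γ.Flag ≃ Γ'.Flag) (j : Γ.Joint ≃ Γ'.Joint)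
    (e : Γ.Edge ≃ Γ'.Edge) (t : Γ.Joint × Bool ≃ Γ'.Joint × Bool)
    (s : Γ.Edge × Bool ≃ Γ'.Edge × Bool),
    (∀ x, (t x).1 = j x.1) ∧ (∀ x, (s x).1 = e x.1) ∧
    (∀ x, Γ'.root (f x) = a (Γ.root x)) ∧ (∀ v, Γ'.genus (a v) = Γ.genus v) ∧
    (∀ x, Γ'.dir (e x) = Γ.dir x) ∧
    ∀ x, Γ'.ends (s x) = Sum.map f (Sum.map t id) (Γ.ends x)

/-- `Γ'` is obtained from `Γ` by contracting a compact edge `e₀` of direction `0`, joining the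
vertices `root f₀` and `root f₁`, which are identified.  If they are distinct, their genera
are added, and if they agree, the genus increases by one. -/
def IsContraction (Γ Γ' : Cob c d) : Prop :=
  ∃ (e₀ : Γ.Edge) (f₀ f₁ : Γ.Flag) (p : Γ.Vert → Γ'.Vert)
    (e : Γ'.Edge ≃ {x : Γ.Edge // x ≠ e₀})
    (f : Γ'.Flag ≃ {x : Γ.Flag // x ≠ f₀ ∧ x ≠ f₁}) (j : Γ'.Joint ≃ Γ.Joint),
    Γ.dir e₀ = Nbar.zero ∧
    Γ.ends (e₀, false) = Sum.inl f₀ ∧ Γ.ends (e₀, true) = Sum.inl f₁ ∧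
    Function.Surjective p ∧
    (∀ x y, p x = p y ↔ x = y ∨ (x = Γ.root f₀ ∧ y = Γ.root f₁) ∨
      (x = Γ.root f₁ ∧ y = Γ.root f₀)) ∧
    (∀ v, v ≠ Γ.root f₀ → v ≠ Γ.root f₁ → Γ'.genus (p v) = Γ.genus v) ∧
    (Γ.root f₀ ≠ Γ.root f₁ →
      Γ'.genus (p (Γ.root f₀)) = Γ.genus (Γ.root f₀) + Γ.genus (Γ.root f₁)) ∧
    (Γ.root f₀ = Γ.root f₁ → Γ'.genus (p (Γ.root f₀)) = Γ.genus (Γ.root f₀) + 1) ∧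
    (∀ x, Γ'.root x = p (Γ.root (f x).1)) ∧
    (∀ x, Γ'.dir x = Γ.dir (e x).1) ∧
    ∀ x b, Γ.ends ((e x).1, b) =
      Sum.map (fun y => (f y).1) (Sum.map (Prod.map j id) id) (Γ'.ends (x, b))

/-- `Γ'` is obtained from `Γ` by erasing a joint `j₀` between two different edges `e₁`, `e₂`, which
become one edge.  (The edges and the joint are oriented so that the second end of
`e₁` meets the first end of `e₂`.) -/
def IsSmoothing (Γ Γ' : Cob c d) : Prop :=
  ∃ (j₀ : Γ.Joint) (e₁ e₂ : Γ.Edge) (a : Γ'.Vert ≃ Γ.Vert) (f : Γ'.Flag ≃ Γ.Flag)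
    (j : Γ'.Joint ≃ {x : Γ.Joint // x ≠ j₀}) (e : Γ'.Edge ≃ {x : Γ.Edge // x ≠ e₂}),
    e₁ ≠ e₂ ∧
    Γ.ends (e₁, true) = Sum.inr (Sum.inl (j₀, false)) ∧
    Γ.ends (e₂, false) = Sum.inr (Sum.inl (j₀, true)) ∧
    (∀ x, Γ.root (f x) = a (Γ'.root x)) ∧ (∀ v, Γ.genus (a v) = Γ'.genus v) ∧
    (∀ x, Γ'.dir x = Γ.dir (e x).1) ∧
    (∀ x b, ((e x).1 ≠ e₁ ∨ b = false) → Γ.ends ((e x).1, b) =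
      Sum.map f (Sum.map (Prod.map (fun y => (j y).1) id) id) (Γ'.ends (x, b))) ∧
    ∀ x, (e x).1 = e₁ → Γ.ends (e₂, true) =
      Sum.map f (Sum.map (Prod.map (fun y => (j y).1) id) id) (Γ'.ends (x, true))

/-- Equivalence of tropical cobordisms; the equivalence classes are the morphisms of `Trop`. -/
def Equivalent : Cob c d → Cob c d → Prop :=
  Relation.EqvGen fun Γ Γ' => IsIso Γ Γ' ∨ IsContraction Γ Γ' ∨ IsSmoothing Γ Γ'

/-- The bookkeeping bijection for gluing: the marks in `J` of both sides become joints. -/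
def glueEquiv (F₁ F₂ J₁ J₂ I J K : Type) :
    (F₁ ⊕ (J₁ × Bool) ⊕ (I ⊕ J)) ⊕ (F₂ ⊕ (J₂ × Bool) ⊕ (J ⊕ K)) ≃
      (F₁ ⊕ F₂) ⊕ ((J₁ ⊕ J₂ ⊕ J) × Bool) ⊕ (I ⊕ K) where
  toFun
    | .inl (.inl f) => .inl (.inl f)
    | .inl (.inr (.inl (j, b))) => .inr (.inl (.inl j, b))
    | .inl (.inr (.inr (.inl i))) => .inr (.inr (.inl i))
    | .inl (.inr (.inr (.inr j))) => .inr (.inl (.inr (.inr j), false))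
    | .inr (.inl f) => .inl (.inr f)
    | .inr (.inr (.inl (j, b))) => .inr (.inl (.inr (.inl j), b))
    | .inr (.inr (.inr (.inl j))) => .inr (.inl (.inr (.inr j), true))
    | .inr (.inr (.inr (.inr k))) => .inr (.inr (.inr k))
  invFun
    | .inl (.inl f) => .inl (.inl f)
    | .inl (.inr f) => .inr (.inl f)
    | .inr (.inl (.inl j, b)) => .inl (.inr (.inl (j, b)))
    | .inr (.inl (.inr (.inl j), b)) => .inr (.inr (.inl (j, b)))
    | .inr (.inl (.inr (.inr j), false)) => .inl (.inr (.inr (.inr j)))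
    | .inr (.inl (.inr (.inr j), true)) => .inr (.inr (.inr (.inl j)))
    | .inr (.inr (.inl i)) => .inl (.inr (.inr (.inl i)))
    | .inr (.inr (.inr k)) => .inr (.inr (.inr (.inr k)))
  left_inv := by
    rintro ((f | ⟨j, b⟩ | i | j) | (f | ⟨j, b⟩ | j | k)) <;> rfl
  right_inv := by
    rintro ((f | f) | ⟨j | j | j, _ | _⟩ | i | k) <;> rfl

/-- Composition: gluing the marked ends indexed by `J`. -/
def comp [Finite J] (Γ : Cob c d) (Γ' : Cob d k) : Cob c k where
  Vert := Γ.Vert ⊕ Γ'.Vert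
  Flag := Γ.Flag ⊕ Γ'.Flag
  Joint := Γ.Joint ⊕ Γ'.Joint ⊕ J
  Edge := Γ.Edge ⊕ Γ'.Edge
  finite_vert := have := Γ.finite_vert; have := Γ'.finite_vert; inferInstance
  finite_flag := have := Γ.finite_flag; have := Γ'.finite_flag; inferInstance
  finite_joint := have := Γ.finite_joint; have := Γ'.finite_joint; inferInstance
  finite_edge := have := Γ.finite_edge; have := Γ'.finite_edge; inferInstance
  root := Sum.map Γ.root Γ'.root
  genus := Sum.elim Γ.genus Γ'.genus
  dir := Sum.elim Γ.dir Γ'.dir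
  ends := (Equiv.sumProdDistrib Γ.Edge Γ'.Edge Bool).trans
    ((Equiv.sumCongr Γ.ends Γ'.ends).trans (glueEquiv _ _ _ _ _ _ _))
  dir_in i := Γ.dir_in i
  dir_out j := Γ'.dir_out j
  dir_joint := by
    rintro (j | j | j)
    · exact Γ.dir_joint j
    · exact Γ'.dir_joint j
    · exact (Γ.dir_out j).trans (Γ'.dir_in j).symm

/-- The bookkeeping bijection for disjoint unions. -/
def unionEquiv (F₁ F₂ J₁ J₂ I J I' J' : Type) :
    (F₁ ⊕ (J₁ × Bool) ⊕ (I ⊕ J)) ⊕ (F₂ ⊕ (J₂ × Bool) ⊕ (I' ⊕ J')) ≃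
      (F₁ ⊕ F₂) ⊕ ((J₁ ⊕ J₂) × Bool) ⊕ ((I ⊕ I') ⊕ (J ⊕ J')) where
  toFun
    | .inl (.inl f) => .inl (.inl f)
    | .inl (.inr (.inl (j, b))) => .inr (.inl (.inl j, b))
    | .inl (.inr (.inr (.inl i))) => .inr (.inr (.inl (.inl i)))
    | .inl (.inr (.inr (.inr j))) => .inr (.inr (.inr (.inl j)))
    | .inr (.inl f) => .inl (.inr f)
    | .inr (.inr (.inl (j, b))) => .inr (.inl (.inr j, b))
    | .inr (.inr (.inr (.inl i))) => .inr (.inr (.inl (.inr i)))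
    | .inr (.inr (.inr (.inr j))) => .inr (.inr (.inr (.inr j)))
  invFun
    | .inl (.inl f) => .inl (.inl f)
    | .inl (.inr f) => .inr (.inl f)
    | .inr (.inl (.inl j, b)) => .inl (.inr (.inl (j, b)))
    | .inr (.inl (.inr j, b)) => .inr (.inr (.inl (j, b)))
    | .inr (.inr (.inl (.inl i))) => .inl (.inr (.inr (.inl i)))
    | .inr (.inr (.inl (.inr i))) => .inr (.inr (.inr (.inl i)))
    | .inr (.inr (.inr (.inl j))) => .inl (.inr (.inr (.inr j)))
    | .inr (.inr (.inr (.inr j))) => .inr (.inr (.inr (.inr j)))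
  left_inv := by
    rintro ((f | ⟨j, b⟩ | i | j) | (f | ⟨j, b⟩ | i | j)) <;> rfl
  right_inv := by
    rintro ((f | f) | ⟨j | j, b⟩ | (i | i) | (j | j)) <;> rfl

/-- The monoidal product: disjoint union. -/
def union {I' J' : Type} {c' : I' → Nbar N} {d' : J' → Nbar N}
    (Γ : Cob c d) (Γ' : Cob c' d') : Cob (Sum.elim c c') (Sum.elim d d') where
  Vert := Γ.Vert ⊕ Γ'.Vert
  Flag := Γ.Flag ⊕ Γ'.Flag
  Joint := Γ.Joint ⊕ Γ'.Joint
  Edge := Γ.Edge ⊕ Γ'.Edge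
  finite_vert := have := Γ.finite_vert; have := Γ'.finite_vert; inferInstance
  finite_flag := have := Γ.finite_flag; have := Γ'.finite_flag; inferInstance
  finite_joint := have := Γ.finite_joint; have := Γ'.finite_joint; inferInstance
  finite_edge := have := Γ.finite_edge; have := Γ'.finite_edge; inferInstance
  root := Sum.map Γ.root Γ'.root
  genus := Sum.elim Γ.genus Γ'.genus
  dir := Sum.elim Γ.dir Γ'.dir
  ends := (Equiv.sumProdDistrib Γ.Edge Γ'.Edge Bool).trans
    ((Equiv.sumCongr Γ.ends Γ'.ends).trans (unionEquiv _ _ _ _ _ _ _ _))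
  dir_in := by
    rintro (i | i)
    · exact Γ.dir_in i
    · exact Γ'.dir_in i
  dir_out := by
    rintro (j | j)
    · exact Γ.dir_out j
    · exact Γ'.dir_out j
  dir_joint := by
    rintro (j | j)
    · exact Γ.dir_joint j
    · exact Γ'.dir_joint j

/-- The cobordism without vertices given by a bijection of index sets: one edge from `i` to `σ i`
for each `i`.  For `σ = id` this is the identity, and the braiding is of this form too. -/
def ofEquiv [Finite I] (σ : I ≃ J) (d : J → Nbar N) : Cob (fun i => d (σ i)) d where
  Vert := Empty
  Flag := Empty
  Joint := Empty
  Edge := I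
  finite_vert := inferInstance
  finite_flag := inferInstance
  finite_joint := inferInstance
  finite_edge := inferInstance
  root := Empty.elim
  genus := Empty.elim
  dir i := d (σ i)
  ends :=
    { toFun := fun
        | (i, false) => .inr (.inr (.inl i))
        | (i, true) => .inr (.inr (.inr (σ i)))
      invFun := fun
        | .inl x => x.elim
        | .inr (.inl x) => x.1.elim
        | .inr (.inr (.inl i)) => (i, false)
        | .inr (.inr (.inr j)) => (σ.symm j, true)
      left_inv := by rintro ⟨i, _ | _⟩ <;> simp
      right_inv := by rintro (x | x | i | j) <;> first | exact x.elim | exact x.1.elim | simp }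
  dir_in _ := rfl
  dir_out j := congrArg d (σ.apply_symm_apply j)
  dir_joint j := j.elim

/-- One vertex of genus `0` with incoming edges `I` and outgoing edges `J`. -/
def corolla [Finite I] [Finite J] (c : I → Nbar N) (d : J → Nbar N) : Cob c d where
  Vert := Unit
  Flag := I ⊕ J
  Joint := Empty
  Edge := I ⊕ J
  finite_vert := inferInstance
  finite_flag := inferInstance
  finite_joint := inferInstance
  finite_edge := inferInstance
  root _ := ()
  genus _ := 0
  dir := Sum.elim c d
  ends :=
    { toFun := fun
        | (x, false) => .inr (.inr x)
        | (x, true) => .inl x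
      invFun := fun
        | .inl x => (x, true)
        | .inr (.inl x) => x.1.elim
        | .inr (.inr x) => (x, false)
      left_inv := by rintro ⟨i, _ | _⟩ <;> rfl
      right_inv := by rintro (x | x | x) <;> first | exact x.1.elim | rfl }
  dir_in _ := rfl
  dir_out _ := rfl
  dir_joint j := j.elim

end Cob

/-- The empty object of `Trop`. -/
def emptyObj : Empty → Nbar N := Empty.elim

/-- The object `[n]` of `Trop`. -/
def oneObj (n : Nbar N) : Unit → Nbar N := fun _ => n

/-- The vertexless edge of direction `n`, as a cobordism from `[n] ⊔ [n]` to the empty object. -/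
def Cob.cap (n : Nbar N) : Cob (fun _ : Bool => n) (emptyObj : Empty → Nbar N) where
  Vert := Empty
  Flag := Empty
  Joint := Empty
  Edge := Unit
  finite_vert := inferInstance
  finite_flag := inferInstance
  finite_joint := inferInstance
  finite_edge := inferInstance
  root := Empty.elim
  genus := Empty.elim
  dir _ := n
  ends :=
    { toFun := fun x => .inr (.inr (.inl x.2))
      invFun := fun
        | .inl x => x.elim
        | .inr (.inl x) => x.1.elim
        | .inr (.inr (.inl b)) => ((), b)
        | .inr (.inr (.inr x)) => x.elim
      left_inv := by rintro ⟨_, _ | _⟩ <;> rfl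
      right_inv := by
        rintro (x | x | x | x) <;> first | exact x.elim | exact x.1.elim | rfl }
  dir_in _ := rfl
  dir_out j := j.elim
  dir_joint j := j.elim

end Trop

/-! ### Tropical quantum field theories -/

section QFT

variable (N : Type u) [AddCommGroup N]

/-- A two-dimensional tropical quantum field theory with `F([n]) = C_n`: a symmetric monoidal
functor from `Trop` to super `ℚ`-modules which sends `(I, c)` to `⨂_{i ∈ I} C_{c i}`.
It is given on representatives of morphisms and respects their equivalence. -/
structure TrQFT where
  map : ∀ {I J : Type} [Finite I] [Finite J] {c : I → Nbar N} {d : J → Nbar N},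
    Cob c d → (State c →ₗ[ℚ] State d)
  /-- The linear maps are even, that is, morphisms of super modules. -/
  map_parity : ∀ {I J : Type} [Finite I] [Finite J] {c : I → Nbar N} {d : J → Nbar N}
    (Γ : Cob c d) (x : State c), map Γ (parity c x) = parity d (map Γ x)
  /-- The value only depends on the morphism of `Trop`. -/
  map_equivalent : ∀ {I J : Type} [Finite I] [Finite J] {c : I → Nbar N} {d : J → Nbar N}
    (Γ Γ' : Cob c d), Cob.Equivalent Γ Γ' → map Γ = map Γ'
  /-- Compatibility with composition. -/
  map_comp : ∀ {I J K : Type} [Finite I] [Finite J] [Finite K]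
    {c : I → Nbar N} {d : J → Nbar N} {k : K → Nbar N} (Γ : Cob c d) (Γ' : Cob d k),
    map (Γ.comp Γ') = map Γ' ∘ₗ map Γ
  /-- Compatibility with identities, with relabelling of index sets and with the braiding. -/
  map_ofEquiv : ∀ {I J : Type} [Finite I] [Finite J] (σ : I ≃ J) (d : J → Nbar N),
    map (Cob.ofEquiv σ d) = (reindex σ d).toLinearMap
  /-- Compatibility with the monoidal products. -/
  map_union : ∀ {I J I' J' : Type} [Finite I] [Finite J] [Finite I'] [Finite J']
    {c : I → Nbar N} {d : J → Nbar N} {c' : I' → Nbar N} {d' : J' → Nbar N}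
    (Γ : Cob c d) (Γ' : Cob c' d') (x : State c) (y : State c'),
    map (Γ.union Γ') (leftPart c c' x * rightPart c c' y) =
      leftPart d d' (map Γ x) * rightPart d d' (map Γ' y)

variable {N}

/-- `C_n`, as the value at the one-element object `[n]`, is the exterior algebra `Λ^*(n^⊥ ⊕ n^⊥)`. -/
def evalOne (n : Nbar N) : State (oneObj n) →ₐ[ℚ] Frob n :=
  ExteriorAlgebra.map (LinearMap.proj (φ := fun _ : Unit => Dbl n) ())

variable [Module.Free ℤ N] [Module.Finite ℤ N]

/-- The multiplicity TrQFT `F_Mult`, that is, the TrQFT determined by the Frobenius algebras `C_n`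
together with the inclusions `κ_n : C_n → C_0` and the contractions `κ_n^∨ : C_0 → C_n`. -/
structure TrQFT.IsMult (F : TrQFT N) : Prop where
  /-- A vertex with any number of incoming edges of arbitrary directions and one outgoing edge of
  direction `0` is sent to `⨂ x_i ↦ ⋀ κ_{c i} (x_i)`.  This contains the unit of `C_0` (no
  incoming edge), its product (two incoming edges of direction `0`) and the maps `κ_n`
  (one incoming edge). -/
  map_vertex : ∀ {I : Type} [Fintype I] (c : I → Nbar N) (x : State c),
    evalOne Nbar.zero (F.map (Cob.corolla c (oneObj Nbar.zero)) x) =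
      ExteriorAlgebra.map (∑ i, dblIncl (c i) ∘ₗ LinearMap.proj (φ := fun i => Dbl (c i)) i) x
  /-- The counit of `C_0` is the Frobenius trace. -/
  map_counit : ∀ x : State (oneObj (Nbar.zero : Nbar N)),
    F.map (Cob.corolla (oneObj Nbar.zero) emptyObj) x =
      algebraMap ℚ _ (tr Nbar.zero (evalOne Nbar.zero x))
  /-- The pairing of `C_n` is `x ⊗ y ↦ Tr_n (x ∧ y)`. -/
  map_cap : ∀ (n : Nbar N) (x : State fun _ : Bool => n),
    F.map (Cob.cap n) x = algebraMap ℚ _ (tr n (ExteriorAlgebra.map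
      (LinearMap.proj (R := ℚ) (φ := fun _ : Bool => Dbl n) false +
        LinearMap.proj (R := ℚ) (φ := fun _ : Bool => Dbl n) true) x))
  /-- For `n ≠ 0` the map `κ_n^∨ : C_0 → C_n` is the contraction `ι_{(n,0) ∧ (0,n)}`. -/
  map_kappa_dual : ∀ n : N, n ≠ 0 → ∀ x : State (oneObj (Nbar.zero : Nbar N)),
    kappa (Nbar.mk n) (evalOne (Nbar.mk n)
      (F.map (Cob.corolla (oneObj Nbar.zero) (oneObj (Nbar.mk n))) x)) =
      contract n (evalOne Nbar.zero x)

end QFT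

/-! ### Tropical curves and their multiplicities -/

section Curves

variable (N : Type u) [AddCommGroup N]

/-- `n` is primitive: nonzero and not a multiple `k v` with `k ≥ 2`. -/
def IsPrimitiveVector (n : N) : Prop := n ≠ 0 ∧ ∀ (k : ℕ) (v : N), n = k • v → k = 1

open Classical in
/-- The type of a tropical curve in `N_ℝ = ℝ ⊗ N` with vertices `V`, compact edges `E` and
non-compact edges marked by `I`.  A compact edge `e` runs from `src e` to `tgt e`,
has weight `w e`, and primitive direction `u e` at `src e`, which is `-(u e)` at `tgt e`
(zero if the weight is zero); the non-compact edge `i` starts at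
`leg i` with weight `wLeg i` and direction `uLeg i`. -/
structure CurveType (V E I : Type) [Fintype V] [Fintype E] [Fintype I] where
  src : E → V
  tgt : E → V
  leg : I → V
  w : E → ℕ
  u : E → N
  wLeg : I → ℕ
  uLeg : I → N
  genus : V → ℕ
  nonempty : Nonempty V
  /-- The graph is connected. -/
  connected : ∀ v v', Relation.EqvGen (fun a b => ∃ e, src e = a ∧ tgt e = b) v v'
  primitive : ∀ e, 0 < w e → IsPrimitiveVector N (u e)
  contracted : ∀ e, w e = 0 → u e = 0
  primitive_leg : ∀ i, 0 < wLeg i → IsPrimitiveVector N (uLeg i)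
  contracted_leg : ∀ i, wLeg i = 0 → uLeg i = 0
  /-- Univalent and bivalent vertices have positive genus. -/
  stable : ∀ v, (Nat.card {e // src e = v} + Nat.card {e // tgt e = v} +
    Nat.card {i // leg i = v} = 1 ∨ Nat.card {e // src e = v} + Nat.card {e // tgt e = v} +
    Nat.card {i // leg i = v} = 2) → 0 < genus v
  /-- The balancing condition. -/
  balanced : ∀ v, (∑ e, if src e = v then w e • u e else 0) -
    (∑ e, if tgt e = v then w e • u e else 0) +
    (∑ i, if leg i = v then wLeg i • uLeg i else 0) = 0

variable {N}

/-- `n ↦ 1 ⊗ n`, the inclusion of `N` in `N_ℝ`. -/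
def toReal (n : N) : ℝ ⊗[ℤ] N := (1 : ℝ) ⊗ₜ[ℤ] n

/-- `W ∩ N` for a linear subspace `W` of `N_ℝ`. -/
def latticePart (W : Submodule ℝ (ℝ ⊗[ℤ] N)) : Submodule ℤ N :=
  (W.restrictScalars ℤ).comap (TensorProduct.mk ℤ ℝ N 1)

namespace CurveType

variable {V E I : Type} [Fintype V] [Fintype E] [Fintype I] (τ : CurveType N V E I)

/-- The valence of a vertex. -/
def val (v : V) : ℕ :=
  Nat.card {e // τ.src e = v} + Nat.card {e // τ.tgt e = v} + Nat.card {i // τ.leg i = v}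

/-- The over-valence `val v + 3 g(v) - 3` of a vertex. -/
def ov (v : V) : ℤ := τ.val v + 3 * τ.genus v - 3

/-- The genus `b_1 + ∑ g(v)`. -/
def totalGenus : ℤ :=
  (Fintype.card E : ℤ) - Fintype.card V + 1 + ∑ v, (τ.genus v : ℤ)

/-- The degree `Δ(i) = w(E_i) u_i`. -/
def degree (i : I) : N := τ.wLeg i • τ.uLeg i

/-- The face of the moduli space of tropical curves given by this type.  A tropical curve of
this type is given by the positions `h` of its vertices; the image of the edge `e` is the
segment from `h (src e)` in direction `u e` to `h (tgt e)` (a point if `u e = 0`). -/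
def face : Set (V → ℝ ⊗[ℤ] N) :=
  {h | ∀ e, ∃ l : ℝ, 0 < l ∧ h (τ.tgt e) = h (τ.src e) + l • toReal (τ.u e)}

/-- The expected dimension `#I + (r - 3)(1 - g) - ov`. -/
def expectedDim : ℤ :=
  Fintype.card I + ((Module.finrank ℤ N : ℤ) - 3) * (1 - τ.totalGenus) - ∑ v, τ.ov v

/-- Non-superabundant types: there are no (necessarily contracted) loops and no vertices of positive
genus, and the dimension of the face is the expected one. -/
def NonSuperabundant : Prop :=
  (∀ e, τ.src e ≠ τ.tgt e) ∧ (∀ v, τ.genus v = 0) ∧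
    (Module.finrank ℝ (vectorSpan ℝ τ.face) : ℤ) = τ.expectedDim

/-- The tropical curve with vertex positions `h` matches the constraints `A`, that is, the image of
the edge `E_i` is contained in `A_i` for all `i`. -/
def Matches (h : V → ℝ ⊗[ℤ] N) (A : I → AffineSubspace ℝ (ℝ ⊗[ℤ] N)) : Prop :=
  ∀ i, ∀ t : ℝ, 0 ≤ t → h (τ.leg i) + t • toReal (τ.uLeg i) ∈ A i

open Classical in
/-- The `ψ`-class conditions `s`, which are indexed by the contracted non-compact edges. -/
def SatisfiesPsi (s : {i // τ.wLeg i = 0} → ℕ) : Prop :=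
  ∀ v, (∑ i : {i // τ.wLeg i = 0}, if τ.leg i = v then (s i : ℤ) else 0) ≤ τ.ov v

/-- The tropical curve of type `τ` with vertex positions `h` is non-superabundant and rigid for the
constraints `A` and `s`. -/
structure IsRigid (h : V → ℝ ⊗[ℤ] N) (A : I → AffineSubspace ℝ (ℝ ⊗[ℤ] N))
    (s : {i // τ.wLeg i = 0} → ℕ) : Prop where
  mem_face : h ∈ τ.face
  nonSuperabundant : τ.NonSuperabundant
  matchesConstraints : τ.Matches h A
  psi : τ.SatisfiesPsi s
  codim : ∑ i, ((Module.finrank ℤ N : ℤ) - Module.finrank ℝ (A i).direction) = τ.expectedDim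

/-- The lattice map `Φ : ∏_V N → ∏_{compact E} N / L_N(E) × ∏_I N / L_N(A_i)`. -/
def Phi (A : I → AffineSubspace ℝ (ℝ ⊗[ℤ] N)) :
    (V → N) →ₗ[ℤ] ((e : E) → N ⧸ latticePart (Submodule.span ℝ {toReal (τ.u e)})) ×
      ((i : I) → N ⧸ latticePart (A i).direction) :=
  (LinearMap.pi fun e => (Submodule.mkQ _) ∘ₗ
      (LinearMap.proj (R := ℤ) (φ := fun _ : V => N) (τ.tgt e) -
        LinearMap.proj (R := ℤ) (φ := fun _ : V => N) (τ.src e))).prod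
    (LinearMap.pi fun i => (Submodule.mkQ _) ∘ₗ LinearMap.proj (R := ℤ) (φ := fun _ : V => N) (τ.leg i))

/-- The multiplicity `index(Φ) · ∏_{compact E} w(E) · ∏_I wt_i`, where `wt_i` is the weight of the
constraint `A_i`.  By the convention of Mathlib the index is `0` if it is infinite. -/
def mult (A : I → AffineSubspace ℝ (ℝ ⊗[ℤ] N)) (wt : I → ℕ) : ℕ :=
  (LinearMap.range (τ.Phi A)).toAddSubgroup.index * (∏ e, τ.w e) * ∏ i, wt i

/-- The degree of the curve as an object of `Trop`. -/
def obj : I → Nbar N := fun i => Nbar.mk (τ.degree i)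

/-- The morphism of `Trop` from the degree of the curve to the empty object that is defined by the
type of the curve: the same graph, with directions `± w(E) u_E`. -/
def cob : Cob τ.obj (emptyObj : Empty → Nbar N) where
  Vert := V
  Flag := (E × Bool) ⊕ I
  Joint := Empty
  Edge := E ⊕ I
  finite_vert := inferInstance
  finite_flag := inferInstance
  finite_joint := inferInstance
  finite_edge := inferInstance
  root := Sum.elim (fun x => if x.2 then τ.tgt x.1 else τ.src x.1) τ.leg
  genus := τ.genus
  dir := Sum.elim (fun e => Nbar.mk (τ.w e • τ.u e)) τ.obj
  ends :=
    { toFun := fun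
        | (.inl e, b) => .inl (.inl (e, b))
        | (.inr i, false) => .inr (.inr (.inl i))
        | (.inr i, true) => .inl (.inr i)
      invFun := fun
        | .inl (.inl (e, b)) => (.inl e, b)
        | .inl (.inr i) => (.inr i, true)
        | .inr (.inl x) => x.1.elim
        | .inr (.inr (.inl i)) => (.inr i, false)
        | .inr (.inr (.inr x)) => x.elim
      left_inv := by rintro ⟨_ | _, _ | _⟩ <;> rfl
      right_inv := by
        rintro ((_ | _) | x | _ | x) <;> first | exact x.1.elim | exact x.elim | rfl }
  dir_in _ := rfl
  dir_out j := j.elim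
  dir_joint j := j.elim

end CurveType

/-- Rational slope: the linear span of `A` is spanned by lattice vectors. -/
def HasRationalSlope (A : AffineSubspace ℝ (ℝ ⊗[ℤ] N)) : Prop :=
  Submodule.span ℝ (toReal '' (latticePart A.direction : Set N)) = A.direction

/-- The linear forms in the dual lattice `M` that vanish on `W ∩ N`. -/
def annLattice (W : Submodule ℝ (ℝ ⊗[ℤ] N)) : Submodule ℤ (Module.Dual ℤ N) :=
  (latticePart W).dualAnnihilator

/-- `M ⊆ M ⊗ ℚ`. -/
def toRat (m : Module.Dual ℤ N) : N →ₗ[ℤ] ℚ := (Algebra.linearMap ℤ ℚ) ∘ₗ m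

/-- `α ∈ Λ^d (c^⊥) ⊆ Λ^d M` is the element (unique up to sign) of index `wt` that vanishes on the
linear span of `A`: it is `wt` times the wedge product of a lattice basis of the annihilator
of `A` in `M`, of rank `d = codim A`. -/
def IsConstraintClass (A : AffineSubspace ℝ (ℝ ⊗[ℤ] N)) (wt : ℕ) (c : Nbar N) (d : ℕ)
    (α : ExteriorAlgebra ℚ (perp c)) : Prop :=
  ∃ (m : Module.Basis (Fin d) ℤ (annLattice A.direction))
    (hm : ∀ j, toRat (m j : Module.Dual ℤ N) ∈ perp c),
    α = (wt : ℚ) • ExteriorAlgebra.ιMulti ℚ d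
      (fun j => (⟨toRat (m j : Module.Dual ℤ N), hm j⟩ : perp c))

end Curves

end TropQFT

end

noncomputable section

namespace TropQFT

universe u

/-! ### Contractions, shears and central elements in exterior algebras -/

section Exterior

open ExteriorAlgebra

variable {R : Type*} [CommRing R] {M M' M'' : Type*} [AddCommGroup M] [Module R M]
  [AddCommGroup M'] [Module R M'] [AddCommGroup M''] [Module R M'']

/-! The theory is realized by Berezin integrals on graphs. Every point of a cobordism (vertex, joint
or mark) carries a copy of `n^⊥ ⊕ n^⊥`, where `n` is `0` at vertices and the direction of the edge
elsewhere, and one works in the exterior algebra of the direct sum of all these copies. An edge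
contributes the top-degree element of trace 1 of its own `n^⊥ ⊕ n^⊥`, embedded by the difference of
its two ends: a delta function that identifies the two ends along the edge. The value of a cobordism
is obtained by multiplying the input by all these delta functions and integrating over all points
except the outgoing marks. Integration is contraction with dual top-degree elements. Since the
spaces are doubled, all top degrees are even: the edge and volume elements are central and do not
change when a difference is negated, so neither orderings nor orientations have to be chosen.

Existence rests on the computation `act_cotopElt_delta`: integrating a delta function performs a
substitution. Hence, by `eval_eq_of_elim`, an integrated point attached to an edge of its own
direction can be removed together with that edge. This gives invariance under erasing joints and
under contracting an edge of direction `0` between distinct vertices, as well as the values on the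
elementary cobordisms. Fubini (`kernelOp_split`) gives compatibility with gluing and disjoint
unions. A loop of direction `0` has difference zero, so its delta function vanishes if the rank is
positive; accordingly vertices of positive genus are sent to zero. In rank zero all the algebras are
`ℚ` and no such vanishing occurs. The contraction `κ_n^∨` appears because the integral over `M ⊕ M`
is the contraction by `(n,0)` and `(0,n)` followed by the integral over `n^⊥ ⊕ n^⊥`
(`cotopElt_zero_eq`).

The second assertion concerns every theory with the given data, so it is shown that the data
determine the value on a joint-free cobordism of genus `0` without outgoing marks
(`determined_of_genus`). Such a cobordism is cut into edges and stars. A star is a vertex with one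
output of direction `0`, followed by the counit. An edge becomes a pairing when its outgoing marks
are folded to incoming ones, and it is recovered from the pairing by a zigzag relation and
nondegeneracy.

For a tropical curve the marks can be integrated away, which leaves an integral over the positions
of the vertices. The delta function of an edge is `w(E)^2` times the product of the squares of a
lattice basis of the annihilator of `u_E` (`topElt_mk_nsmul`), and `α_i^□` is `w_i^2` times the
product of the squares of a lattice basis of the annihilator of `A_i`. The dimension condition makes
the number of these linear forms equal to the rank of `N^V`. A product of that many squares is the
square of a determinant times the standard top element, once for each copy of `M`
(`list_ofFn_sqv_eq_det`). The determinant is that of `Φ` in lattice coordinates, so its absolute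
value is the index. If a compact edge is contracted, there are too many linear forms and both sides
vanish. -/

theorem ext_induction {P : ExteriorAlgebra R M → Prop} (one : P 1)
    (smul : ∀ (r : R) x, P x → P (r • x)) (add : ∀ x y, P x → P y → P (x + y))
    (mul : ∀ a x, P x → P (ι R a * x)) (x : ExteriorAlgebra R M) : P x := by
  induction x using CliffordAlgebra.left_induction with
  | algebraMap r => rw [Algebra.algebraMap_eq_smul_one]; exact smul r _ one
  | add x y hx hy => exact add x y hx hy
  | ι_mul x a hx => exact mul a x hx

/-- Contraction with a linear form. -/
def ctr (ξ : Module.Dual R M) : ExteriorAlgebra R M →ₗ[R] ExteriorAlgebra R M :=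
  CliffordAlgebra.contractLeft ξ

theorem ctr_one (ξ : Module.Dual R M) : ctr ξ (1 : ExteriorAlgebra R M) = 0 :=
  CliffordAlgebra.contractLeft_one _ _

theorem ctr_ι_mul (ξ : Module.Dual R M) (a : M) (x : ExteriorAlgebra R M) :
    ctr ξ (ι R a * x) = ξ a • x - ι R a * ctr ξ x :=
  CliffordAlgebra.contractLeft_ι_mul _ _ _

theorem ctr_ctr (ξ : Module.Dual R M) (x : ExteriorAlgebra R M) : ctr ξ (ctr ξ x) = 0 :=
  CliffordAlgebra.contractLeft_contractLeft _ _

theorem ctr_comm (ξ ξ' : Module.Dual R M) (x : ExteriorAlgebra R M) :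
    ctr ξ (ctr ξ' x) = -ctr ξ' (ctr ξ x) :=
  CliffordAlgebra.contractLeft_comm _ _ _

theorem map_map' (T : M →ₗ[R] M') (T' : M' →ₗ[R] M'') (x : ExteriorAlgebra R M) :
    map T' (map T x) = map (T' ∘ₗ T) x := by
  rw [← map_comp_map]; rfl

theorem map_id' (x : ExteriorAlgebra R M) : map (LinearMap.id : M →ₗ[R] M) x = x := by
  rw [map_id]; rfl

theorem map_ctr (T : M →ₗ[R] M') (ξ : Module.Dual R M') (x : ExteriorAlgebra R M) :
    map T (ctr (ξ ∘ₗ T) x) = ctr ξ (map T x) := by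
  induction x using ext_induction with
  | one => simp [ctr_one]
  | smul r x hx => simp [hx]
  | add x y hx hy => simp [hx, hy]
  | mul a x hx => simp [ctr_ι_mul, hx]

/-- `x ↦ x - ξ(x) w`. -/
def shear (w : M) (ξ : Module.Dual R M) : M →ₗ[R] M := LinearMap.id - ξ.smulRight w

theorem shear_apply (w : M) (ξ : Module.Dual R M) (a : M) : shear w ξ a = a - ξ a • w := rfl

/-- In the expansion of a product of vectors `a - ξ(a) w`, every term containing `w` twice vanishes.
Only the linear term survives, and it is a contraction. -/
theorem map_shear (w : M) (ξ : Module.Dual R M) (x : ExteriorAlgebra R M) :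
    map (shear w ξ) x = x - ι R w * ctr ξ x := by
  induction x using ext_induction with
  | one => simp [ctr_one]
  | smul r x hx => simp [hx, smul_sub]
  | add x y hx hy => simp [hx, hy, mul_add]; abel
  | mul a x hx =>
    have h : ι R a * ι R w = - (ι R w * ι R a) := eq_neg_of_add_eq_zero_left (ι_add_mul_swap a w)
    have h0 : ι R w * ι R w = 0 := ι_sq_zero w
    rw [map_mul, map_apply_ι, hx, ctr_ι_mul, shear_apply, map_sub, map_smul]
    simp only [sub_mul, mul_sub, smul_mul_assoc, mul_smul_comm, ← mul_assoc, h, h0]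
    simp
    abel

/-- The delta function in one odd variable: `w` forces the variable `ξ` to zero, and integrating it
out substitutes the projection along `w`. -/
theorem ctr_ι_mul_of_eq_one (w : M) (ξ : Module.Dual R M) (h : ξ w = 1) (x : ExteriorAlgebra R M) :
    ctr ξ (ι R w * x) = map (shear w ξ) x := by
  rw [ctr_ι_mul, h, one_smul, map_shear]

/-- The action of `Λ(W^*)` on `Λ(W)` by contractions. -/
def act : ExteriorAlgebra R (Module.Dual R M) →ₐ[R] Module.End R (ExteriorAlgebra R M) :=
  ExteriorAlgebra.lift R ⟨{
      toFun := ctr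
      map_add' := fun a b => by simp [ctr]
      map_smul' := fun a b => by simp [ctr] }, fun ξ => by
    exact LinearMap.ext fun x => ctr_ctr ξ x⟩

theorem act_ι (ξ : Module.Dual R M) : act (ι R ξ) = ctr ξ :=
  ExteriorAlgebra.lift_ι_apply R _ _ ξ

theorem act_ι_mul (ξ : Module.Dual R M) (ω : ExteriorAlgebra R (Module.Dual R M))
    (x : ExteriorAlgebra R M) : act (ι R ξ * ω) x = ctr ξ (act ω x) := by
  rw [map_mul, act_ι]; rfl

/-- The projection formula for integration: forms are pulled back while elements are pushed forward.
-/
theorem map_act (T : M →ₗ[R] M') (ω : ExteriorAlgebra R (Module.Dual R M'))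
    (x : ExteriorAlgebra R M) : map T (act (map T.dualMap ω) x) = act ω (map T x) := by
  induction ω using ext_induction generalizing x with
  | one => simp
  | smul r ω h => simp [h]
  | add ω ω' h h' => simp [h, h']
  | mul ξ ω h =>
    rw [map_mul, map_apply_ι, act_ι_mul, act_ι_mul, ← h, ← map_ctr]; rfl

/-- A central element of an exterior algebra. -/
def IsCentral (x : ExteriorAlgebra R M) : Prop := x ∈ Subalgebra.center R (ExteriorAlgebra R M)

theorem IsCentral.comm {x : ExteriorAlgebra R M} (h : IsCentral x) (y : ExteriorAlgebra R M) :
    y * x = x * y := Subalgebra.mem_center_iff.1 h y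

theorem isCentral_of_ι {x : ExteriorAlgebra R M} (h : ∀ a, ι R a * x = x * ι R a) :
    IsCentral x := by
  refine Subalgebra.mem_center_iff.2 fun y => ?_
  induction y using ext_induction with
  | one => simp
  | smul r y hy => simp [hy]
  | add y y' hy hy' => simp [hy, hy', add_mul, mul_add]
  | mul a y hy => rw [mul_assoc, hy, ← mul_assoc, h, mul_assoc]

theorem ι_mul_list_prod (l : List M) (a : M) :
    ι R a * (l.map (ι R)).prod = (-1 : R) ^ l.length • ((l.map (ι R)).prod * ι R a) := by
  induction l with
  | nil => simp
  | cons b l ih =>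
    have h : ι R a * ι R b = - (ι R b * ι R a) := eq_neg_of_add_eq_zero_left (ι_add_mul_swap a b)
    rw [List.map_cons, List.prod_cons, ← mul_assoc, h, neg_mul, mul_assoc, ih, List.length_cons,
      pow_succ, mul_smul_comm, mul_neg_one, neg_smul, mul_assoc]

theorem isCentral_list_prod {l : List M} (h : Even l.length) :
    IsCentral (l.map (ι R)).prod :=
  isCentral_of_ι fun a => by rw [ι_mul_list_prod, h.neg_one_pow, one_smul]

theorem isCentral_sq (a b : M) : IsCentral (ι R a * ι R b) := by
  simpa using isCentral_list_prod (R := R) (l := [a, b]) (by simp)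

theorem ctr_mul_of_ctr_eq_zero (ξ : Module.Dual R M) (a b : ExteriorAlgebra R M)
    (h : ctr ξ b = 0) : ctr ξ (a * b) = ctr ξ a * b := by
  induction a using ext_induction with
  | one => simp [h, ctr_one]
  | smul r y hy => simp [hy]
  | add y y' hy hy' => simp [hy, hy', add_mul]
  | mul c y hy => rw [mul_assoc, ctr_ι_mul, ctr_ι_mul, hy, sub_mul, smul_mul_assoc, mul_assoc]

theorem ctr_map_mul (ξ : Module.Dual R M) (S : M' →ₗ[R] M) (h : ξ ∘ₗ S = 0)
    (b : ExteriorAlgebra R M') (a : ExteriorAlgebra R M) :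
    ctr ξ (map S b * a) = map (-S) b * ctr ξ a := by
  induction b using ext_induction with
  | one => simp
  | smul r y hy => simp [hy]
  | add y y' hy hy' => simp [hy, hy', add_mul]
  | mul c y hy =>
    have hc : ξ (S c) = 0 := LinearMap.congr_fun h c
    simp [mul_assoc, ctr_ι_mul, hy, hc]

theorem ctr_map_eq_zero (ξ : Module.Dual R M) (S : M' →ₗ[R] M) (h : ξ ∘ₗ S = 0)
    (b : ExteriorAlgebra R M') : ctr ξ (map S b) = 0 := by
  simpa [ctr_one] using ctr_map_mul ξ S h b 1

/-- Each contraction anticommutes with the vectors it annihilates. The sign depends on the degree of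
`b`, so it is recorded by scaling `S`; it disappears for an even number of forms. -/
theorem act_list_map_mul (S : M' →ₗ[R] M) (l : List (Module.Dual R M)) (h : ∀ ξ ∈ l, ξ ∘ₗ S = 0)
    (b : ExteriorAlgebra R M') (a : ExteriorAlgebra R M) :
    act (l.map (ι R)).prod (map S b * a) =
      map ((-1 : R) ^ l.length • S) b * act (l.map (ι R)).prod a := by
  induction l with
  | nil => simp
  | cons ξ l ih =>
    rw [List.map_cons, List.prod_cons, act_ι_mul, act_ι_mul, ih fun ξ hξ => h ξ (by simp [hξ]),
      ctr_map_mul _ _ (by rw [LinearMap.comp_smul, h ξ (by simp), smul_zero]), List.length_cons,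
      pow_succ, mul_neg_one, neg_smul]

theorem act_list_mul_map (S : M' →ₗ[R] M) (l : List (Module.Dual R M)) (h : ∀ ξ ∈ l, ξ ∘ₗ S = 0)
    (b : ExteriorAlgebra R M') (a : ExteriorAlgebra R M) :
    act (l.map (ι R)).prod (a * map S b) = act (l.map (ι R)).prod a * map S b := by
  induction l with
  | nil => simp
  | cons ξ l ih =>
    rw [List.map_cons, List.prod_cons, act_ι_mul, act_ι_mul, ih fun ξ hξ => h ξ (by simp [hξ]),
      ctr_mul_of_ctr_eq_zero _ _ _ (ctr_map_eq_zero ξ S (h ξ (by simp)) b)]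

theorem map_list_prod_of_fixed (T : M →ₗ[R] M) (l : List M) (h : ∀ a ∈ l, T a = a) :
    map T (l.map (ι R)).prod = (l.map (ι R)).prod := by
  rw [map_list_prod, List.map_map]
  congr 1
  refine List.map_congr_left fun a ha => ?_
  simp [h a ha]

/-- The composite of the shears `x ↦ x - ξ(x) w` given by a list of pairs. -/
def shears (l : List (Module.Dual R M × M)) : M →ₗ[R] M :=
  l.foldr (fun p T => T ∘ₗ shear p.2 p.1) LinearMap.id

/-- Successive one-variable substitutions. The list of forms is reversed because the rightmost
operator acts first; the shear of the first pair fixes the later vectors, on which its form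
vanishes. -/
theorem act_list_delta (l : List (Module.Dual R M × M))
    (h1 : ∀ p ∈ l, p.1 p.2 = 1) (h2 : l.Pairwise fun p q => p.1 q.2 = 0)
    (x : ExteriorAlgebra R M) :
    act ((l.map Prod.fst).reverse.map (ι R)).prod (((l.map Prod.snd).map (ι R)).prod * x) =
      map (shears l) x := by
  induction l generalizing x with
  | nil => simp [shears]
  | cons p l ih =>
    obtain ⟨h2, h3⟩ := List.pairwise_cons.1 h2
    have : map (shears (p :: l)) x = map (shears l) (map (shear p.2 p.1) x) := by
      rw [map_map']; rfl
    rw [this, ← ih (fun q hq => h1 q (by simp [hq])) h3]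
    simp only [List.map_cons, List.reverse_cons, List.map_append, List.prod_append, map_mul,
      List.prod_cons, List.map_nil, List.prod_nil, mul_one, act_ι, mul_assoc]
    change act _ (ctr _ _) = _
    rw [ctr_ι_mul_of_eq_one _ _ (h1 p (by simp)), map_mul, map_list_prod_of_fixed]
    intro a ha
    obtain ⟨q, hq, rfl⟩ := List.mem_map.1 ha
    rw [shear_apply, h2 q hq, zero_smul, sub_zero]

end Exterior

/-! ### Top degree, the augmentation, and products of squares -/

section ExteriorTop

open ExteriorAlgebra Module

variable {R : Type*} [CommRing R] {M M' : Type*} [AddCommGroup M] [Module R M]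
  [AddCommGroup M'] [Module R M']

theorem ιMulti_eq_det_smul {k : ℕ} (e : Basis (Fin k) R M) (a : Fin k → M) :
    ιMulti R k a = e.det a • ιMulti R k e := by
  have : ιMulti R k =
      (LinearMap.toSpanSingleton R (ExteriorAlgebra R M) (ιMulti R k e)).compAlternatingMap
        e.det := by
    refine Basis.ext_alternating e fun v hv => ?_
    have hb : Function.Bijective v := Finite.injective_iff_bijective.1 hv
    obtain ⟨σ, rfl⟩ : ∃ σ : Equiv.Perm (Fin k), ⇑σ = v := ⟨Equiv.ofBijective v hb, rfl⟩
    have h1 := (ιMulti R k).map_perm e σ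
    have h2 := e.det.map_perm e σ
    simp only [LinearMap.compAlternatingMap_apply, LinearMap.toSpanSingleton_apply]
    change ιMulti R k (e ∘ σ) = e.det (e ∘ σ) • _
    rw [h1, h2, e.det_self]
    rcases Int.units_eq_one_or (Equiv.Perm.sign σ) with h | h <;> simp [h]
  conv_lhs => rw [this]
  rfl

/-- The top exterior power is one-dimensional, so a linear form supported there is known from its
value on one basis. -/
theorem functional_ext {k : ℕ} (e : Basis (Fin k) R M) {f g : ExteriorAlgebra R M →ₗ[R] R}
    (hf : ∀ m (v : Fin m → M), m ≠ k → f (ιMulti R m v) = 0)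
    (hg : ∀ m (v : Fin m → M), m ≠ k → g (ιMulti R m v) = 0)
    (h : f (ιMulti R k e) = g (ιMulti R k e)) : f = g := by
  refine lhom_ext fun m => ?_
  ext v
  simp only [LinearMap.compAlternatingMap_apply]
  by_cases hm : m = k
  · subst hm
    rw [ιMulti_eq_det_smul e v, map_smul, map_smul, h]
  · rw [hf m v hm, hg m v hm]

/-- The augmentation. -/
def eps : ExteriorAlgebra R M →ₐ[R] R := algebraMapInv

theorem map_zero_apply (x : ExteriorAlgebra R M) :
    map (0 : M →ₗ[R] M') x = algebraMap R _ (eps x) := by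
  induction x using ext_induction with
  | one => simp
  | smul r x hx => simp [hx, Algebra.smul_def]
  | add x y hx hy => simp [hx, hy]
  | mul a x hx => simp [eps, algebraMapInv]

theorem eps_map (T : M →ₗ[R] M') (x : ExteriorAlgebra R M) : eps (map T x) = eps x := by
  have h := map_zero_apply (M' := M) (map T x)
  rw [map_map', LinearMap.zero_comp, map_zero_apply] at h
  exact ((algebraMap_inj M _ _).1 h).symm

theorem ιMulti_eq_list {k : ℕ} (v : Fin k → M) :
    ιMulti R k v = ((List.ofFn v).map (ι R)).prod := by
  rw [ιMulti_apply, List.map_ofFn]; rfl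

theorem map_list (T : M →ₗ[R] M') (l : List M) :
    map T (l.map (ι R)).prod = ((l.map T).map (ι R)).prod := by
  rw [map_list_prod, List.map_map, List.map_map]
  congr 1
  exact List.map_congr_left fun a _ => by simp

theorem list_smul (c : R) (l : List M) :
    ((l.map fun a => c • a).map (ι R)).prod = c ^ l.length • (l.map (ι R)).prod := by
  induction l with
  | nil => simp
  | cons a l ih =>
    simp only [List.map_cons, List.prod_cons, ih, List.length_cons, map_smul, smul_mul_assoc,
      mul_smul_comm, smul_smul, pow_succ]

/-- A degree argument by scaling: multiplication by `2` on `X` scales the element by `2 ^ m` and the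
forms by `2 ^ l.length`, while the augmentation is invariant. -/
theorem eps_act_ιMulti_eq_zero {X : Type*} [AddCommGroup X] [Module ℚ X]
    (l : List (Module.Dual ℚ X)) {m : ℕ}
    (v : Fin m → X) (hm : m ≠ l.length) :
    eps (act (l.map (ι ℚ)).prod (ιMulti ℚ m v)) = 0 := by
  have h := map_act ((2 : ℚ) • LinearMap.id : X →ₗ[ℚ] X) (l.map (ι ℚ)).prod (ιMulti ℚ m v)
  have h1 : map ((2 : ℚ) • LinearMap.id : X →ₗ[ℚ] X).dualMap (l.map (ι ℚ)).prod =
      (2 : ℚ) ^ l.length • (l.map (ι ℚ)).prod := by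
    rw [map_list, ← list_smul]
    congr 2
    refine List.map_congr_left fun a _ => ?_
    ext x
    simp
  have h2 : map ((2 : ℚ) • LinearMap.id : X →ₗ[ℚ] X) (ιMulti ℚ m v) =
      (2 : ℚ) ^ m • ιMulti ℚ m v := by
    have := list_smul (2 : ℚ) (List.ofFn v)
    rw [List.length_ofFn] at this
    rw [ιMulti_eq_list, map_list, ← this]
    rfl
  rw [h1, h2] at h
  have h' := congrArg eps h
  rw [eps_map] at h'
  simp only [map_smul, LinearMap.smul_apply, smul_eq_mul] at h'
  have hne : (2 : ℚ) ^ l.length - 2 ^ m ≠ 0 := by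
    rw [sub_ne_zero]
    intro hh
    exact hm (pow_right_injective₀ (a := (2 : ℚ)) (by norm_num) (by norm_num) hh).symm
  have : ((2 : ℚ) ^ l.length - 2 ^ m) * eps (act (l.map (ι ℚ)).prod (ιMulti ℚ m v)) = 0 := by
    rw [sub_mul, h', sub_self]
  exact (mul_eq_zero.1 this).resolve_left hne

/-- Mutual orthogonality makes the composite of the shears additive: it subtracts all components at
once. -/
theorem shears_apply (l : List (Module.Dual R M × M))
    (h : l.Pairwise fun p q => p.1 q.2 = 0 ∧ q.1 p.2 = 0) (a : M) :
    shears l a = a - (l.map fun p => p.1 a • p.2).sum := by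
  induction l generalizing a with
  | nil => simp [shears]
  | cons p l ih =>
    obtain ⟨h2, h3⟩ := List.pairwise_cons.1 h
    have : shears (p :: l) a = shears l (shear p.2 p.1 a) := rfl
    rw [this, ih h3, shear_apply, List.map_cons, List.sum_cons, sub_sub]
    congr 3
    refine List.map_congr_left fun q hq => ?_
    simp [(h2 q hq).2]

/-- The square `(a, 0) ∧ (0, a)` for two embeddings `j₁`, `j₂`. -/
def sqv (j₁ j₂ : M →ₗ[R] M') (a : M) : ExteriorAlgebra R M' := ι R (j₁ a) * ι R (j₂ a)

theorem map_sqv {M'' : Type*} [AddCommGroup M''] [Module R M''] (T : M' →ₗ[R] M'')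
    (j₁ j₂ : M →ₗ[R] M') (a : M) : map T (sqv j₁ j₂ a) = sqv (T ∘ₗ j₁) (T ∘ₗ j₂) a := by
  simp [sqv]

theorem sqv_central (j₁ j₂ : M →ₗ[R] M') (a : M) : IsCentral (sqv j₁ j₂ a) := isCentral_sq _ _

/-- Moving each `j₂ a` to the right past the later first-copy vectors produces the triangular-number
sign, which is the sign in the definition of `square`. -/
theorem list_sqv (j₁ j₂ : M →ₗ[R] M') (l : List M) :
    (l.map (sqv j₁ j₂)).prod = (-1 : R) ^ (l.length * (l.length - 1) / 2) •
      (map j₁ (l.map (ι R)).prod * map j₂ (l.map (ι R)).prod) := by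
  induction l with
  | nil => simp
  | cons a l ih =>
    have hs : (l.length + 1) * (l.length + 1 - 1) / 2 =
        l.length * (l.length - 1) / 2 + l.length := by
      rw [← Finset.sum_range_id, ← Finset.sum_range_id, Finset.sum_range_succ]
    rw [List.map_cons, List.prod_cons, ih, List.length_cons, hs, List.map_cons, List.prod_cons,
      map_mul, map_mul, map_apply_ι, map_apply_ι, sqv, map_list, map_list, pow_add]
    have h := ι_mul_list_prod (R := R) (l.map j₁) (j₂ a)
    rw [List.length_map] at h
    have h2 : ((l.map j₁).map (ι R)).prod * ι R (j₂ a) =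
        (-1 : R) ^ l.length • (ι R (j₂ a) * ((l.map j₁).map (ι R)).prod) := by
      rw [h, smul_smul, ← mul_pow]; simp
    rw [mul_assoc (ι R (j₁ a)) _ (_ * _), ← mul_assoc _ (ι R (j₂ a)), h2, mul_smul_comm,
      smul_mul_assoc, mul_smul_comm, smul_smul]
    congr 1
    · rw [mul_assoc, ← mul_pow]; simp
    · simp only [mul_assoc]

theorem list_ofFn_sqv {k : ℕ} (j₁ j₂ : M →ₗ[R] M') (a : Fin k → M) :
    ((List.ofFn a).map (sqv j₁ j₂)).prod = (-1 : R) ^ (k * (k - 1) / 2) •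
      (map j₁ (ιMulti R k a) * map j₂ (ιMulti R k a)) := by
  rw [list_sqv, List.length_ofFn, ← ιMulti_eq_list]

/-- The determinant occurs once for each of the two copies; this is where the square of the
multiplicity comes from. -/
theorem list_ofFn_sqv_eq_det {k : ℕ} (j₁ j₂ : M →ₗ[R] M') (e : Basis (Fin k) R M)
    (a : Fin k → M) :
    ((List.ofFn a).map (sqv j₁ j₂)).prod =
      e.det a ^ 2 • ((List.ofFn e).map (sqv j₁ j₂)).prod := by
  rw [list_ofFn_sqv, list_ofFn_sqv, ιMulti_eq_det_smul e a, map_smul, map_smul, smul_mul_assoc,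
    mul_smul_comm, smul_smul, smul_smul, smul_smul]
  congr 1
  ring

end ExteriorTop

/-! ### Values and nonvanishing of the Frobenius traces -/

section Traces

open ExteriorAlgebra Module

variable {N : Type u} [AddCommGroup N]

/-- The identification of `M ⊗ ℚ` with `0^⊥`. -/
def toZero : (N →ₗ[ℤ] ℚ) →ₗ[ℚ] perp (Nbar.zero : Nbar N) :=
  LinearMap.codRestrict _ LinearMap.id fun m => by
    change m ∈ LinearMap.ker (evalAt (0 : N)); simp [evalAt]

/-- `m ↦ (m, 0)`. -/
def zeroFst : (N →ₗ[ℤ] ℚ) →ₗ[ℚ] Dbl (Nbar.zero : Nbar N) := LinearMap.inl ℚ _ _ ∘ₗ toZero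

/-- `m ↦ (0, m)`. -/
def zeroSnd : (N →ₗ[ℤ] ℚ) →ₗ[ℚ] Dbl (Nbar.zero : Nbar N) := LinearMap.inr ℚ _ _ ∘ₗ toZero

@[simp] theorem pairFst_zeroFst (n : N) (m : N →ₗ[ℤ] ℚ) : pairFst n (zeroFst m) = m n := rfl
@[simp] theorem pairSnd_zeroSnd (n : N) (m : N →ₗ[ℤ] ℚ) : pairSnd n (zeroSnd m) = m n := rfl
@[simp] theorem pairFst_zeroSnd (n : N) (m : N →ₗ[ℤ] ℚ) : pairFst n (zeroSnd m) = 0 := rfl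
@[simp] theorem pairSnd_zeroFst (n : N) (m : N →ₗ[ℤ] ℚ) : pairSnd n (zeroFst m) = 0 := rfl

theorem mem_perp_mk {n : N} {m : N →ₗ[ℤ] ℚ} : m ∈ perp (Nbar.mk n) ↔ m n = 0 := Iff.rfl

theorem mk_out (c : Nbar N) : Nbar.mk (Quotient.out c) = c := Quotient.out_eq c

theorem mk_eq_mk {a b : N} : Nbar.mk a = Nbar.mk b ↔ a = b ∨ a = -b :=
  Quotient.eq (r := signSetoid N)

theorem mk_eq_zero {a : N} : Nbar.mk a = Nbar.zero ↔ a = 0 := by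
  simp [Nbar.zero, mk_eq_mk]

theorem out_ne_zero {c : Nbar N} (hc : c ≠ Nbar.zero) : Quotient.out c ≠ 0 := by
  intro h
  apply hc
  rw [← mk_out c, h]; rfl

theorem kappa_zero_apply (x : Frob (Nbar.zero : Nbar N)) : kappa Nbar.zero x = x := by
  have : dblIncl (Nbar.zero : Nbar N) = LinearMap.id := rfl
  rw [kappa, this, map_id']

/-- `m ↦ (m, 0)` on `c^⊥`. -/
abbrev dblFst (c : Nbar N) : perp c →ₗ[ℚ] Dbl c := LinearMap.inl ℚ _ _

/-- `m ↦ (0, m)` on `c^⊥`. -/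
abbrev dblSnd (c : Nbar N) : perp c →ₗ[ℚ] Dbl c := LinearMap.inr ℚ _ _

theorem kappa_list_sqv (c : Nbar N) (l : List (perp c)) :
    kappa c (l.map (sqv (dblFst c) (dblSnd c))).prod =
      ((l.map (perp c).subtype).map (sqv zeroFst zeroSnd)).prod := by
  rw [map_list_prod, List.map_map, List.map_map]
  congr 1
  refine List.map_congr_left fun a _ => ?_
  simp only [Function.comp, kappa]
  rw [map_sqv]
  simp only [sqv]
  congr 2

variable [Module.Free ℤ N] [Module.Finite ℤ N]

variable (N) in
/-- The rational basis of `M ⊗ ℚ` dual to the chosen lattice basis. -/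
def latBasis : Basis (Fin (finrank ℤ N)) ℚ (N →ₗ[ℤ] ℚ) :=
  (Pi.basisFun ℚ _).map ((finBasis ℤ N).constr ℚ)

theorem latBasis_apply (i j) : latBasis N i (finBasis ℤ N j) = if i = j then 1 else 0 := by
  simp [latBasis, Pi.single_apply, eq_comm]

instance : FiniteDimensional ℚ (N →ₗ[ℤ] ℚ) := (latBasis N).finiteDimensional_of_finite

theorem finrank_hom : finrank ℚ (N →ₗ[ℤ] ℚ) = finrank ℤ N := by
  rw [finrank_eq_card_basis (latBasis N), Fintype.card_fin]

theorem trZero_ιMulti_of_ne {m : ℕ} (v : Fin m → Dbl (Nbar.zero : Nbar N))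
    (h : m ≠ finrank ℤ N * 2) : trZero (ιMulti ℚ m v) = 0 := by
  rw [trZero, liftAlternating_apply_ιMulti, Pi.single_eq_of_ne h]
  rfl

theorem trZero_list_of_ne (l : List (Dbl (Nbar.zero : Nbar N)))
    (h : l.length ≠ finrank ℤ N * 2) : trZero (l.map (ι ℚ)).prod = 0 := by
  have := trZero_ιMulti_of_ne l.get h
  rwa [ιMulti_eq_list, List.ofFn_get] at this

theorem trZero_latBasis :
    trZero ((List.ofFn (latBasis N)).map (sqv zeroFst zeroSnd)).prod = 1 := by
  have h : ((List.ofFn (latBasis N)).map (sqv zeroFst zeroSnd)).prod =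
      ιMulti ℚ (finrank ℤ N * 2) (fun a => if (finProdFinEquiv.symm a).2 = 0 then
        zeroFst (latBasis N (finProdFinEquiv.symm a).1)
        else zeroSnd (latBasis N (finProdFinEquiv.symm a).1)) := by
    rw [ιMulti_apply, List.ofFn_mul, List.prod_flatten, List.map_ofFn, List.map_ofFn]
    congr 2
    funext i
    -- The basis is interleaved: position `2 i + j` holds copy `j` of the `i`-th basis vector.
    have key : ∀ j : Fin 2, (finProdFinEquiv.symm (⟨i * 2 + j, by omega⟩ : Fin (finrank ℤ N * 2))) =
        (i, j) := by
      intro j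
      rw [Equiv.symm_apply_eq]
      ext
      simp [finProdFinEquiv]
      omega
    simp only [Function.comp_def, key]
    simp [sqv]
  rw [h, trZero, liftAlternating_apply_ιMulti, Pi.single_eq_same]
  change Matrix.det _ = 1
  rw [← Matrix.det_one (n := Fin (finrank ℤ N * 2)) (R := ℚ)]
  congr 1
  ext a b
  obtain ⟨⟨i, x⟩, rfl⟩ := finProdFinEquiv.surjective a
  obtain ⟨⟨j, y⟩, rfl⟩ := finProdFinEquiv.surjective b
  simp only [coords, LinearMap.pi_apply, Equiv.symm_apply_apply, Matrix.one_apply,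
    EmbeddingLike.apply_eq_iff_eq, Prod.mk.injEq]
  fin_cases x <;> fin_cases y <;> simp [latBasis_apply]

theorem trZero_sq (a : Fin (finrank ℤ N) → (N →ₗ[ℤ] ℚ)) :
    trZero ((List.ofFn a).map (sqv zeroFst zeroSnd)).prod = (latBasis N).det a ^ 2 := by
  rw [list_ofFn_sqv_eq_det _ _ (latBasis N), map_smul, trZero_latBasis, smul_eq_mul, mul_one]

theorem trZero_sq_list (l : List (N →ₗ[ℤ] ℚ)) (h : l.length = finrank ℤ N) :
    trZero (l.map (sqv zeroFst zeroSnd)).prod =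
      (latBasis N).det (fun i => l.get (i.cast h.symm)) ^ 2 := by
  rw [← trZero_sq]
  congr 3
  refine List.ext_get (by simp [h]) fun i h1 h2 => by simp

theorem exists_eval_eq_one {n : N} (hn : n ≠ 0) : ∃ m : N →ₗ[ℤ] ℚ, m n = 1 := by
  obtain ⟨i, hi⟩ : ∃ i, (finBasis ℤ N).repr n i ≠ 0 := by
    by_contra! h
    exact hn ((finBasis ℤ N).repr.map_eq_zero_iff.1 (Finsupp.ext h))
  refine ⟨((((finBasis ℤ N).repr n i : ℤ) : ℚ)⁻¹) •
    ((Algebra.linearMap ℤ ℚ) ∘ₗ (finBasis ℤ N).coord i), ?_⟩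
  simp [hi]

theorem tr_zero_apply (x : Frob (Nbar.zero : Nbar N)) : tr Nbar.zero x = trZero x := by
  rw [tr, if_pos rfl]
  simp [kappa_zero_apply]

/-- The trace is defined through a chosen representative of `± n`. If the representative is `-n`,
the auxiliary form is negated, which does not change its square. -/
theorem exists_tr_eq (n : N) (hn : n ≠ 0) : ∃ p : N →ₗ[ℤ] ℚ, p n = 1 ∧
    ∀ x, tr (Nbar.mk n) x = trZero (sqv zeroFst zeroSnd p * kappa (Nbar.mk n) x) := by
  have hc : Nbar.mk n ≠ Nbar.zero := fun h => hn (mk_eq_zero.1 h)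
  set q : N →ₗ[ℤ] ℚ :=
    Classical.epsilon fun m : N →ₗ[ℤ] ℚ => m (Quotient.out (Nbar.mk n)) = 1 with hq
  have h1 : q (Quotient.out (Nbar.mk n)) = 1 :=
    Classical.epsilon_spec (exists_eval_eq_one (out_ne_zero hc))
  have h2 : ∀ x, tr (Nbar.mk n) x = trZero (sqv zeroFst zeroSnd q * kappa (Nbar.mk n) x) := by
    intro x
    rw [tr, if_neg hc]; rfl
  rcases mk_eq_mk.1 (mk_out (Nbar.mk n)) with h | h
  · exact ⟨q, by rw [← h, h1], h2⟩
  · refine ⟨-q, ?_, fun x => ?_⟩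
    · have : q (-n) = 1 := by rw [← h, h1]
      simpa using this
    · rw [h2]; simp [sqv]

theorem finrank_perp {c : Nbar N} (hc : c ≠ Nbar.zero) :
    finrank ℚ (perp c) + 1 = finrank ℤ N := by
  obtain ⟨m, hm⟩ := exists_eval_eq_one (out_ne_zero hc)
  have hp : perp c = LinearMap.ker (evalAt (Quotient.out c)) := by
    conv_lhs => rw [← mk_out c]
    rfl
  have h := LinearMap.finrank_range_add_finrank_ker (evalAt (Quotient.out c) : (N →ₗ[ℤ] ℚ) →ₗ[ℚ] ℚ)
  rw [LinearMap.range_eq_top.2, finrank_top, finrank_self, finrank_hom, ← hp] at h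
  · omega
  · exact LinearMap.surjective fun h => by
      have := LinearMap.congr_fun h m
      simp only [evalAt] at this
      simp [hm] at this

theorem finrank_perp_zero : finrank ℚ (perp (Nbar.zero : Nbar N)) = finrank ℤ N := by
  rw [← finrank_hom]
  have : perp (Nbar.zero : Nbar N) = ⊤ := by
    rw [eq_top_iff]
    intro m _
    exact (toZero m).2
  rw [this, finrank_top]

theorem finrank_dbl (c : Nbar N) : finrank ℚ (Dbl c) = finrank ℚ (perp c) * 2 := by
  rw [finrank_prod, mul_two]

theorem tr_list_of_ne (c : Nbar N) (l : List (Dbl c)) (h : l.length ≠ finrank ℚ (Dbl c)) :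
    tr c (l.map (ι ℚ)).prod = 0 := by
  rw [finrank_dbl] at h
  by_cases hc : c = Nbar.zero
  · subst hc
    rw [finrank_perp_zero] at h
    rw [tr_zero_apply, trZero_list_of_ne _ h]
  · obtain ⟨p, -, hp⟩ := exists_tr_eq (Quotient.out c) (out_ne_zero hc)
    rw [mk_out] at hp
    rw [hp, kappa, map_list, sqv, mul_assoc, ← List.prod_cons, ← List.map_cons, ← List.prod_cons,
      ← List.map_cons, trZero_list_of_ne]
    have := finrank_perp hc
    simp only [List.length_cons, List.length_map]
    omega

theorem tr_ιMulti_of_ne (c : Nbar N) {m : ℕ} (v : Fin m → Dbl c) (h : m ≠ finrank ℚ (Dbl c)) :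
    tr c (ιMulti ℚ m v) = 0 := by
  rw [ιMulti_eq_list]
  exact tr_list_of_ne c _ (by simpa using h)

/-- A form with value 1 on the direction completes a basis of the hyperplane `c^⊥` to a basis of `M
⊗ ℚ`, and the trace of the product of squares of that basis is a nonzero determinant squared. -/
theorem tr_ne_zero (c : Nbar N) : tr c ≠ 0 := by
  intro h0
  by_cases hc : c = Nbar.zero
  · subst hc
    have := trZero_latBasis (N := N)
    rw [← tr_zero_apply, h0] at this
    simp at this
  · obtain ⟨p, hp1, hp⟩ := exists_tr_eq (Quotient.out c) (out_ne_zero hc)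
    rw [mk_out] at hp
    set b := finBasis ℚ (perp c)
    have h := hp ((List.ofFn b).map (sqv (dblFst c) (dblSnd c))).prod
    rw [h0, kappa_list_sqv, List.map_ofFn (g := (perp c).subtype), ← List.prod_cons, ← List.map_cons,
      ← List.ofFn_cons] at h
    have hr := finrank_perp hc
    rw [trZero_sq_list _ (by simpa using hr)] at h
    have hli : LinearIndependent ℚ
        (Fin.cons p ((perp c).subtype ∘ b) : Fin (finrank ℚ (perp c) + 1) → _) := by
      refine linearIndependent_finCons.2
        ⟨b.linearIndependent.map' (perp c).subtype (Submodule.ker_subtype _), fun hmem => ?_⟩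
      have : p ∈ perp c := by
        refine (Submodule.span_le.2 ?_) hmem
        rintro _ ⟨i, rfl⟩
        exact (b i).2
      rw [← mk_out c, mem_perp_mk, hp1] at this
      exact one_ne_zero this
    have : Nonempty (Fin (finrank ℤ N)) := ⟨⟨0, by omega⟩⟩
    have hli' := hli.comp (Fin.cast hr.symm) (Fin.cast_injective _)
    have hu := (latBasis N).isUnit_det (basisOfLinearIndependentOfCardEqFinrank hli' (by
      rw [Fintype.card_fin, finrank_hom]))
    rw [coe_basisOfLinearIndependentOfCardEqFinrank] at hu
    have h' := pow_eq_zero_iff (two_ne_zero) |>.1 h.symm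
    refine hu.ne_zero ?_
    rw [← h']
    congr 1
    funext i
    rw [List.get_ofFn]
    rfl

end Traces

/-! ### Unordered products of central elements -/

section CentralProducts

open ExteriorAlgebra Module

variable {W W' : Type*} [AddCommGroup W] [Module ℚ W] [AddCommGroup W'] [Module ℚ W']

/-- The product of a finite family of central elements. -/
def centralProd {E : Type*} [Finite E] (f : E → ExteriorAlgebra ℚ W) (hf : ∀ e, IsCentral (f e)) :
    ExteriorAlgebra ℚ W :=
  letI := Fintype.ofFinite E
  ((∏ e, (⟨f e, hf e⟩ : Subalgebra.center ℚ (ExteriorAlgebra ℚ W)) :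
    Subalgebra.center ℚ (ExteriorAlgebra ℚ W)) : ExteriorAlgebra ℚ W)

section

variable {E E₁ E₂ : Type*} [Finite E] [Finite E₁] [Finite E₂]
  (f : E → ExteriorAlgebra ℚ W) (hf : ∀ e, IsCentral (f e))

theorem centralProd_eq [Fintype E] : centralProd f hf =
    ((∏ e, (⟨f e, hf e⟩ : Subalgebra.center ℚ (ExteriorAlgebra ℚ W)) :
    Subalgebra.center ℚ (ExteriorAlgebra ℚ W)) : ExteriorAlgebra ℚ W) := by
  unfold centralProd
  congr!

theorem centralProd_central : IsCentral (centralProd f hf) := by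
  have := Fintype.ofFinite E
  rw [centralProd_eq]
  exact Subtype.property _

theorem centralProd_equiv {f' : E₁ → ExteriorAlgebra ℚ W} (hf' : ∀ e, IsCentral (f' e))
    (σ : E ≃ E₁) (h : ∀ e, f e = f' (σ e)) : centralProd f hf = centralProd f' hf' := by
  have := Fintype.ofFinite E
  have := Fintype.ofFinite E₁
  rw [centralProd_eq, centralProd_eq]
  congr 1
  exact Fintype.prod_equiv σ _ _ fun e => Subtype.ext (h e)

theorem centralProd_sum (σ : E₁ ⊕ E₂ ≃ E) : centralProd f hf =
    centralProd (fun e => f (σ (.inl e))) (fun _ => hf _) *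
      centralProd (fun e => f (σ (.inr e))) (fun _ => hf _) := by
  have := Fintype.ofFinite E
  have := Fintype.ofFinite E₁
  have := Fintype.ofFinite E₂
  rw [centralProd_eq, centralProd_eq, centralProd_eq]
  rw [← Fintype.prod_equiv σ (fun e => (⟨f (σ e), hf _⟩ : Subalgebra.center ℚ _)) _ fun e => rfl,
    Fintype.prod_sum_type]
  rfl

theorem centralProd_isEmpty [IsEmpty E] : centralProd f hf = 1 := by
  have := Fintype.ofFinite E
  rw [centralProd_eq, Fintype.prod_empty]
  rfl

theorem centralProd_unique [Unique E] : centralProd f hf = f default := by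
  rw [centralProd_eq, Fintype.prod_unique]

theorem centralProd_one (h : ∀ e, f e = 1) : centralProd f hf = 1 := by
  have := Fintype.ofFinite E
  rw [centralProd_eq, Finset.prod_eq_one]
  · rfl
  · intro e _
    exact Subtype.ext (h e)

theorem centralProd_eq_zero (e : E) (h : f e = 0) : centralProd f hf = 0 := by
  have := Fintype.ofFinite E
  rw [centralProd_eq, Finset.prod_eq_zero (Finset.mem_univ e)]
  · rfl
  · exact Subtype.ext h

theorem centralProd_induction {P : ExteriorAlgebra ℚ W → Prop} (h1 : P 1)
    (hmul : ∀ e x, P x → P (f e * x)) : P (centralProd f hf) := by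
  have := Fintype.ofFinite E
  classical
  rw [centralProd_eq]
  suffices H : ∀ s : Finset E, P ((∏ e ∈ s, (⟨f e, hf e⟩ : Subalgebra.center ℚ _) :
      Subalgebra.center ℚ _) : ExteriorAlgebra ℚ W) from H _
  intro s
  induction s using Finset.induction_on with
  | empty => simpa using h1
  | insert a s ha ih =>
    rw [Finset.prod_insert ha]
    exact hmul a _ ih

theorem map_centralProd (T : ExteriorAlgebra ℚ W →ₐ[ℚ] ExteriorAlgebra ℚ W')
    (hf' : ∀ e, IsCentral (T (f e))) :
    T (centralProd f hf) = centralProd (fun e => T (f e)) hf' := by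
  have := Fintype.ofFinite E
  classical
  rw [centralProd_eq, centralProd_eq]
  suffices H : ∀ s : Finset E, T ((∏ e ∈ s, (⟨f e, hf e⟩ : Subalgebra.center ℚ _) :
      Subalgebra.center ℚ _) : ExteriorAlgebra ℚ W) =
      ((∏ e ∈ s, (⟨T (f e), hf' e⟩ : Subalgebra.center ℚ _) :
      Subalgebra.center ℚ _) : ExteriorAlgebra ℚ W') from H _
  intro s
  induction s using Finset.induction_on with
  | empty => simp
  | insert a s ha ih =>
    rw [Finset.prod_insert ha, Finset.prod_insert ha]
    simp [ih]

end

end CentralProducts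

/-! ### Delta functions and volume elements -/

section TopElements

open ExteriorAlgebra Module

variable {N : Type u} [AddCommGroup N] [Module.Free ℤ N] [Module.Finite ℤ N]
variable {W W' : Type*} [AddCommGroup W] [Module ℚ W] [AddCommGroup W'] [Module ℚ W']

/-- An auxiliary basis of `c^⊥ ⊕ c^⊥`. -/
def dblBasis (c : Nbar N) : Basis (Fin (finrank ℚ (Dbl c))) ℚ (Dbl c) := finBasis ℚ (Dbl c)

/-- The trace of the product of the auxiliary basis. -/
def volScale (c : Nbar N) : ℚ := tr c (ιMulti ℚ _ (dblBasis c))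

theorem volScale_ne_zero (c : Nbar N) : volScale c ≠ 0 := by
  intro h
  exact tr_ne_zero c (functional_ext (dblBasis c) (fun m v hm => tr_ιMulti_of_ne c v hm)
    (fun _ _ _ => rfl) h)

/-- The element of top degree of trace `1`. -/
def topElt (c : Nbar N) : Frob c :=
  (volScale c)⁻¹ • ((List.ofFn (dblBasis c)).map (ι ℚ)).prod

/-- The element of top degree of `Λ((c^⊥ ⊕ c^⊥)^*)` dual to `topElt`. -/
def cotopElt (c : Nbar N) : ExteriorAlgebra ℚ (Dual ℚ (Dbl c)) :=
  volScale c • ((List.ofFn (dblBasis c).coord).reverse.map (ι ℚ)).prod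

/-- This parity is what makes top-degree elements central and independent of orientation. -/
theorem even_finrank_dbl (c : Nbar N) : Even (finrank ℚ (Dbl c)) := by
  rw [finrank_dbl]; exact even_two.mul_left _

theorem IsCentral.smul {x : ExteriorAlgebra ℚ W} (h : IsCentral x) (r : ℚ) : IsCentral (r • x) :=
  Subalgebra.smul_mem _ h r

theorem map_topElt_central {c : Nbar N} (S : Dbl c →ₗ[ℚ] W) : IsCentral (map S (topElt c)) := by
  rw [topElt, map_smul, map_list]
  refine (isCentral_list_prod ?_).smul _
  simp

theorem map_cotopElt_central {c : Nbar N} (S : Dual ℚ (Dbl c) →ₗ[ℚ] W) :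
    IsCentral (map S (cotopElt c)) := by
  rw [cotopElt, map_smul, map_list]
  refine (isCentral_list_prod ?_).smul _
  simp

theorem map_even_neg {l : List W} (h : Even l.length) (S : W →ₗ[ℚ] W') :
    map (-S) (l.map (ι ℚ)).prod = map S (l.map (ι ℚ)).prod := by
  have h1 := list_smul (-1 : ℚ) (l.map S)
  rw [List.length_map, h.neg_one_pow, one_smul] at h1
  rw [map_list, map_list, ← h1, List.map_map (f := S)]
  congr 2
  exact List.map_congr_left fun a _ => by simp [Function.comp]

/-- Reversing an edge negates the difference of its ends; in even degree this has no effect. -/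
theorem map_neg_topElt {c : Nbar N} (S : Dbl c →ₗ[ℚ] W) :
    map (-S) (topElt c) = map S (topElt c) := by
  rw [topElt, map_smul, map_smul, map_even_neg]
  simp

theorem map_neg_cotopElt {c : Nbar N} (S : Dual ℚ (Dbl c) →ₗ[ℚ] W) :
    map (-S) (cotopElt c) = map S (cotopElt c) := by
  rw [cotopElt, map_smul, map_smul, map_even_neg]
  simp

/-- The defining property of a delta function: integrating over `π` against the delta function along
`s` substitutes the projection with image `ker π` along the image of `s`. The normalizations of
`topElt` and `cotopElt` are inverse to each other. -/
theorem act_cotopElt_delta {c : Nbar N} (π : W →ₗ[ℚ] Dbl c) (s : Dbl c →ₗ[ℚ] W)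
    (h : π ∘ₗ s = LinearMap.id) (x : ExteriorAlgebra ℚ W) :
    act (map π.dualMap (cotopElt c)) (map s (topElt c) * x) =
      map (LinearMap.id - s ∘ₗ π) x := by
  set b := dblBasis c with hb
  have hps : ∀ y, π (s y) = y := fun y => LinearMap.congr_fun h y
  set l : List (Dual ℚ W × W) := List.ofFn fun i => (b.coord i ∘ₗ π, s (b i)) with hl
  have horth : l.Pairwise fun p q => p.1 q.2 = 0 ∧ q.1 p.2 = 0 := by
    rw [hl, List.pairwise_ofFn]
    intro i j hij
    simp [hps, hij.ne, hij.ne']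
  have key := act_list_delta l (by
    intro p hp
    obtain ⟨i, rfl⟩ := List.mem_ofFn.1 hp
    simp [hps]) (horth.imp fun h => h.1) x
  have hS : shears l = LinearMap.id - s ∘ₗ π := by
    ext a
    rw [shears_apply l horth, hl, List.map_ofFn, List.sum_ofFn]
    simp only [Function.comp, LinearMap.sub_apply, LinearMap.id_apply, LinearMap.comp_apply]
    congr 1
    conv_rhs => rw [← b.sum_repr (π a), map_sum]
    simp
  rw [hS] at key
  rw [← key, cotopElt, topElt, map_smul, map_smul, map_smul, map_list, map_list]
  have e1 : (List.ofFn b.coord).reverse.map π.dualMap = (l.map Prod.fst).reverse := by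
    rw [List.map_reverse, hl, List.map_ofFn, List.map_ofFn]
    rfl
  have e2 : (List.ofFn b).map s = l.map Prod.snd := by
    rw [hl, List.map_ofFn, List.map_ofFn]
    rfl
  rw [e1, e2, smul_mul_assoc, LinearMap.smul_apply, map_smul, smul_smul,
    mul_inv_cancel₀ (volScale_ne_zero c), one_smul]

/-- Both sides are supported in top degree, so it suffices to compare them on one basis, where the
delta function property applies. It identifies the trace with integration. -/
theorem eps_act_cotopElt (c : Nbar N) (x : Frob c) : eps (act (cotopElt c) x) = tr c x := by
  have : eps.toLinearMap ∘ₗ act (cotopElt c) = tr c := by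
    refine functional_ext (dblBasis c) (fun m v hm => ?_)
      (fun m v hm => tr_ιMulti_of_ne c v hm) ?_
    · simp only [LinearMap.comp_apply, cotopElt, map_smul, LinearMap.smul_apply]
      change volScale c • eps (act _ _) = 0
      rw [eps_act_ιMulti_eq_zero, smul_zero]
      simpa using hm
    · have h := act_cotopElt_delta (LinearMap.id : Dbl c →ₗ[ℚ] Dbl c) LinearMap.id rfl 1
      rw [map_one, mul_one] at h
      have h2 : (LinearMap.id : Dbl c →ₗ[ℚ] Dbl c).dualMap = LinearMap.id := rfl
      rw [h2, map_id', map_id', topElt, map_smul] at h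
      rw [LinearMap.comp_apply, ιMulti_eq_list]
      rw [inv_smul_eq_iff₀ (volScale_ne_zero c)] at h
      rw [h]
      change eps (volScale c • (1 : ExteriorAlgebra ℚ (Dbl c))) = _
      rw [map_smul, map_one, smul_eq_mul, mul_one, volScale, ιMulti_eq_list]
  exact LinearMap.congr_fun this x

/-- A factor that does not involve the integrated variables can be taken out of the integral,
without sign because the number of contractions is even. -/
theorem act_map_cotopElt_map_mul {c : Nbar N} (π : W →ₗ[ℚ] Dbl c) (S : W' →ₗ[ℚ] W)
    (h : π ∘ₗ S = 0) (b : ExteriorAlgebra ℚ W') (a : ExteriorAlgebra ℚ W) :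
    act (map π.dualMap (cotopElt c)) (map S b * a) =
      map S b * act (map π.dualMap (cotopElt c)) a := by
  rw [cotopElt, map_smul, map_list, map_smul, LinearMap.smul_apply, LinearMap.smul_apply,
    act_list_map_mul, List.length_map, List.length_reverse, List.length_ofFn,
    (even_finrank_dbl c).neg_one_pow, one_smul, mul_smul_comm]
  intro ξ hξ
  obtain ⟨η, -, rfl⟩ := List.mem_map.1 hξ
  rw [LinearMap.dualMap_apply', LinearMap.comp_assoc, h, LinearMap.comp_zero]

theorem act_map_cotopElt_mul_map {c : Nbar N} (π : W →ₗ[ℚ] Dbl c) (S : W' →ₗ[ℚ] W)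
    (h : π ∘ₗ S = 0) (b : ExteriorAlgebra ℚ W') (a : ExteriorAlgebra ℚ W) :
    act (map π.dualMap (cotopElt c)) (a * map S b) =
      act (map π.dualMap (cotopElt c)) a * map S b := by
  rw [cotopElt, map_smul, map_list, map_smul, LinearMap.smul_apply, LinearMap.smul_apply,
    act_list_mul_map, smul_mul_assoc]
  intro ξ hξ
  obtain ⟨η, -, rfl⟩ := List.mem_map.1 hξ
  rw [LinearMap.dualMap_apply', LinearMap.comp_assoc, h, LinearMap.comp_zero]

end TopElements

/-! ### Integral operators given by edges and integrated points -/

section Operators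

open ExteriorAlgebra Module

variable {N : Type u} [AddCommGroup N] [Module.Free ℤ N] [Module.Finite ℤ N]
variable {W W' W'' : Type*} [AddCommGroup W] [Module ℚ W] [AddCommGroup W'] [Module ℚ W']
  [AddCommGroup W''] [Module ℚ W'']

/-- The product of the elements of top degree of a family of edges. -/
def edgeProd {E : Type*} [Finite E] {ed : E → Nbar N} (δ : ∀ e, Dbl (ed e) →ₗ[ℚ] W) :
    ExteriorAlgebra ℚ W :=
  centralProd (fun e => map (δ e) (topElt (ed e))) fun _ => map_topElt_central _

/-- The product of the dual elements of top degree of a family of points. -/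
def volProd {Q : Type*} [Finite Q] {qd : Q → Nbar N} (π : ∀ q, W →ₗ[ℚ] Dbl (qd q)) :
    ExteriorAlgebra ℚ (Dual ℚ W) :=
  centralProd (fun q => map (π q).dualMap (cotopElt (qd q))) fun _ => map_cotopElt_central _

/-- Multiplication by the elements of a family of edges, followed by the integration over a family
of points. -/
def kernelOp {E Q : Type*} [Finite E] [Finite Q] {ed : E → Nbar N} {qd : Q → Nbar N}
    (δ : ∀ e, Dbl (ed e) →ₗ[ℚ] W) (π : ∀ q, W →ₗ[ℚ] Dbl (qd q)) :
    ExteriorAlgebra ℚ W →ₗ[ℚ] ExteriorAlgebra ℚ W :=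
  act (volProd π) ∘ₗ LinearMap.mulLeft ℚ (edgeProd δ)

section

theorem lin_comp_sum {X : Type*} (s : Finset X) (f : X → W →ₗ[ℚ] W') (g : W' →ₗ[ℚ] W'') :
    g ∘ₗ (∑ x ∈ s, f x) = ∑ x ∈ s, g ∘ₗ f x := by ext w; simp

theorem lin_sum_comp {X : Type*} (s : Finset X) (f : X → W' →ₗ[ℚ] W'') (g : W →ₗ[ℚ] W') :
    (∑ x ∈ s, f x) ∘ₗ g = ∑ x ∈ s, f x ∘ₗ g := by ext w; simp

variable {E E₁ E₂ Q Q₁ Q₂ : Type*} [Finite E] [Finite Q] [Finite E₁] [Finite Q₁]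
  [Finite E₂] [Finite Q₂] {ed : E → Nbar N} {qd : Q → Nbar N}

theorem kernelOp_apply (δ : ∀ e, Dbl (ed e) →ₗ[ℚ] W) (π : ∀ q, W →ₗ[ℚ] Dbl (qd q))
    (x : ExteriorAlgebra ℚ W) : kernelOp δ π x = act (volProd π) (edgeProd δ * x) := rfl

theorem act_mul (ω ω' : ExteriorAlgebra ℚ (Dual ℚ W)) (x : ExteriorAlgebra ℚ W) :
    act (ω * ω') x = act ω (act ω' x) := by rw [map_mul]; rfl

theorem map_edgeProd (T : W →ₗ[ℚ] W') (δ : ∀ e, Dbl (ed e) →ₗ[ℚ] W) :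
    map T (edgeProd δ) = edgeProd fun e => T ∘ₗ δ e := by
  unfold edgeProd
  rw [map_centralProd _ _ _ fun e => by rw [map_map']; exact map_topElt_central _]
  congr 1
  funext e
  rw [map_map']

theorem map_volProd (T : W →ₗ[ℚ] W') (π : ∀ q, W' →ₗ[ℚ] Dbl (qd q)) :
    map T.dualMap (volProd π) = volProd fun q => π q ∘ₗ T := by
  unfold volProd
  rw [map_centralProd _ _ _ fun e => by rw [map_map']; exact map_cotopElt_central _]
  congr 1
  funext e
  rw [map_map']
  rfl

theorem map_kernelOp (T : W →ₗ[ℚ] W') (δ : ∀ e, Dbl (ed e) →ₗ[ℚ] W)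
    (π : ∀ q, W' →ₗ[ℚ] Dbl (qd q)) (x : ExteriorAlgebra ℚ W) :
    map T (kernelOp δ (fun q => π q ∘ₗ T) x) = kernelOp (fun e => T ∘ₗ δ e) π (map T x) := by
  rw [kernelOp_apply, kernelOp_apply, ← map_volProd, map_act, map_mul, map_edgeProd]

theorem act_volProd_map_mul (π : ∀ q, W →ₗ[ℚ] Dbl (qd q)) (S : W' →ₗ[ℚ] W)
    (h : ∀ q, π q ∘ₗ S = 0) (b : ExteriorAlgebra ℚ W') (a : ExteriorAlgebra ℚ W) :
    act (volProd π) (map S b * a) = map S b * act (volProd π) a := by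
  refine centralProd_induction (P := fun ω => act ω (map S b * a) = map S b * act ω a) _ _ ?_ ?_
  · simp
  · intro e ω h'
    rw [act_mul, h', act_map_cotopElt_map_mul _ _ (h e), act_mul]

theorem act_volProd_mul_map (π : ∀ q, W →ₗ[ℚ] Dbl (qd q)) (S : W' →ₗ[ℚ] W)
    (h : ∀ q, π q ∘ₗ S = 0) (b : ExteriorAlgebra ℚ W') (a : ExteriorAlgebra ℚ W) :
    act (volProd π) (a * map S b) = act (volProd π) a * map S b := by
  refine centralProd_induction (P := fun ω => act ω (a * map S b) = act ω a * map S b) _ _ ?_ ?_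
  · simp
  · intro e ω h'
    rw [act_mul, h', act_map_cotopElt_mul_map _ _ (h e), act_mul]

theorem act_volProd_edgeProd_mul (π : ∀ q, W →ₗ[ℚ] Dbl (qd q)) (δ : ∀ e, Dbl (ed e) →ₗ[ℚ] W)
    (h : ∀ q e, π q ∘ₗ δ e = 0) (a : ExteriorAlgebra ℚ W) :
    act (volProd π) (edgeProd δ * a) = edgeProd δ * act (volProd π) a := by
  refine centralProd_induction
    (P := fun k => act (volProd π) (k * a) = k * act (volProd π) a) _ _ ?_ ?_
  · simp
  · intro e k h'
    rw [mul_assoc, act_volProd_map_mul _ _ fun q => h q e, h', mul_assoc]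

theorem edgeProd_central (δ : ∀ e, Dbl (ed e) →ₗ[ℚ] W) : IsCentral (edgeProd δ) :=
  centralProd_central _ _

/-- Fubini: the second family of edges does not involve the first family of points, so these points
can be integrated out first. -/
theorem kernelOp_split (σ : E₁ ⊕ E₂ ≃ E) (σ' : Q₁ ⊕ Q₂ ≃ Q) (δ : ∀ e, Dbl (ed e) →ₗ[ℚ] W)
    (π : ∀ q, W →ₗ[ℚ] Dbl (qd q)) (h : ∀ q e, π (σ' (.inl q)) ∘ₗ δ (σ (.inr e)) = 0)
    (x : ExteriorAlgebra ℚ W) :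
    kernelOp δ π x = kernelOp (fun e => δ (σ (.inr e))) (fun q => π (σ' (.inr q)))
      (kernelOp (fun e => δ (σ (.inl e))) (fun q => π (σ' (.inl q))) x) := by
  have hE : edgeProd δ = edgeProd (fun e => δ (σ (.inl e))) * edgeProd (fun e => δ (σ (.inr e))) :=
    centralProd_sum _ _ σ
  have hQ : volProd π = volProd (fun q => π (σ' (.inl q))) * volProd (fun q => π (σ' (.inr q))) :=
    centralProd_sum _ _ σ'
  have hQc : IsCentral (volProd (fun q => π (σ' (.inl q)))) := centralProd_central _ _
  rw [kernelOp_apply, kernelOp_apply, kernelOp_apply, hE, hQ, ← hQc.comm, act_mul,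
    ← (edgeProd_central _).comm, (edgeProd_central _).comm, ← (edgeProd_central _).comm,
    mul_assoc, act_volProd_edgeProd_mul _ _ h]

/-- All edge elements commute and all volume elements commute, so the second family of both may be
made the innermost operator without any condition. -/
theorem kernelOp_elim_left (σ : E₁ ⊕ E₂ ≃ E) (σ' : Q₁ ⊕ Q₂ ≃ Q) (δ : ∀ e, Dbl (ed e) →ₗ[ℚ] W)
    (π : ∀ q, W →ₗ[ℚ] Dbl (qd q)) (x : ExteriorAlgebra ℚ W) :
    kernelOp δ π x = act (volProd (fun q => π (σ' (.inl q))))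
      (kernelOp (fun e => δ (σ (.inr e))) (fun q => π (σ' (.inr q)))
        (edgeProd (fun e => δ (σ (.inl e))) * x)) := by
  have hE : edgeProd δ = edgeProd (fun e => δ (σ (.inl e))) * edgeProd (fun e => δ (σ (.inr e))) :=
    centralProd_sum _ _ σ
  have hQ : volProd π = volProd (fun q => π (σ' (.inl q))) * volProd (fun q => π (σ' (.inr q))) :=
    centralProd_sum _ _ σ'
  rw [kernelOp_apply, kernelOp_apply, hE, hQ, act_mul, ← mul_assoc, (edgeProd_central _).comm]

/-- The hypotheses compare top-degree elements rather than linear maps; thus edges may be reversed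
and directions need only be equal propositionally. -/
theorem kernelOp_congr (σ : E ≃ E₁) (σ' : Q ≃ Q₁) {ed₁ : E₁ → Nbar N} {qd₁ : Q₁ → Nbar N}
    (δ : ∀ e, Dbl (ed e) →ₗ[ℚ] W) (π : ∀ q, W →ₗ[ℚ] Dbl (qd q))
    (δ₁ : ∀ e, Dbl (ed₁ e) →ₗ[ℚ] W) (π₁ : ∀ q, W →ₗ[ℚ] Dbl (qd₁ q))
    (h : ∀ e, map (δ e) (topElt (ed e)) = map (δ₁ (σ e)) (topElt (ed₁ (σ e))))
    (h' : ∀ q, map (π q).dualMap (cotopElt (qd q)) =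
      map (π₁ (σ' q)).dualMap (cotopElt (qd₁ (σ' q)))) :
    kernelOp δ π = kernelOp δ₁ π₁ := by
  have hE : edgeProd δ = edgeProd δ₁ := centralProd_equiv _ _ _ σ h
  have hQ : volProd π = volProd π₁ := centralProd_equiv _ _ _ σ' h'
  rw [kernelOp, kernelOp, hE, hQ]

theorem kernelOp_congr_left {ed₁ : E → Nbar N} {qd₁ : Q → Nbar N}
    (δ : ∀ e, Dbl (ed e) →ₗ[ℚ] W) (π : ∀ q, W →ₗ[ℚ] Dbl (qd q))
    (δ₁ : ∀ e, Dbl (ed₁ e) →ₗ[ℚ] W) (π₁ : ∀ q, W →ₗ[ℚ] Dbl (qd₁ q))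
    (h : ∀ e, map (δ e) (topElt (ed e)) = map (δ₁ e) (topElt (ed₁ e)))
    (h' : ∀ q, map (π q).dualMap (cotopElt (qd q)) = map (π₁ q).dualMap (cotopElt (qd₁ q))) :
    kernelOp δ π = kernelOp δ₁ π₁ :=
  kernelOp_congr (Equiv.refl _) (Equiv.refl _) _ _ _ _ h h'

/-- A dual system of edges and points integrates to the simultaneous substitution `1 - ∑ δ' π`. It
is characterized, as `S`, by killing the edge vectors and fixing the common kernel of the `π x`. -/
theorem kernelOp_delta {X : Type*} [Finite X] {xd qd : X → Nbar N}
    (δ : ∀ x, Dbl (xd x) →ₗ[ℚ] W)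
    (π : ∀ x, W →ₗ[ℚ] Dbl (qd x)) (δ' : ∀ x, Dbl (qd x) →ₗ[ℚ] W)
    (hδ : ∀ x, map (δ x) (topElt (xd x)) = map (δ' x) (topElt (qd x)))
    (h1 : ∀ x, π x ∘ₗ δ' x = LinearMap.id) (h0 : ∀ x y, x ≠ y → π x ∘ₗ δ' y = 0)
    (S : W →ₗ[ℚ] W) (hS : ∀ x, S ∘ₗ δ' x = 0) (hS' : ∀ w, (∀ x, π x w = 0) → S w = w)
    (a : ExteriorAlgebra ℚ W) : kernelOp δ π a = map S a := by
  have e1 : kernelOp δ π = kernelOp δ' π :=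
    kernelOp_congr (Equiv.refl _) (Equiv.refl _) _ _ _ _ hδ fun _ => rfl
  rw [e1, kernelOp_apply]
  have := Fintype.ofFinite X
  classical
  unfold volProd edgeProd
  rw [centralProd_eq, centralProd_eq]
  have key : ∀ s : Finset X, ∀ a,
      act ((∏ x ∈ s, (⟨map (π x).dualMap (cotopElt (qd x)), map_cotopElt_central _⟩ :
        Subalgebra.center ℚ _) : Subalgebra.center ℚ _) : ExteriorAlgebra ℚ (Dual ℚ W))
      (((∏ x ∈ s, (⟨map (δ' x) (topElt (qd x)), map_topElt_central _⟩ :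
        Subalgebra.center ℚ _) : Subalgebra.center ℚ _) : ExteriorAlgebra ℚ W) * a) =
      map (LinearMap.id - ∑ x ∈ s, δ' x ∘ₗ π x) a := by
    intro s
    induction s using Finset.induction_on with
    | empty => intro a; simp
    | insert y s hy ih =>
      intro a
      rw [Finset.prod_insert hy, Finset.prod_insert hy]
      change act (map (π y).dualMap (cotopElt (qd y)) * _) (map (δ' y) (topElt (qd y)) * _ * a) = _
      rw [act_mul, ← (map_topElt_central (δ' y)).comm, mul_assoc, ih, map_mul, map_map']
      have e2 : (LinearMap.id - ∑ x ∈ s, δ' x ∘ₗ π x) ∘ₗ δ' y = δ' y := by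
        rw [LinearMap.sub_comp, LinearMap.id_comp, lin_sum_comp,
          Finset.sum_eq_zero, sub_zero]
        intro x hx
        rw [LinearMap.comp_assoc, h0 x y (fun h => hy (h ▸ hx)), LinearMap.comp_zero]
      rw [e2, act_cotopElt_delta _ _ (h1 y), map_map']
      congr 2
      rw [Finset.sum_insert hy, LinearMap.sub_comp, LinearMap.id_comp]
      have e3 : (δ' y ∘ₗ π y) ∘ₗ (LinearMap.id - ∑ x ∈ s, δ' x ∘ₗ π x) = δ' y ∘ₗ π y := by
        rw [LinearMap.comp_sub, LinearMap.comp_id, lin_comp_sum,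
          Finset.sum_eq_zero, sub_zero]
        intro x hx
        rw [LinearMap.comp_assoc, ← LinearMap.comp_assoc (π x),
          h0 y x (fun h => hy (h ▸ hx)), LinearMap.zero_comp, LinearMap.comp_zero]
      rw [e3]
      abel
  rw [key]
  congr 2
  -- `S` absorbs the projection because it kills its complement; on the image of the projection,
  -- where all `π x` vanish, `S` is the identity.
  have hS2 : S ∘ₗ (LinearMap.id - ∑ x, δ' x ∘ₗ π x) = S := by
    rw [LinearMap.comp_sub, LinearMap.comp_id, lin_comp_sum,
      Finset.sum_eq_zero, sub_zero]
    intro x _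
    rw [← LinearMap.comp_assoc, hS, LinearMap.zero_comp]
  rw [← hS2]
  ext w
  refine (hS' _ fun x => ?_).symm
  have h1' : ∀ v, π x (δ' x v) = v := fun v => LinearMap.congr_fun (h1 x) v
  have h0' : ∀ y, x ≠ y → ∀ v, π x (δ' y v) = 0 := fun y h v => LinearMap.congr_fun (h0 x y h) v
  simp only [LinearMap.sub_apply, LinearMap.id_apply, LinearMap.sum_apply, LinearMap.comp_apply,
    map_sub, map_sum]
  rw [Finset.sum_eq_single x, h1', sub_self]
  · intro y _ hy
    exact h0' y hy.symm _
  · simp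

end

end Operators

/-! ### Linear maps induced by partial maps of points -/

section PointMaps

open ExteriorAlgebra Module

variable {N : Type u} [AddCommGroup N]

open Classical in
/-- The inclusion `a^⊥ ⊕ a^⊥ ⊆ b^⊥ ⊕ b^⊥` (zero if there is none). -/
def incl (a b : Nbar N) : Dbl a →ₗ[ℚ] Dbl b :=
  if h : perp a ≤ perp b then (Submodule.inclusion h).prodMap (Submodule.inclusion h) else 0

theorem incl_self (a : Nbar N) : incl a a = LinearMap.id := by
  rw [incl, dif_pos le_rfl]; rfl

theorem incl_zero (a : Nbar N) : incl a Nbar.zero = dblIncl a := by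
  rw [incl, dif_pos (perp_le_perp_zero a)]; rfl

theorem incl_comp {a b c : Nbar N} (h : perp a ≤ perp b) (h' : perp b ≤ perp c) :
    incl b c ∘ₗ incl a b = incl a c := by
  rw [incl, incl, incl, dif_pos h, dif_pos h', dif_pos (h.trans h')]; rfl

section

variable {P P' P'' : Type} {pd : P → Nbar N} {pd' : P' → Nbar N} {pd'' : P'' → Nbar N}

variable (pd) in
open Classical in
/-- The inclusion of `n^⊥ ⊕ n^⊥` into the summand at the point `p`. -/
def wsingle (p : P) (n : Nbar N) : Dbl n →ₗ[ℚ] ((p : P) → Dbl (pd p)) :=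
  LinearMap.single ℚ (fun p => Dbl (pd p)) p ∘ₗ incl n (pd p)

theorem wsingle_incl {a b : Nbar N} (p : P) (h : perp a ≤ perp b) (h' : perp b ≤ perp (pd p)) :
    wsingle pd p b ∘ₗ incl a b = wsingle pd p a := by
  rw [wsingle, LinearMap.comp_assoc, incl_comp h h', wsingle]

theorem proj_wsingle (p : P) (n : Nbar N) :
    LinearMap.proj p ∘ₗ wsingle pd p n = incl n (pd p) := by
  rw [wsingle, ← LinearMap.comp_assoc, LinearMap.proj_comp_single_same, LinearMap.id_comp]

theorem proj_wsingle_of_ne {p q : P} (h : p ≠ q) (n : Nbar N) :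
    LinearMap.proj q ∘ₗ wsingle pd p n = 0 := by
  classical
  rw [wsingle, ← LinearMap.comp_assoc, LinearMap.proj_comp_single_ne _ _ _ _ h.symm,
    LinearMap.zero_comp]

theorem wsingle_ext [Finite P] {V : Type*} [AddCommGroup V] [Module ℚ V]
    {f g : ((p : P) → Dbl (pd p)) →ₗ[ℚ] V}
    (h : ∀ p, f ∘ₗ wsingle pd p (pd p) = g ∘ₗ wsingle pd p (pd p)) : f = g := by
  classical
  refine LinearMap.pi_ext' fun p => ?_
  have := h p
  simp only [wsingle, incl_self, LinearMap.comp_id] at this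
  convert this

theorem sum_wsingle [Fintype P] (w : (p : P) → Dbl (pd p)) :
    ∑ p, wsingle pd p (pd p) (w p) = w := by
  classical
  simp only [wsingle, incl_self, LinearMap.comp_id]
  simp only [LinearMap.single_apply]
  convert Finset.univ_sum_single w

variable (pd pd') in
/-- The linear map of the summands given by a partial map of the points. -/
def wmap [Finite P] (f : P → Option P') : ((p : P) → Dbl (pd p)) →ₗ[ℚ] ((p : P') → Dbl (pd' p)) :=
  letI := Fintype.ofFinite P
  ∑ p, ((f p).elim 0 fun q => wsingle pd' q (pd p)) ∘ₗ LinearMap.proj p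

theorem wmap_wsingle [Finite P] (f : P → Option P') (p : P) (n : Nbar N)
    (hn : perp n ≤ perp (pd p)) (hf : ∀ q, f p = some q → perp (pd p) ≤ perp (pd' q)) :
    wmap pd pd' f ∘ₗ wsingle pd p n = (f p).elim 0 fun q => wsingle pd' q n := by
  let := Fintype.ofFinite P
  rw [wmap, lin_sum_comp, Finset.sum_eq_single p]
  · rw [LinearMap.comp_assoc, proj_wsingle]
    cases h : f p with
    | none => simp
    | some q => exact wsingle_incl q hn (hf q h)
  · intro q _ hq
    rw [LinearMap.comp_assoc, proj_wsingle_of_ne hq.symm, LinearMap.comp_zero]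
  · simp

theorem wmap_wsingle_some [Finite P] {f : P → Option P'} {p : P} {q : P'} (h : f p = some q)
    {n : Nbar N} (hn : perp n ≤ perp (pd p)) (hf : perp (pd p) ≤ perp (pd' q)) :
    wmap pd pd' f ∘ₗ wsingle pd p n = wsingle pd' q n := by
  rw [wmap_wsingle f p n hn (by rintro q' h'; rw [h] at h'; cases h'; exact hf), h]; rfl

theorem wmap_wsingle_none [Finite P] {f : P → Option P'} {p : P} (h : f p = none)
    {n : Nbar N} (hn : perp n ≤ perp (pd p)) :
    wmap pd pd' f ∘ₗ wsingle pd p n = 0 := by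
  rw [wmap_wsingle f p n hn (by rintro q' h'; rw [h] at h'; cases h'), h]; rfl

theorem wmap_comp [Finite P] [Finite P'] {f : P → Option P'} {g : P' → Option P''}
    (hf : ∀ p q, f p = some q → perp (pd p) ≤ perp (pd' q))
    (hg : ∀ p q, g p = some q → perp (pd' p) ≤ perp (pd'' q)) :
    wmap pd' pd'' g ∘ₗ wmap pd pd' f = wmap pd pd'' fun p => (f p).bind g := by
  refine wsingle_ext fun p => ?_
  rw [LinearMap.comp_assoc, wmap_wsingle f p _ le_rfl (hf p)]
  cases h : f p with
  | none => rw [wmap_wsingle_none (by simp [h]) le_rfl]; simp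
  | some q =>
    rw [Option.elim_some, wmap_wsingle g q _ (hf p q h) (hg q)]
    cases h' : g q with
    | none => rw [wmap_wsingle_none (by simp [h, h']) le_rfl]; rfl
    | some t =>
      rw [wmap_wsingle_some (q := t) (by simp [h, h']) le_rfl ((hf p q h).trans (hg q t h'))]; rfl

theorem wmap_none [Finite P] : wmap pd pd' (fun _ => none) = 0 :=
  wsingle_ext fun p => by rw [wmap_wsingle_none rfl le_rfl]; simp

theorem wmap_some [Finite P] : wmap pd pd some = LinearMap.id :=
  wsingle_ext fun p => by rw [wmap_wsingle_some rfl le_rfl le_rfl]; simp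

end

end PointMaps

/-! ### Diagrams, their integrals, and elimination of points -/

section Diagrams

open ExteriorAlgebra Module

variable {N : Type u} [AddCommGroup N]

/-- A combinatorial pattern for an integral: a finite graph on a set of points with edges, some
points being integrated over. -/
structure Diagram {I J : Type} (c : I → Nbar N) (d : J → Nbar N) where
  Pt : Type
  Edge : Type
  Int : Type
  finite_pt : Finite Pt
  finite_edge : Finite Edge
  finite_int : Finite Int
  pd : Pt → Nbar N
  ed : Edge → Nbar N
  en : Edge → Bool → Pt
  ip : Int → Pt
  src : I → Pt
  tgt : Pt → Option J
  en_le : ∀ e b, perp (ed e) ≤ perp (pd (en e b))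
  src_le : ∀ i, perp (c i) ≤ perp (pd (src i))
  tgt_le : ∀ p j, tgt p = some j → perp (pd p) ≤ perp (d j)

attribute [instance] Diagram.finite_pt Diagram.finite_edge Diagram.finite_int

variable {I J : Type} [Finite I] [Finite J] {c : I → Nbar N} {d : J → Nbar N}

namespace Diagram

/-- The direct sum over all points. -/
abbrev Space (D : Diagram c d) : Type u := (p : D.Pt) → Dbl (D.pd p)

/-- The difference of the two ends of an edge. -/
def diff (D : Diagram c d) (e : D.Edge) : Dbl (D.ed e) →ₗ[ℚ] D.Space :=
  wsingle D.pd (D.en e true) (D.ed e) - wsingle D.pd (D.en e false) (D.ed e)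

/-- The projection to an integrated point. -/
def pt (D : Diagram c d) (q : D.Int) : D.Space →ₗ[ℚ] Dbl (D.pd (D.ip q)) :=
  LinearMap.proj (D.ip q)

/-- The inclusion of the incoming summands. -/
def inMap (D : Diagram c d) : ((i : I) → Dbl (c i)) →ₗ[ℚ] D.Space :=
  wmap c D.pd fun i => some (D.src i)

/-- The projection to the outgoing summands. -/
def outMap (D : Diagram c d) : D.Space →ₗ[ℚ] ((j : J) → Dbl (d j)) :=
  wmap D.pd d D.tgt

theorem inMap_wsingle (D : Diagram c d) (i : I) (n : Nbar N) (h : perp n ≤ perp (c i)) :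
    D.inMap ∘ₗ wsingle c i n = wsingle D.pd (D.src i) n :=
  wmap_wsingle_some (f := fun i => some (D.src i)) rfl h (D.src_le i)

variable [Module.Free ℤ N] [Module.Finite ℤ N]

/-- The integral. -/
def eval (D : Diagram c d) : State c →ₗ[ℚ] State d :=
  (map D.outMap).toLinearMap ∘ₗ kernelOp D.diff D.pt ∘ₗ (map D.inMap).toLinearMap

theorem eval_apply (D : Diagram c d) (x : State c) :
    D.eval x = map D.outMap (kernelOp D.diff D.pt (map D.inMap x)) := rfl

/-- Directions that are equal only propositionally are compared through `incl`, which is then the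
identity; a sign is harmless in even degree. -/
theorem map_topElt_congr {W : Type*} [AddCommGroup W] [Module ℚ W] {a b : Nbar N} (h : a = b)
    {f : Dbl a →ₗ[ℚ] W} {g : Dbl b →ₗ[ℚ] W} (hfg : f = g ∘ₗ incl a b ∨ f = -(g ∘ₗ incl a b)) :
    map f (topElt a) = map g (topElt b) := by
  subst h
  rw [incl_self, LinearMap.comp_id] at hfg
  rcases hfg with rfl | rfl
  · rfl
  · rw [map_neg_topElt]

theorem map_cotopElt_congr {W : Type*} [AddCommGroup W] [Module ℚ W] {a b : Nbar N} (h : a = b)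
    {f : W →ₗ[ℚ] Dbl a} {g : W →ₗ[ℚ] Dbl b} (hfg : incl a b ∘ₗ f = g) :
    map f.dualMap (cotopElt a) = map g.dualMap (cotopElt b) := by
  subst h
  rw [incl_self, LinearMap.id_comp] at hfg
  rw [hfg]

/-- Elimination of a family `X` of integrated points, each of which is attached to an edge of its
own direction: the points are replaced by the other ends of these edges. -/
theorem eval_eq_of_elim (D D' : Diagram c d) {X : Type} [Finite X]
    (eE : D'.Edge ⊕ X ≃ D.Edge) (eQ : D'.Int ⊕ X ≃ D.Int) (r : D.Pt → D'.Pt) (s : D'.Pt → D.Pt)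
    (hrs : ∀ p, r (s p) = p) (hpd : ∀ p, D.pd (s p) = D'.pd p)
    (hsr : ∀ p, s (r p) = p ∨ ∃ x, p = D.ip (eQ (.inr x)))
    (hX : ∀ x, ∃ b, D.en (eE (.inr x)) b = D.ip (eQ (.inr x)) ∧
      D.en (eE (.inr x)) (!b) = s (r (D.ip (eQ (.inr x)))))
    (hXd : ∀ x, D.ed (eE (.inr x)) = D.pd (D.ip (eQ (.inr x))))
    (hs : ∀ x p, s p ≠ D.ip (eQ (.inr x)))
    (hinj : ∀ x y, D.ip (eQ (.inr x)) = D.ip (eQ (.inr y)) → x = y)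
    (hed : ∀ e, D.ed (eE (.inl e)) = D'.ed e)
    (hen : ∀ e, ∃ f : Bool, ∀ b, D'.en e b = r (D.en (eE (.inl e)) (xor b f)))
    (hip : ∀ q, s (D'.ip q) = D.ip (eQ (.inl q)))
    (hsrc : ∀ i, D'.src i = r (D.src i)) (htgt : ∀ p, D'.tgt p = D.tgt (s p)) :
    D.eval = D'.eval := by
  have hr : ∀ p, perp (D.pd p) ≤ perp (D'.pd (r p)) := by
    intro p
    rcases hsr p with h | ⟨x, rfl⟩
    · rw [← hpd, h]
    · obtain ⟨b, -, hb⟩ := hX x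
      rw [← hpd, ← hb, ← hXd]
      exact D.en_le _ _
  -- `R` moves each eliminated point to the other end of its edge, and `S` includes the remaining
  -- points, so `S ∘ R` is the substitution performed by the delta functions.
  set R := wmap D.pd D'.pd fun p => some (r p)
  set S := wmap D'.pd D.pd fun p => some (s p)
  have hR : ∀ p n, perp n ≤ perp (D.pd p) →
      R ∘ₗ wsingle D.pd p n = wsingle D'.pd (r p) n := fun p n hn =>
    wmap_wsingle_some (f := fun p => some (r p)) rfl hn (hr p)
  have hS : ∀ p n, perp n ≤ perp (D'.pd p) →
      S ∘ₗ wsingle D'.pd p n = wsingle D.pd (s p) n := fun p n hn =>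
    wmap_wsingle_some (f := fun p => some (s p)) rfl hn (hpd p ▸ le_rfl)
  have hδ : ∀ a : ExteriorAlgebra ℚ D.Space, kernelOp (fun x => D.diff (eE (.inr x)))
      (fun x => D.pt (eQ (.inr x))) a = map (S ∘ₗ R) a := by
    have hle : ∀ x, perp (D.pd (D.ip (eQ (.inr x)))) ≤
        perp (D.pd (s (r (D.ip (eQ (.inr x)))))) := fun x => by
      rw [hpd]; exact hr _
    -- The edges are oriented with the eliminated point as the positive end, so that they form a
    -- dual system with the projections to the eliminated points.
    refine kernelOp_delta _ _ (fun x => wsingle D.pd (D.ip (eQ (.inr x))) _ -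
      wsingle D.pd (s (r (D.ip (eQ (.inr x))))) _) ?_ ?_ ?_ _ ?_ ?_
    · intro x
      refine map_topElt_congr (hXd x) ?_
      rw [LinearMap.sub_comp, wsingle_incl _ (hXd x ▸ le_rfl) le_rfl,
        wsingle_incl _ (hXd x ▸ le_rfl) (hle x), diff]
      obtain ⟨b, hb, hb'⟩ := hX x
      cases b
      · right; rw [hb]; rw [Bool.not_false] at hb'; rw [hb']; exact LinearMap.ext fun v => (neg_sub _ _).symm
      · left; rw [hb]; rw [Bool.not_true] at hb'; rw [hb']
    · intro x
      rw [LinearMap.comp_sub, pt, proj_wsingle, proj_wsingle_of_ne (hs x _), incl_self]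
      exact LinearMap.ext fun v => sub_zero _
    · intro x y hxy
      rw [LinearMap.comp_sub, pt, proj_wsingle_of_ne (fun h => hxy (hinj _ _ h).symm),
        proj_wsingle_of_ne (hs x _)]
      exact LinearMap.ext fun v => sub_zero _
    · intro x
      rw [LinearMap.comp_sub, LinearMap.comp_assoc, LinearMap.comp_assoc, hR _ _ le_rfl,
        hR _ _ (hle x), hrs]
      exact LinearMap.ext fun v => sub_self _
    -- Componentwise: `S ∘ R` fixes the summands at remaining points, and the components at
    -- eliminated points vanish by assumption.
    · intro w hw
      let := Fintype.ofFinite D.Pt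
      conv_rhs => rw [← sum_wsingle w]
      conv_lhs => rw [← sum_wsingle w]
      rw [map_sum]
      refine Finset.sum_congr rfl fun p _ => ?_
      rcases hsr p with h | ⟨x, rfl⟩
      · have := LinearMap.congr_fun (hR p _ le_rfl) (w p)
        have h2 := LinearMap.congr_fun (hS (r p) (D.pd p) (hr p)) (w p)
        rw [h] at h2
        simp only [LinearMap.comp_apply] at this h2 ⊢
        rw [this, h2]
      · have : w (D.ip (eQ (.inr x))) = 0 := hw x
        rw [this, map_zero, map_zero]
  refine LinearMap.ext fun x => ?_
  -- The eliminated edges and points act first, as `S ∘ R`; then `S` is pulled out of the remaining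
  -- integral by naturality, which turns it into the integral of `D'`.
  rw [eval_apply, eval_apply, kernelOp_elim_left eE eQ, hδ, map_mul, map_edgeProd, map_map',
    ← kernelOp_apply]
  simp only [LinearMap.comp_assoc]
  rw [← map_map' (R ∘ₗ D.inMap) S, ← map_kernelOp, map_map']
  have e1 : R ∘ₗ D.inMap = D'.inMap := by
    refine wsingle_ext fun i => ?_
    rw [LinearMap.comp_assoc, inMap_wsingle _ _ _ le_rfl, inMap_wsingle _ _ _ le_rfl,
      hR _ _ (D.src_le i), hsrc]
  have e2 : D.outMap ∘ₗ S = D'.outMap := by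
    refine wsingle_ext fun p => ?_
    rw [LinearMap.comp_assoc, hS _ _ le_rfl, outMap, outMap,
      wmap_wsingle _ _ _ (hpd p ▸ le_rfl) (D.tgt_le _), wmap_wsingle _ _ _ le_rfl (D'.tgt_le _),
      htgt]
  rw [e1, e2]
  congr 2
  refine kernelOp_congr_left _ _ _ _ ?_ ?_
  · intro e
    refine map_topElt_congr (hed e) ?_
    have hle := (hed e) ▸ (le_refl (perp (D.ed (eE (.inl e)))))
    obtain ⟨f, hf⟩ := hen e
    simp only [diff]
    rw [LinearMap.comp_sub, hR _ _ (D.en_le _ _), hR _ _ (D.en_le _ _), LinearMap.sub_comp,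
      wsingle_incl _ (hed e ▸ le_rfl) (D'.en_le _ _), wsingle_incl _ (hed e ▸ le_rfl) (D'.en_le _ _),
      hf, hf]
    cases f
    · left; rfl
    · right; exact LinearMap.ext fun v => (neg_sub _ _).symm
  · intro q
    have hq : D.pd (D.ip (eQ (.inl q))) = D'.pd (D'.ip q) := by rw [← hip, hpd]
    refine map_cotopElt_congr hq ?_
    refine wsingle_ext fun p => ?_
    simp only [pt]
    rw [LinearMap.comp_assoc, LinearMap.comp_assoc, hS _ _ le_rfl]
    by_cases h : p = D'.ip q
    · subst h
      rw [hip, proj_wsingle, proj_wsingle, incl_self]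
      exact incl_comp (hq ▸ le_rfl) (hq ▸ le_rfl) |>.trans (incl_self _)
    · rw [proj_wsingle_of_ne h, proj_wsingle_of_ne, LinearMap.comp_zero]
      rw [← hip]
      intro h'
      exact h (by rw [← hrs p, h', hrs])

end Diagram

end Diagrams

/-! ### Gluing, disjoint union, parity and degenerate cases of integrals -/

section DiagramOperations

open ExteriorAlgebra Module

variable {N : Type u} [AddCommGroup N]

theorem wsingle_apply_self {P : Type} {pd : P → Nbar N} (p : P) (v : Dbl (pd p)) :
    wsingle pd p (pd p) v p = v := by
  have := LinearMap.congr_fun (proj_wsingle (pd := pd) p (pd p)) v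
  rwa [incl_self] at this

theorem wsingle_apply_of_ne {P : Type} {pd : P → Nbar N} {p q : P} (h : p ≠ q) {n : Nbar N}
    (v : Dbl n) : wsingle pd p n v q = 0 :=
  LinearMap.congr_fun (proj_wsingle_of_ne (pd := pd) h n) v

section

variable {I I' : Type} (c : I → Nbar N) (c' : I' → Nbar N)

theorem leftPart_eq [Finite I] :
    leftPart c c' = map (wmap c (Sum.elim c c') fun i => some (.inl i)) := by
  unfold leftPart
  congr 1
  refine wsingle_ext fun i => Eq.trans ?_ (wmap_wsingle_some (pd := c) (pd' := Sum.elim c c')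
    (f := fun i => some (Sum.inl i)) (p := i) (q := Sum.inl i) rfl (n := c i) le_rfl le_rfl).symm
  refine LinearMap.ext fun v => funext fun j => ?_
  rcases j with j | j
  · change wsingle c i (c i) v j = _
    by_cases h : i = j
    · subst h
      exact (wsingle_apply_self _ v).trans
        (wsingle_apply_self (pd := Sum.elim c c') (Sum.inl i) v).symm
    · exact (wsingle_apply_of_ne h v).trans
        (wsingle_apply_of_ne (pd := Sum.elim c c') (p := Sum.inl i) (q := Sum.inl j) (by simpa using h)
          v).symm
  · exact (wsingle_apply_of_ne (pd := Sum.elim c c') (p := Sum.inl i) (q := Sum.inr j) (by simp) v).symm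

theorem rightPart_eq [Finite I'] :
    rightPart c c' = map (wmap c' (Sum.elim c c') fun i => some (.inr i)) := by
  unfold rightPart
  congr 1
  refine wsingle_ext fun i => Eq.trans ?_ (wmap_wsingle_some (pd := c') (pd' := Sum.elim c c')
    (f := fun i => some (Sum.inr i)) (p := i) (q := Sum.inr i) rfl (n := c' i) le_rfl le_rfl).symm
  refine LinearMap.ext fun v => funext fun j => ?_
  rcases j with j | j
  · exact (wsingle_apply_of_ne (pd := Sum.elim c c') (p := Sum.inr i) (q := Sum.inl j) (by simp) v).symm
  · change wsingle c' i (c' i) v j = _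
    by_cases h : i = j
    · subst h
      exact (wsingle_apply_self _ v).trans
        (wsingle_apply_self (pd := Sum.elim c c') (Sum.inr i) v).symm
    · exact (wsingle_apply_of_ne h v).trans
        (wsingle_apply_of_ne (pd := Sum.elim c c') (p := Sum.inr i) (q := Sum.inr j) (by simpa using h)
          v).symm

end

theorem neg_id_comp {V V' : Type*} [AddCommGroup V] [Module ℚ V] [AddCommGroup V'] [Module ℚ V']
    (f : V →ₗ[ℚ] V') : (-LinearMap.id) ∘ₗ f = -f := by
  ext v
  simp

theorem comp_neg_id {V V' : Type*} [AddCommGroup V] [Module ℚ V] [AddCommGroup V'] [Module ℚ V']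
    (f : V →ₗ[ℚ] V') : f ∘ₗ (-LinearMap.id) = -f := by
  ext v
  simp

theorem dualMap_comp_neg_id {V V' : Type*} [AddCommGroup V] [Module ℚ V] [AddCommGroup V']
    [Module ℚ V'] (f : V →ₗ[ℚ] V') : (f ∘ₗ (-LinearMap.id)).dualMap = -f.dualMap := by
  ext φ v
  simp

namespace Diagram

variable {I J K I' J' : Type} [Finite I] [Finite J] [Finite K] [Finite I'] [Finite J']
  {c : I → Nbar N} {d : J → Nbar N} {k : K → Nbar N} {c' : I' → Nbar N} {d' : J' → Nbar N}

theorem wsingle_congr {P : Type} {pd : P → Nbar N} {p q : P} (h : p = q) (n : Nbar N) :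
    wsingle pd p n = wsingle pd q n := by rw [h]

variable [Module.Free ℤ N] [Module.Finite ℤ N]

theorem diff_transport {D₁ : Diagram c d} {D : Diagram c' d'} (ρ : D₁.Pt → D.Pt)
    (hpd : ∀ p, D.pd (ρ p) = D₁.pd p) (e : D.Edge) (e₁ : D₁.Edge)
    (hed : D.ed e = D₁.ed e₁) (hen : ∀ b, D.en e b = ρ (D₁.en e₁ b)) :
    map (D.diff e) (topElt (D.ed e)) =
      map (wmap D₁.pd D.pd (fun p => some (ρ p)) ∘ₗ D₁.diff e₁) (topElt (D₁.ed e₁)) := by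
  refine map_topElt_congr hed (Or.inl ?_)
  have hR : ∀ b, (wmap D₁.pd D.pd fun p => some (ρ p)) ∘ₗ wsingle D₁.pd (D₁.en e₁ b) (D₁.ed e₁) =
      wsingle D.pd (ρ (D₁.en e₁ b)) (D₁.ed e₁) := fun b =>
    wmap_wsingle_some (f := fun p => some (ρ p)) rfl (D₁.en_le _ _) (hpd _ ▸ le_rfl)
  rw [diff, diff, LinearMap.comp_sub, hR, hR, LinearMap.sub_comp, wsingle_incl _ (hed ▸ le_rfl)
    (hpd _ ▸ D₁.en_le _ _), wsingle_incl _ (hed ▸ le_rfl) (hpd _ ▸ D₁.en_le _ _), hen, hen]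

theorem pt_transport {D₁ : Diagram c d} {D : Diagram c' d'} (ρ : D₁.Pt → D.Pt)
    (hpd : ∀ p, D.pd (ρ p) = D₁.pd p) (q : D.Int) (q₁ : D₁.Int)
    (hip : D.ip q = ρ (D₁.ip q₁)) (hinj : ∀ p, ρ p = ρ (D₁.ip q₁) → p = D₁.ip q₁) :
    map (D.pt q ∘ₗ wmap D₁.pd D.pd (fun p => some (ρ p))).dualMap (cotopElt (D.pd (D.ip q))) =
      map (D₁.pt q₁).dualMap (cotopElt (D₁.pd (D₁.ip q₁))) := by
  have hq : D.pd (D.ip q) = D₁.pd (D₁.ip q₁) := by rw [hip, hpd]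
  refine map_cotopElt_congr hq (wsingle_ext fun p => ?_)
  rw [LinearMap.comp_assoc, LinearMap.comp_assoc,
    wmap_wsingle_some (f := fun p => some (ρ p)) rfl le_rfl (hpd _ ▸ le_rfl), pt, pt]
  by_cases h : p = D₁.ip q₁
  · subst h
    rw [proj_wsingle, incl_self, wsingle_congr hip.symm, proj_wsingle]
    exact incl_comp (hq ▸ le_rfl) (hq ▸ le_rfl) |>.trans (incl_self _)
  · rw [proj_wsingle_of_ne h, proj_wsingle_of_ne, LinearMap.comp_zero]
    rw [hip]
    exact fun h' => h (hinj p h')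

theorem pt_comp_diff_eq_zero {D : Diagram c d} (q : D.Int) (e : D.Edge)
    (h : ∀ b, D.en e b ≠ D.ip q) : D.pt q ∘ₗ D.diff e = 0 := by
  rw [diff, LinearMap.comp_sub, pt, proj_wsingle_of_ne (h _), proj_wsingle_of_ne (h _)]
  exact LinearMap.ext fun v => sub_zero _

/-- Gluing of integrals. -/
theorem eval_comp (D₁ : Diagram c d) (D₂ : Diagram d k) (D : Diagram c k)
    (ρ₁ : D₁.Pt → D.Pt) (ρ₂ : D₂.Pt → D.Pt) (Pr : D.Pt → Option D₂.Pt)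
    (hpd₁ : ∀ p, D.pd (ρ₁ p) = D₁.pd p) (hpd₂ : ∀ p, D.pd (ρ₂ p) = D₂.pd p)
    (hPr₂ : ∀ p, Pr (ρ₂ p) = some p) (hPr₁ : ∀ p, Pr (ρ₁ p) = (D₁.tgt p).map D₂.src)
    (hPrle : ∀ p q, Pr p = some q → perp (D.pd p) ≤ perp (D₂.pd q))
    (eE : D₁.Edge ⊕ D₂.Edge ≃ D.Edge) (eQ : D₁.Int ⊕ D₂.Int ≃ D.Int)
    (hed₁ : ∀ e, D.ed (eE (.inl e)) = D₁.ed e) (hed₂ : ∀ e, D.ed (eE (.inr e)) = D₂.ed e)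
    (hen₁ : ∀ e b, D.en (eE (.inl e)) b = ρ₁ (D₁.en e b))
    (hen₂ : ∀ e b, D.en (eE (.inr e)) b = ρ₂ (D₂.en e b))
    (hip₁ : ∀ q, D.ip (eQ (.inl q)) = ρ₁ (D₁.ip q))
    (hip₂ : ∀ q, D.ip (eQ (.inr q)) = ρ₂ (D₂.ip q))
    (hinj : ∀ q p, ρ₁ p = ρ₁ (D₁.ip q) → p = D₁.ip q)
    (hdisj : ∀ q p, ρ₂ p ≠ ρ₁ (D₁.ip q))
    (hPrip : ∀ q p, Pr p = some (D₂.ip q) → p = ρ₂ (D₂.ip q))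
    (htgt : ∀ p, D.tgt p = (Pr p).bind D₂.tgt) (hsrc : ∀ i, D.src i = ρ₁ (D₁.src i)) :
    D.eval = D₂.eval ∘ₗ D₁.eval := by
  set R₁ := wmap D₁.pd D.pd fun p => some (ρ₁ p)
  set R₂ := wmap D₂.pd D.pd fun p => some (ρ₂ p)
  -- `P` projects to the points of `D₂`; each outgoing point of `D₁` is carried to the point at
  -- which `D₂` receives it, and the other points of `D₁` are dropped. Hence `P ∘ R₁` is the output
  -- of `D₁` followed by the input of `D₂`.
  set P := wmap D.pd D₂.pd Pr
  have hPR₂ : P ∘ₗ R₂ = LinearMap.id := by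
    rw [wmap_comp (by rintro p q ⟨⟩; exact hpd₂ p ▸ le_rfl) hPrle, ← wmap_some]
    congr 1
    funext p
    simp [hPr₂]
  have hPR₁ : P ∘ₗ R₁ = D₂.inMap ∘ₗ D₁.outMap := by
    rw [wmap_comp (by rintro p q ⟨⟩; exact hpd₁ p ▸ le_rfl) hPrle, inMap, outMap,
      wmap_comp D₁.tgt_le (by rintro p q ⟨⟩; exact D₂.src_le p)]
    congr 1
    funext p
    simp only [Option.bind_some, hPr₁]
    cases D₁.tgt p <;> rfl
  have hout : D.outMap = D₂.outMap ∘ₗ P := by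
    rw [outMap, outMap, wmap_comp hPrle D₂.tgt_le]
    congr 1
    funext p
    exact htgt p
  have hin : D.inMap = R₁ ∘ₗ D₁.inMap := by
    refine wsingle_ext fun i => ?_
    rw [LinearMap.comp_assoc, inMap_wsingle _ _ _ le_rfl, inMap_wsingle _ _ _ le_rfl,
      wmap_wsingle_some (f := fun p => some (ρ₁ p)) rfl (D₁.src_le i) (hpd₁ _ ▸ le_rfl), hsrc]
  have hπ₂ : ∀ q, map (D.pt (eQ (.inr q))).dualMap (cotopElt _) =
      map (D₂.pt q ∘ₗ P).dualMap (cotopElt _) := by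
    intro q
    have hq : D.pd (D.ip (eQ (.inr q))) = D₂.pd (D₂.ip q) := by rw [hip₂, hpd₂]
    refine map_cotopElt_congr hq (wsingle_ext fun p => ?_)
    rw [LinearMap.comp_assoc, LinearMap.comp_assoc, wmap_wsingle _ _ _ le_rfl (hPrle p), pt, pt]
    by_cases h : Pr p = some (D₂.ip q)
    · have hp := (hPrip q p h).trans (hip₂ q).symm
      subst hp
      rw [proj_wsingle, h, Option.elim_some, proj_wsingle, incl_self, LinearMap.comp_id]
    · have hp : p ≠ D.ip (eQ (.inr q)) := by
        rintro rfl
        exact h (by rw [hip₂, hPr₂])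
      rw [proj_wsingle_of_ne hp, LinearMap.comp_zero]
      cases h' : Pr p with
      | none => simp
      | some t =>
        rw [Option.elim_some, proj_wsingle_of_ne]
        rintro rfl
        exact h h'
  refine LinearMap.ext fun x => ?_
  -- The edges of `D₂` avoid the points integrated in `D₁`, so Fubini applies: the integral of `D₁`
  -- is done inside the image of `R₁`, and `P` then transports the rest to the space of `D₂`.
  rw [LinearMap.comp_apply, eval_apply, eval_apply, eval_apply,
    kernelOp_split eE eQ _ _ (fun q e => pt_comp_diff_eq_zero _ _ fun b => by
      rw [hen₂, hip₁]; exact hdisj _ _), hin, ← map_map' D₁.inMap R₁,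
    kernelOp_congr_left (fun e => D.diff (eE (.inl e))) (fun q => D.pt (eQ (.inl q)))
      (fun e => R₁ ∘ₗ D₁.diff e) (fun q => D.pt (eQ (.inl q)))
      (fun e => diff_transport ρ₁ hpd₁ _ _ (hed₁ e) (hen₁ e)) (fun _ => rfl),
    ← map_kernelOp,
    kernelOp_congr_left D₁.diff (fun q => D.pt (eQ (.inl q)) ∘ₗ R₁) D₁.diff D₁.pt
      (fun _ => rfl) (fun q => pt_transport ρ₁ hpd₁ _ _ (hip₁ q) (hinj q)),
    kernelOp_congr_left (fun e => D.diff (eE (.inr e))) (fun q => D.pt (eQ (.inr q)))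
      (fun e => R₂ ∘ₗ D₂.diff e) (fun q => D₂.pt q ∘ₗ P)
      (fun e => diff_transport ρ₂ hpd₂ _ _ (hed₂ e) (hen₂ e)) hπ₂,
    hout, ← map_map' P, map_kernelOp, map_map', hPR₁, ← map_map']
  congr 3
  funext e
  rw [← LinearMap.comp_assoc, hPR₂, LinearMap.id_comp]

set_option maxHeartbeats 1600000 in
/-- Disjoint unions of integrals. -/
theorem eval_union (D₁ : Diagram c d) (D₂ : Diagram c' d')
    (D : Diagram (Sum.elim c c') (Sum.elim d d'))
    (ρ₁ : D₁.Pt → D.Pt) (ρ₂ : D₂.Pt → D.Pt)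
    (hpd₁ : ∀ p, D.pd (ρ₁ p) = D₁.pd p) (hpd₂ : ∀ p, D.pd (ρ₂ p) = D₂.pd p)
    (hinj₁ : Function.Injective ρ₁) (hinj₂ : Function.Injective ρ₂)
    (hdisj : ∀ p q, ρ₁ p ≠ ρ₂ q)
    (eE : D₁.Edge ⊕ D₂.Edge ≃ D.Edge) (eQ : D₁.Int ⊕ D₂.Int ≃ D.Int)
    (hed₁ : ∀ e, D.ed (eE (.inl e)) = D₁.ed e) (hed₂ : ∀ e, D.ed (eE (.inr e)) = D₂.ed e)
    (hen₁ : ∀ e b, D.en (eE (.inl e)) b = ρ₁ (D₁.en e b))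
    (hen₂ : ∀ e b, D.en (eE (.inr e)) b = ρ₂ (D₂.en e b))
    (hip₁ : ∀ q, D.ip (eQ (.inl q)) = ρ₁ (D₁.ip q))
    (hip₂ : ∀ q, D.ip (eQ (.inr q)) = ρ₂ (D₂.ip q))
    (htgt₁ : ∀ p, D.tgt (ρ₁ p) = (D₁.tgt p).map .inl)
    (htgt₂ : ∀ p, D.tgt (ρ₂ p) = (D₂.tgt p).map .inr)
    (hsrc₁ : ∀ i, D.src (.inl i) = ρ₁ (D₁.src i)) (hsrc₂ : ∀ i, D.src (.inr i) = ρ₂ (D₂.src i))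
    (x : State c) (y : State c') :
    D.eval (leftPart c c' x * rightPart c c' y) =
      leftPart d d' (D₁.eval x) * rightPart d d' (D₂.eval y) := by
  set R₁ := wmap D₁.pd D.pd fun p => some (ρ₁ p)
  set R₂ := wmap D₂.pd D.pd fun p => some (ρ₂ p)
  have hle₁ : ∀ p q, (fun p => some (ρ₁ p)) p = some q → perp (D₁.pd p) ≤ perp (D.pd q) := by
    rintro p q ⟨⟩; exact hpd₁ p ▸ le_rfl
  have hle₂ : ∀ p q, (fun p => some (ρ₂ p)) p = some q → perp (D₂.pd p) ≤ perp (D.pd q) := by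
    rintro p q ⟨⟩; exact hpd₂ p ▸ le_rfl
  have hin₁ : D.inMap ∘ₗ wmap c (Sum.elim c c') (fun i => some (.inl i)) = R₁ ∘ₗ D₁.inMap := by
    rw [inMap, inMap, wmap_comp (by rintro p q ⟨⟩; exact le_rfl)
      (by rintro p q ⟨⟩; exact D.src_le p), wmap_comp (by rintro p q ⟨⟩; exact D₁.src_le p) hle₁]
    congr 1
    funext i
    simp [hsrc₁]
  have hin₂ : D.inMap ∘ₗ wmap c' (Sum.elim c c') (fun i => some (.inr i)) = R₂ ∘ₗ D₂.inMap := by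
    rw [inMap, inMap, wmap_comp (by rintro p q ⟨⟩; exact le_rfl)
      (by rintro p q ⟨⟩; exact D.src_le p), wmap_comp (by rintro p q ⟨⟩; exact D₂.src_le p) hle₂]
    congr 1
    funext i
    simp [hsrc₂]
  have hout₁ : D.outMap ∘ₗ R₁ = wmap d (Sum.elim d d') (fun i => some (.inl i)) ∘ₗ D₁.outMap := by
    rw [outMap, outMap, wmap_comp hle₁ D.tgt_le,
      wmap_comp D₁.tgt_le (by rintro p q ⟨⟩; exact le_rfl)]
    congr 1
    funext i
    simp only [Option.bind_some, htgt₁]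
    cases D₁.tgt i <;> rfl
  have hout₂ : D.outMap ∘ₗ R₂ = wmap d' (Sum.elim d d') (fun i => some (.inr i)) ∘ₗ D₂.outMap := by
    rw [outMap, outMap, wmap_comp hle₂ D.tgt_le,
      wmap_comp D₂.tgt_le (by rintro p q ⟨⟩; exact le_rfl)]
    congr 1
    funext i
    simp only [Option.bind_some, htgt₂]
    cases D₂.tgt i <;> rfl
  have hπ₁ : ∀ q, D.pt (eQ (.inl q)) ∘ₗ R₂ = 0 := by
    intro q
    refine wsingle_ext fun p => ?_
    rw [LinearMap.comp_assoc, wmap_wsingle_some (f := fun p => some (ρ₂ p)) rfl le_rfl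
      (hpd₂ _ ▸ le_rfl), pt, proj_wsingle_of_ne, LinearMap.zero_comp]
    rw [hip₁]
    exact (hdisj _ _).symm
  have hπ₂ : ∀ q, D.pt (eQ (.inr q)) ∘ₗ R₁ = 0 := by
    intro q
    refine wsingle_ext fun p => ?_
    rw [LinearMap.comp_assoc, wmap_wsingle_some (f := fun p => some (ρ₁ p)) rfl le_rfl
      (hpd₁ _ ▸ le_rfl), pt, proj_wsingle_of_ne, LinearMap.zero_comp]
    rw [hip₂]
    exact hdisj _ _
  have hD₁ : ∀ z, kernelOp (fun e => D.diff (eE (.inl e))) (fun q => D.pt (eQ (.inl q)))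
      (map (R₁ ∘ₗ D₁.inMap) z) = map R₁ (kernelOp D₁.diff D₁.pt (map D₁.inMap z)) := by
    intro z
    rw [kernelOp_congr_left (fun e => D.diff (eE (.inl e))) (fun q => D.pt (eQ (.inl q)))
      (fun e => R₁ ∘ₗ D₁.diff e) (fun q => D.pt (eQ (.inl q)))
      (fun e => diff_transport ρ₁ hpd₁ _ _ (hed₁ e) (hen₁ e)) (fun _ => rfl),
      ← map_map' D₁.inMap R₁, ← map_kernelOp,
      kernelOp_congr_left D₁.diff (fun q => D.pt (eQ (.inl q)) ∘ₗ R₁) D₁.diff D₁.pt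
      (fun _ => rfl) (fun q => pt_transport ρ₁ hpd₁ _ _ (hip₁ q) (fun p h => hinj₁ h))]
  have hD₂ : ∀ z, kernelOp (fun e => D.diff (eE (.inr e))) (fun q => D.pt (eQ (.inr q)))
      (map (R₂ ∘ₗ D₂.inMap) z) = map R₂ (kernelOp D₂.diff D₂.pt (map D₂.inMap z)) := by
    intro z
    rw [kernelOp_congr_left (fun e => D.diff (eE (.inr e))) (fun q => D.pt (eQ (.inr q)))
      (fun e => R₂ ∘ₗ D₂.diff e) (fun q => D.pt (eQ (.inr q)))
      (fun e => diff_transport ρ₂ hpd₂ _ _ (hed₂ e) (hen₂ e)) (fun _ => rfl),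
      ← map_map' D₂.inMap R₂, ← map_kernelOp,
      kernelOp_congr_left D₂.diff (fun q => D.pt (eQ (.inr q)) ∘ₗ R₂) D₂.diff D₂.pt
      (fun _ => rfl) (fun q => pt_transport ρ₂ hpd₂ _ _ (hip₂ q) (fun p h => hinj₂ h))]
  -- Each of the two integrals treats the factor from the other component as a constant.
  have hmul₁ : ∀ a b, kernelOp (fun e => D.diff (eE (.inl e))) (fun q => D.pt (eQ (.inl q)))
      (a * map R₂ b) = kernelOp (fun e => D.diff (eE (.inl e))) (fun q => D.pt (eQ (.inl q))) a *
        map R₂ b := by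
    intro a b
    rw [kernelOp_apply, ← mul_assoc, act_volProd_mul_map _ _ hπ₁, ← kernelOp_apply]
  have hmul₂ : ∀ a b, kernelOp (fun e => D.diff (eE (.inr e))) (fun q => D.pt (eQ (.inr q)))
      (map R₁ a * b) = map R₁ a *
        kernelOp (fun e => D.diff (eE (.inr e))) (fun q => D.pt (eQ (.inr q))) b := by
    intro a b
    rw [kernelOp_apply, ← mul_assoc, ← (edgeProd_central _).comm, mul_assoc,
      act_volProd_map_mul _ _ hπ₂, ← kernelOp_apply]
  have hsplit := kernelOp_split eE eQ D.diff D.pt (fun q e => pt_comp_diff_eq_zero _ _ fun b => by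
      rw [hen₂, hip₁]; exact (hdisj _ _).symm)
  have e1 : map D.inMap (leftPart c c' x * rightPart c c' y) =
      map (R₁ ∘ₗ D₁.inMap) x * map R₂ (map D₂.inMap y) := by
    rw [map_mul, leftPart_eq, rightPart_eq, map_map', map_map', hin₁, hin₂, map_map']
  have e2 : ∀ z, map D.outMap (map R₁ z) = leftPart d d' (map D₁.outMap z) := by
    intro z
    rw [map_map', hout₁, leftPart_eq, map_map']
  have e3 : ∀ z, map D.outMap (map R₂ z) = rightPart d d' (map D₂.outMap z) := by
    intro z
    rw [map_map', hout₂, rightPart_eq, map_map']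
  have e4 : kernelOp D.diff D.pt (map D.inMap (leftPart c c' x * rightPart c c' y)) =
      map R₁ (kernelOp D₁.diff D₁.pt (map D₁.inMap x)) *
        map R₂ (kernelOp D₂.diff D₂.pt (map D₂.inMap y)) := by
    rw [e1, hsplit, hmul₁, hD₁, hmul₂, map_map', hD₂]
  refine (congrArg (map D.outMap) e4).trans ?_
  rw [map_mul, e2, e3]
  rfl

/-- All edge and volume elements have even degree, so they are invariant under `-1`. -/
theorem eval_parity (D : Diagram c d) (x : State c) :
    D.eval (parity c x) = parity d (D.eval x) := by
  have h1 : ∀ z, map (-LinearMap.id) (kernelOp D.diff D.pt z) =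
      kernelOp D.diff D.pt (map (-LinearMap.id) z) := by
    intro z
    have e1 : kernelOp D.diff (fun q => D.pt q ∘ₗ (-LinearMap.id)) = kernelOp D.diff D.pt :=
      kernelOp_congr_left D.diff _ D.diff D.pt (fun _ => rfl)
        (fun q => (congrArg (fun f => map f (cotopElt _)) (dualMap_comp_neg_id (D.pt q))).trans
          (map_neg_cotopElt (D.pt q).dualMap))
    have e2 : kernelOp (fun e => (-LinearMap.id) ∘ₗ D.diff e) D.pt = kernelOp D.diff D.pt :=
      kernelOp_congr_left _ D.pt D.diff D.pt
        (fun e => (congrArg (fun f => map f (topElt _)) (neg_id_comp (D.diff e))).trans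
          (map_neg_topElt (D.diff e))) (fun _ => rfl)
    exact (congrArg (fun k => map (-LinearMap.id) (k z)) e1.symm).trans
      ((map_kernelOp (-LinearMap.id) D.diff D.pt z).trans
        (congrArg (fun k => k (map (-LinearMap.id) z)) e2))
  have h2 : map D.inMap (parity c x) = map (-LinearMap.id) (map D.inMap x) := by
    rw [parity, map_map', map_map', comp_neg_id]
    exact congrArg (fun f => map f x) (neg_id_comp D.inMap).symm
  have h3 : ∀ z, map D.outMap (map (-LinearMap.id) z) = parity d (map D.outMap z) := by
    intro z
    rw [parity, map_map', map_map', neg_id_comp]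
    exact congrArg (fun f => map f z) (comp_neg_id D.outMap)
  exact (congrArg (fun z => map D.outMap (kernelOp D.diff D.pt z)) h2).trans
    ((congrArg (map D.outMap) (h1 _)).symm.trans (h3 _))

/-- The two ends of a loop have difference zero, and a delta function of positive degree at zero
vanishes. -/
theorem eval_eq_zero_of_loop (D : Diagram c d) (e : D.Edge) (h : D.en e true = D.en e false)
    (hr : finrank ℚ (Dbl (D.ed e)) ≠ 0) : D.eval = 0 := by
  have h0 : edgeProd D.diff = 0 := by
    refine centralProd_eq_zero _ _ e ?_
    have : D.diff e = 0 := by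
      rw [diff, h]
      exact LinearMap.ext fun v => sub_self _
    rw [this, topElt, map_smul, map_list]
    have hl : (List.ofFn (dblBasis (D.ed e))) ≠ [] := by
      rw [Ne, List.ofFn_eq_nil_iff]; exact hr
    obtain ⟨a, l, hal⟩ := List.exists_cons_of_ne_nil hl
    rw [hal]
    simp
  refine LinearMap.ext fun x => ?_
  rw [eval_apply, kernelOp_apply, h0]
  simp

theorem topElt_of_rank_zero (h : finrank ℤ N = 0) (a : Nbar N) :
    topElt a = 1 ∧ cotopElt a = 1 := by
  have hN : Subsingleton N := finrank_zero_iff.1 h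
  have ha : a = Nbar.zero := by
    rw [← mk_out a]
    exact mk_eq_zero.2 (Subsingleton.elim _ _)
  subst ha
  have hf : finrank ℚ (Dbl (Nbar.zero : Nbar N)) = 0 := by
    rw [finrank_dbl, finrank_perp_zero, h]
  have hl : List.ofFn (dblBasis (Nbar.zero : Nbar N)) = [] := List.ofFn_eq_nil_iff.2 hf
  have hl' : List.ofFn (dblBasis (Nbar.zero : Nbar N)).coord = [] := List.ofFn_eq_nil_iff.2 hf
  have hs : volScale (Nbar.zero : Nbar N) = 1 := by
    have := trZero_latBasis (N := N)
    rw [List.ofFn_eq_nil_iff.2 h] at this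
    rw [volScale, ιMulti_eq_list, hl, tr_zero_apply]
    exact this
  rw [topElt, cotopElt, hs, hl, hl']
  simp

/-- For `N = 0` every exterior algebra is `ℚ` and every edge and volume element is 1. -/
theorem eval_eq_of_rank_zero (h : finrank ℤ N = 0) (D D' : Diagram c d) : D.eval = D'.eval := by
  have key : ∀ D : Diagram c d, D.eval 1 = 1 := by
    intro D
    have h1 : edgeProd D.diff = 1 := centralProd_one _ _ fun e => by
      rw [(topElt_of_rank_zero h _).1, map_one]
    have h2 : volProd D.pt = 1 := centralProd_one _ _ fun e => by
      rw [(topElt_of_rank_zero h _).2, map_one]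
    rw [eval_apply, kernelOp_apply, h1, h2]
    simp
  have hN : Subsingleton N := finrank_zero_iff.1 h
  refine LinearMap.ext fun x => ?_
  have hx : x = algebraMap ℚ _ (eps x) := by
    rw [← map_zero_apply (M' := (i : I) → Dbl (c i)) x]
    have : (0 : ((i : I) → Dbl (c i)) →ₗ[ℚ] ((i : I) → Dbl (c i))) = LinearMap.id := by
      ext v i n <;> simp [Subsingleton.elim n 0]
    rw [this, map_id']
  rw [hx, Algebra.algebraMap_eq_smul_one, map_smul, map_smul, key, key]

end Diagram

end DiagramOperations

/-! ### The integral of a cobordism and its invariance -/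

section CobordismIntegrals

open ExteriorAlgebra Module

variable {N : Type u} [AddCommGroup N]

namespace Cob

variable {I J K : Type} {c : I → Nbar N} {d : J → Nbar N} {k : K → Nbar N}

/-- The point at which an end of an edge is attached. -/
def endPt (Γ : Cob c d) : Γ.Flag ⊕ (Γ.Joint × Bool) ⊕ (I ⊕ J) → Γ.Vert ⊕ Γ.Joint ⊕ (I ⊕ J) :=
  Sum.map Γ.root (Sum.map Prod.fst id)

/-- The directions of the points of a cobordism. -/
def ptDir (Γ : Cob c d) : Γ.Vert ⊕ Γ.Joint ⊕ (I ⊕ J) → Nbar N :=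
  Sum.elim (fun _ => Nbar.zero) (Sum.elim (fun j => Γ.dir (Γ.ends.symm (.inr (.inl (j, false)))).1)
    (Sum.elim c d))

theorem ptDir_endPt (Γ : Cob c d) (x : (Γ.Joint × Bool) ⊕ (I ⊕ J)) :
    Γ.ptDir (Γ.endPt (.inr x)) = Γ.dir (Γ.ends.symm (.inr x)).1 := by
  rcases x with ⟨j, _ | _⟩ | i | j
  · rfl
  · exact Γ.dir_joint j
  · exact (Γ.dir_in i).symm
  · exact (Γ.dir_out j).symm

theorem dir_eq_ptDir (Γ : Cob c d) {x : Γ.Edge × Bool} {y} (h : Γ.ends x = .inr y) :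
    Γ.dir x.1 = Γ.ptDir (Γ.endPt (.inr y)) := by
  rw [ptDir_endPt, ← h, Equiv.symm_apply_apply]

/-- The integral attached to a cobordism. -/
abbrev diagram [Finite I] [Finite J] (Γ : Cob c d) : Diagram c d where
  Pt := Γ.Vert ⊕ Γ.Joint ⊕ (I ⊕ J)
  Edge := Γ.Edge
  -- Incoming marks are integrated over and outgoing marks are not; thus a glued mark, which becomes
  -- a joint, is integrated exactly once.
  Int := Γ.Vert ⊕ Γ.Joint ⊕ I
  finite_pt := have := Γ.finite_vert; have := Γ.finite_joint; inferInstance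
  finite_edge := Γ.finite_edge
  finite_int := have := Γ.finite_vert; have := Γ.finite_joint; inferInstance
  pd := Γ.ptDir
  ed := Γ.dir
  en e b := Γ.endPt (Γ.ends (e, b))
  ip := Sum.map id (Sum.map id .inl)
  src i := .inr (.inr (.inl i))
  tgt := Sum.elim (fun _ => none) (Sum.elim (fun _ => none) (Sum.elim (fun _ => none) some))
  en_le e b := by
    rcases h : Γ.ends (e, b) with f | x
    · exact perp_le_perp_zero _
    · rw [← Γ.dir_eq_ptDir h]
  src_le _ := le_rfl
  tgt_le := by
    rintro (v | j | i | j) j' h <;> cases h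
    exact le_rfl

variable [Finite I] [Finite J] [Finite K] [Module.Free ℤ N] [Module.Finite ℤ N]

theorem eval_diagram_comp (Γ : Cob c d) (Γ' : Cob d k) :
    (Γ.comp Γ').diagram.eval = Γ'.diagram.eval ∘ₗ Γ.diagram.eval := by
  refine Diagram.eval_comp Γ.diagram Γ'.diagram (Γ.comp Γ').diagram
    (Sum.elim (fun v => .inl (.inl v)) (Sum.elim (fun j => .inr (.inl (.inl j)))
      (Sum.elim (fun i => .inr (.inr (.inl i))) (fun j => .inr (.inl (.inr (.inr j)))))))
    (Sum.elim (fun v => .inl (.inr v)) (Sum.elim (fun j => .inr (.inl (.inr (.inl j))))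
      (Sum.elim (fun j => .inr (.inl (.inr (.inr j)))) (fun k => .inr (.inr (.inr k))))))
    (Sum.elim (Sum.elim (fun _ => none) (fun v => some (.inl v)))
      (Sum.elim (Sum.elim (fun _ => none) (Sum.elim (fun j => some (.inr (.inl j)))
        (fun j => some (.inr (.inr (.inl j))))))
        (Sum.elim (fun _ => none) (fun k => some (.inr (.inr (.inr k)))))))
    ?_ ?_ ?_ ?_ ?_ (Equiv.refl _)
    { toFun := Sum.elim (Sum.elim (fun v => .inl (.inl v)) (Sum.elim (fun j => .inr (.inl (.inl j)))
        (fun i => .inr (.inr i)))) (Sum.elim (fun v => .inl (.inr v))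
        (Sum.elim (fun j => .inr (.inl (.inr (.inl j)))) (fun j => .inr (.inl (.inr (.inr j))))))
      invFun := Sum.elim (Sum.elim (fun v => .inl (.inl v)) (fun v => .inr (.inl v)))
        (Sum.elim (Sum.elim (fun j => .inl (.inr (.inl j))) (Sum.elim
          (fun j => .inr (.inr (.inl j))) (fun j => .inr (.inr (.inr j)))))
          (fun i => .inl (.inr (.inr i))))
      left_inv := by rintro ((v | j | i) | (v | j | i)) <;> rfl
      right_inv := by rintro ((v | v) | (j | j | j) | i) <;> rfl }
    ?_ ?_ ?_ ?_ ?_ ?_ ?_ ?_ ?_ ?_ ?_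
  · rintro (v | j | i | j)
    · rfl
    · rfl
    · rfl
    · exact Γ.dir_out j
  · rintro (v | j | j | k)
    · rfl
    · rfl
    · exact Γ.dir_out j
    · rfl
  · rintro (v | j | i | j) <;> rfl
  · rintro (v | j | i | j) <;> rfl
  · rintro ((v | v) | (j | j | j) | i | i) q hq <;> cases hq
    · exact le_rfl
    · exact le_rfl
    · exact (congrArg perp (Γ.dir_out j)).le
    · exact le_rfl
  · intro e; rfl
  · intro e; rfl
  · intro e b
    change (Γ.comp Γ').endPt (glueEquiv _ _ _ _ _ _ _ (.inl (Γ.ends (e, b)))) =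
      Sum.elim _ _ (Γ.endPt (Γ.ends (e, b)))
    rcases Γ.ends (e, b) with f | ⟨j, _ | _⟩ | i | j <;> rfl
  · intro e b
    change (Γ.comp Γ').endPt (glueEquiv _ _ _ _ _ _ _ (.inr (Γ'.ends (e, b)))) =
      Sum.elim _ _ (Γ'.endPt (Γ'.ends (e, b)))
    rcases Γ'.ends (e, b) with f | ⟨j, _ | _⟩ | i | j <;> rfl
  · rintro (v | j | i) <;> rfl
  · rintro (v | j | i) <;> rfl
  · rintro (v | j | i) (v' | j' | i' | i') h <;> cases h <;> rfl
  · rintro (v | j | i) (v' | j' | i' | i') h <;> cases h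
  · rintro (v | j | i) ((v | v) | (j | j | j) | i | i) h <;> cases h <;> rfl
  · rintro ((v | v) | (j | j | j) | i | i) <;> rfl
  · intro i; rfl

theorem eval_diagram_union {I' J' : Type} [Finite I'] [Finite J'] {c' : I' → Nbar N}
    {d' : J' → Nbar N} (Γ : Cob c d) (Γ' : Cob c' d') (x : State c) (y : State c') :
    (Γ.union Γ').diagram.eval (leftPart c c' x * rightPart c c' y) =
      leftPart d d' (Γ.diagram.eval x) * rightPart d d' (Γ'.diagram.eval y) := by
  refine Diagram.eval_union Γ.diagram Γ'.diagram (Γ.union Γ').diagram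
    (Sum.map .inl (Sum.map .inl (Sum.map .inl .inl)))
    (Sum.map .inr (Sum.map .inr (Sum.map .inr .inr)))
    ?_ ?_ ?_ ?_ ?_ (Equiv.refl _)
    { toFun := Sum.elim (Sum.map .inl (Sum.map .inl .inl)) (Sum.map .inr (Sum.map .inr .inr))
      invFun := Sum.elim (Sum.map .inl .inl) (Sum.elim (Sum.map (fun j => .inr (.inl j))
        (fun j => .inr (.inl j))) (Sum.map (fun j => .inr (.inr j)) (fun j => .inr (.inr j))))
      left_inv := by rintro ((v | j | i) | (v | j | i)) <;> rfl
      right_inv := by rintro ((v | v) | (j | j) | (i | i)) <;> rfl }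
    ?_ ?_ ?_ ?_ ?_ ?_ ?_ ?_ ?_ ?_ x y
  · rintro (v | j | i | j) <;> rfl
  · rintro (v | j | i | j) <;> rfl
  · rintro (v | j | i | j) (v' | j' | i' | j') h <;> cases h <;> rfl
  · rintro (v | j | i | j) (v' | j' | i' | j') h <;> cases h <;> rfl
  · rintro (v | j | i | j) (v' | j' | i' | j') h <;> cases h
  · intro e; rfl
  · intro e; rfl
  · intro e b
    change (Γ.union Γ').endPt (unionEquiv _ _ _ _ _ _ _ _ (.inl (Γ.ends (e, b)))) =
      Sum.map _ _ (Γ.endPt (Γ.ends (e, b)))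
    rcases Γ.ends (e, b) with f | ⟨j, _ | _⟩ | i | j <;> rfl
  · intro e b
    change (Γ.union Γ').endPt (unionEquiv _ _ _ _ _ _ _ _ (.inr (Γ'.ends (e, b)))) =
      Sum.map _ _ (Γ'.endPt (Γ'.ends (e, b)))
    rcases Γ'.ends (e, b) with f | ⟨j, _ | _⟩ | i | j <;> rfl
  · rintro (v | j | i) <;> rfl
  · rintro (v | j | i) <;> rfl
  · rintro (v | j | i | j) <;> rfl
  · rintro (v | j | i | j) <;> rfl
  · intro i; rfl
  · intro i; rfl

theorem IsIso.eval_diagram_eq {Γ Γ' : Cob c d} (h : IsIso Γ Γ') :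
    Γ.diagram.eval = Γ'.diagram.eval := by
  obtain ⟨a, f, j, e, t, s, ht, hs, hroot, -, hdir, hends⟩ := h
  have hpt : ∀ x, Γ'.endPt (Γ'.ends (s x)) = Sum.map a (Sum.map j id) (Γ.endPt (Γ.ends x)) := by
    intro x
    rw [hends]
    rcases Γ.ends x with f | x | x
    · exact congrArg Sum.inl (hroot _)
    · exact congrArg (fun z => Sum.inr (Sum.inl z)) (ht _)
    · rfl
  -- A bijection of edge ends that covers a bijection of edges either preserves or exchanges the two
  -- ends of each edge.
  have hsx : ∀ x b, s (x, b) = (e x, xor b (s (x, false)).2) := by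
    intro x b
    have h1 := hs (x, false)
    have h2 := hs (x, true)
    have h3 : s (x, true) ≠ s (x, false) := by simp
    rcases h4 : s (x, false) with ⟨y, _ | _⟩ <;> rcases h5 : s (x, true) with ⟨z, _ | _⟩ <;>
      rw [h4, h5] at h3 <;> rw [h4] at h1 <;> rw [h5] at h2 <;> simp only at h1 h2 <;>
      subst h1 <;> subst h2 <;> first | exact absurd rfl h3 | (cases b <;> simp [h4, h5])
  refine Diagram.eval_eq_of_elim Γ.diagram Γ'.diagram (X := Empty)
    ((Equiv.sumEmpty _ _).trans e.symm)
    ((Equiv.sumEmpty _ _).trans (Equiv.sumCongr a.symm (Equiv.sumCongr j.symm (Equiv.refl _))))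
    (Sum.map a (Sum.map j id)) (Sum.map a.symm (Sum.map j.symm id)) ?_ ?_ ?_ Empty.rec Empty.rec
    Empty.rec Empty.rec ?_ ?_ ?_ ?_ ?_
  · rintro (v | j | i) <;> simp
  · rintro (v | j' | i)
    · rfl
    · obtain ⟨j₁, rfl⟩ := j.surjective j'
      change Γ.ptDir (.inr (.inl (j.symm (j j₁)))) = Γ'.ptDir (.inr (.inl (j j₁)))
      rw [Equiv.symm_apply_apply]
      obtain ⟨x, hx⟩ := Γ.ends.surjective (.inr (.inl (j₁, false)))
      have h1 := Γ.dir_eq_ptDir hx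
      have h2 := hends x
      rw [hx] at h2
      have h3 := Γ'.dir_eq_ptDir h2
      rw [hs, hdir, h1] at h3
      refine h3.trans ?_
      change Γ'.ptDir (.inr (.inl (t (j₁, false)).1)) = _
      rw [ht]
    · rfl
  · rintro (v | j | i) <;> simp
  · intro x
    change Γ.dir (e.symm x) = Γ'.dir x
    rw [← hdir, Equiv.apply_symm_apply]
  · intro x
    refine ⟨(s (e.symm x, false)).2, fun b => ?_⟩
    change Γ'.endPt (Γ'.ends (x, b)) = Sum.map a (Sum.map j id)
      (Γ.endPt (Γ.ends (e.symm x, xor b (s (e.symm x, false)).2)))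
    rw [← hpt, hsx, Equiv.apply_symm_apply, Bool.xor_assoc, Bool.xor_self, Bool.xor_false]
  · rintro (v | j | i) <;> rfl
  · intro i; rfl
  · rintro (v | j | i | j) <;> rfl

/-- For distinct end vertices, the edge of direction `0` is the full delta function between them, so
the vertex `root f₁` is integrated away along it. -/
theorem IsContraction.eval_diagram_eq {Γ Γ' : Cob c d} {e₀ : Γ.Edge} {f₀ f₁ : Γ.Flag}
    {p : Γ.Vert → Γ'.Vert} (e : Γ'.Edge ≃ {x : Γ.Edge // x ≠ e₀}) (j : Γ'.Joint ≃ Γ.Joint)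
    (f : Γ'.Flag → Γ.Flag)
    (hd : Γ.dir e₀ = Nbar.zero) (h₀ : Γ.ends (e₀, false) = Sum.inl f₀)
    (h₁ : Γ.ends (e₀, true) = Sum.inl f₁) (hp : Function.Surjective p)
    (hpe : ∀ x y, p x = p y ↔ x = y ∨ (x = Γ.root f₀ ∧ y = Γ.root f₁) ∨
      (x = Γ.root f₁ ∧ y = Γ.root f₀))
    (hne : Γ.root f₀ ≠ Γ.root f₁) (hroot : ∀ x, Γ'.root x = p (Γ.root (f x)))
    (hdir : ∀ x, Γ'.dir x = Γ.dir (e x).1)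
    (hends : ∀ x b, Γ.ends ((e x).1, b) =
      Sum.map f (Sum.map (Prod.map j id) id) (Γ'.ends (x, b))) :
    Γ.diagram.eval = Γ'.diagram.eval := by
  classical
  -- A section of the vertex map that avoids the vertex to be eliminated: the merged vertex is
  -- represented by `root f₀`.
  obtain ⟨s, hs⟩ : ∃ s : Γ'.Vert → Γ.Vert, ∀ v, p (s v) = v ∧ s v ≠ Γ.root f₁ := by
    choose s hs using hp
    refine ⟨fun v => if s v = Γ.root f₁ then Γ.root f₀ else s v, fun v => ?_⟩
    by_cases h : s v = Γ.root f₁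
    · simp only [if_pos h]
      refine ⟨?_, hne⟩
      rw [← hs v, hpe, h]
      simp
    · simp only [if_neg h]
      exact ⟨hs v, h⟩
  have hsp : ∀ v, v ≠ Γ.root f₁ → s (p v) = v := by
    intro v hv
    rcases (hpe (s (p v)) v).1 (hs _).1 with h | ⟨-, h⟩ | ⟨h, -⟩
    · exact h
    · exact absurd h hv
    · exact absurd h (hs _).2
  have hp1 : p (Γ.root f₁) = p (Γ.root f₀) := by rw [hpe]; simp
  refine Diagram.eval_eq_of_elim Γ.diagram Γ'.diagram (X := Unit)
    (Equiv.ofBijective (Sum.elim (fun x => (e x).1) (fun _ => e₀)) ⟨?_, ?_⟩)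
    (Equiv.ofBijective (Sum.elim (Sum.map s (Sum.map j id)) (fun _ => .inl (Γ.root f₁))) ⟨?_, ?_⟩)
    (Sum.map p (Sum.map j.symm id)) (Sum.map s (Sum.map j id)) ?_ ?_ ?_ ?_ ?_ ?_ ?_ ?_ ?_ ?_ ?_ ?_
  · rintro (x | x) (y | y) h
    · exact congrArg Sum.inl (e.injective (Subtype.ext h))
    · exact absurd h (e x).2
    · exact absurd h.symm (e y).2
    · rfl
  · intro x
    by_cases h : x = e₀
    · exact ⟨.inr (), h.symm⟩
    · exact ⟨.inl (e.symm ⟨x, h⟩), by simp⟩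
  · rintro ((v | i | i) | x) ((v' | i' | i') | y) h
    · have := (hs v).1.symm.trans ((congrArg p (Sum.inl.inj h)).trans (hs v').1)
      rw [this]
    all_goals first
      | (cases h; done)
      | (exact absurd (Sum.inl.inj h) (hs _).2)
      | (exact absurd (Sum.inl.inj h).symm (hs _).2)
      | rfl
      | (simp at h; rw [h])
  · rintro (v | i | i)
    · by_cases h : v = Γ.root f₁
      · exact ⟨.inr (), by rw [h]; rfl⟩
      · exact ⟨.inl (.inl (p v)), congrArg Sum.inl (hsp v h)⟩
    · exact ⟨.inl (.inr (.inl (j.symm i))), by simp⟩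
    · exact ⟨.inl (.inr (.inr i)), rfl⟩
  · rintro (v | i | i)
    · exact congrArg Sum.inl (hs v).1
    · simp
    · rfl
  · rintro (v | i | i)
    · rfl
    · obtain ⟨x, hx⟩ := Γ'.ends.surjective (.inr (.inl (i, false)))
      have h1 := Γ'.dir_eq_ptDir hx
      have h2 := hends x.1 x.2
      rw [hx] at h2
      have h3 := Γ.dir_eq_ptDir h2
      exact h3.symm.trans ((hdir x.1).symm.trans h1)
    · rfl
  · rintro (v | i | i)
    · by_cases h : v = Γ.root f₁
      · exact .inr ⟨(), congrArg Sum.inl h⟩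
      · exact .inl (congrArg Sum.inl (hsp v h))
    · left; simp
    · left; rfl
  · intro x
    refine ⟨true, ?_, ?_⟩
    · exact congrArg Γ.endPt h₁
    · refine (congrArg Γ.endPt h₀).trans (congrArg Sum.inl ?_)
      change Γ.root f₀ = s (p (Γ.root f₁))
      rw [hp1, hsp _ hne]
  · intro x; exact hd
  · rintro x (v | i | i) h
    · exact (hs v).2 (Sum.inl.inj h)
    · cases h
    · cases h
  · intro x y _; rfl
  · intro x; exact (hdir x).symm
  · intro x
    refine ⟨false, fun b => ?_⟩
    rw [Bool.xor_false]
    change Γ'.endPt (Γ'.ends (x, b)) = Sum.map p (Sum.map j.symm id) (Γ.endPt (Γ.ends ((e x).1, b)))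
    rw [hends]
    rcases Γ'.ends (x, b) with f | x | x
    · exact congrArg Sum.inl (hroot _)
    · simp [endPt]
    · rfl
  · rintro (v | i | i) <;> rfl
  · intro i; rfl
  · rintro (v | i | i | i) <;> rfl

/-- The joint `j₀` has the direction of the two edges it separates, so it is integrated away along
`e₂`. -/
theorem IsSmoothing.eval_diagram_eq {Γ Γ' : Cob c d} (h : IsSmoothing Γ Γ') :
    Γ.diagram.eval = Γ'.diagram.eval := by
  classical
  obtain ⟨j₀, e₁, e₂, a, f, j, e, hne, h₁, h₂, hroot, -, hdir, hends, hends'⟩ := h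
  set x₁ : Γ'.Edge := e.symm ⟨e₁, hne⟩ with hx₁
  have hex₁ : (e x₁).1 = e₁ := by rw [hx₁, Equiv.apply_symm_apply]
  set s : Γ'.Vert ⊕ Γ'.Joint ⊕ (I ⊕ J) → Γ.Vert ⊕ Γ.Joint ⊕ (I ⊕ J) :=
    Sum.map a (Sum.map (fun y => (j y).1) id) with hs
  -- The erased joint is moved along `e₂` to its far end, which is the second end of the merged edge
  -- `x₁`.
  set r : Γ.Vert ⊕ Γ.Joint ⊕ (I ⊕ J) → Γ'.Vert ⊕ Γ'.Joint ⊕ (I ⊕ J) :=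
    Sum.elim (fun v => .inl (a.symm v)) (Sum.elim (fun i => if h : i ≠ j₀ then
      .inr (.inl (j.symm ⟨i, h⟩)) else Γ'.endPt (Γ'.ends (x₁, true))) (fun i => .inr (.inr i)))
    with hr
  have hrs : ∀ p, r (s p) = p := by
    rintro (v | i | i)
    · simp [hs, hr]
    · simp [hs, hr, (j i).2]
    · rfl
  have hrj : r (.inr (.inl j₀)) = Γ'.endPt (Γ'.ends (x₁, true)) := by simp [hr]
  have hsend : ∀ y, Γ.endPt (Sum.map f (Sum.map (Prod.map (fun y => (j y).1) id) id) y) =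
      s (Γ'.endPt y) := by
    rintro (y | y | y)
    · exact congrArg Sum.inl (hroot _)
    · rfl
    · rfl
  have hd : Γ.dir e₂ = Γ.dir e₁ :=
    (Γ.dir_eq_ptDir h₂).trans (Γ.dir_eq_ptDir h₁).symm
  refine Diagram.eval_eq_of_elim Γ.diagram Γ'.diagram (X := Unit)
    (Equiv.ofBijective (Sum.elim (fun x => (e x).1) (fun _ => e₂)) ⟨?_, ?_⟩)
    (Equiv.ofBijective (Sum.elim (Sum.map a (Sum.map (fun y => (j y).1) id))
      (fun _ => .inr (.inl j₀))) ⟨?_, ?_⟩)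
    r s hrs ?_ ?_ ?_ ?_ ?_ ?_ ?_ ?_ ?_ ?_ ?_
  · rintro (x | x) (y | y) h
    · exact congrArg Sum.inl (e.injective (Subtype.ext h))
    · exact absurd h (e x).2
    · exact absurd h.symm (e y).2
    · rfl
  · intro x
    by_cases h : x = e₂
    · exact ⟨.inr (), h.symm⟩
    · exact ⟨.inl (e.symm ⟨x, h⟩), by simp⟩
  · rintro ((v | i | i) | x) ((v' | i' | i') | y) h
    all_goals first
      | (cases h; done)
      | (exact absurd (Sum.inl.inj (Sum.inr.inj h)) (j _).2)
      | (exact absurd (Sum.inl.inj (Sum.inr.inj h)).symm (j _).2)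
      | rfl
      | (simp [Subtype.val_inj] at h; rw [h])
  · rintro (v | i | i)
    · exact ⟨.inl (.inl (a.symm v)), by simp⟩
    · by_cases h : i = j₀
      · exact ⟨.inr (), by rw [h]; rfl⟩
      · exact ⟨.inl (.inr (.inl (j.symm ⟨i, h⟩))), by simp⟩
    · exact ⟨.inl (.inr (.inr i)), rfl⟩
  · rintro (v | i | i)
    · rfl
    · obtain ⟨⟨x, b⟩, hx⟩ := Γ'.ends.surjective (.inr (.inl (i, false)))
      have h1 := Γ'.dir_eq_ptDir hx
      refine Eq.trans ?_ h1
      by_cases hb : (e x).1 ≠ e₁ ∨ b = false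
      · have h2 := hends x b hb
        rw [hx] at h2
        exact (Γ.dir_eq_ptDir h2).symm.trans (hdir x).symm
      · push Not at hb
        have h2 := hends' x hb.1
        have hb2 : b = true := by simpa using hb.2
        rw [← hb2, hx] at h2
        refine (Γ.dir_eq_ptDir h2).symm.trans ?_
        rw [hdir, hb.1, hd]
    · rfl
  · rintro (v | i | i)
    · left; simp [hs, hr]
    · by_cases h : i = j₀
      · right; exact ⟨(), by rw [h]; rfl⟩
      · left; simp [hs, hr, h]
    · left; rfl
  · intro x
    refine ⟨false, congrArg Γ.endPt h₂, ?_⟩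
    change Γ.endPt (Γ.ends (e₂, true)) = s (r (.inr (.inl j₀)))
    rw [hrj, hends' x₁ hex₁, hsend]
  · intro x
    exact Γ.dir_eq_ptDir h₂
  · rintro x (v | i | i) h
    · cases h
    · exact (j i).2 (Sum.inl.inj (Sum.inr.inj h))
    · cases h
  · intro x y _; rfl
  · intro x; exact (hdir x).symm
  · intro x
    refine ⟨false, fun b => ?_⟩
    rw [Bool.xor_false]
    change Γ'.endPt (Γ'.ends (x, b)) = r (Γ.endPt (Γ.ends ((e x).1, b)))
    by_cases hb : (e x).1 ≠ e₁ ∨ b = false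
    · rw [hends x b hb, hsend, hrs]
    · push Not at hb
      obtain ⟨hb, hb2⟩ := hb
      obtain rfl : b = true := by simpa using hb2
      rw [hb, h₁]
      have : x = x₁ := by rw [hx₁, Equiv.eq_symm_apply]; exact Subtype.ext hb
      rw [this]
      exact hrj.symm
  · rintro (v | i | i) <;> rfl
  · intro i; rfl
  · rintro (v | i | i | i) <;> rfl

end Cob

end CobordismIntegrals

/-! ### Elementary cobordisms and construction of the functor -/

section MultiplicityTheory

open ExteriorAlgebra Module

variable {N : Type u} [AddCommGroup N] [Module.Free ℤ N] [Module.Finite ℤ N]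

namespace Diagram

variable {I J : Type} [Finite I] [Finite J] {c : I → Nbar N} {d : J → Nbar N}

theorem eval_of_isEmpty (D : Diagram c d) [IsEmpty D.Edge] [IsEmpty D.Int] (x : State c) :
    D.eval x = map (D.outMap ∘ₗ D.inMap) x := by
  have h1 : edgeProd D.diff = 1 := centralProd_isEmpty _ _
  have h2 : volProd D.pt = 1 := centralProd_isEmpty _ _
  rw [eval_apply, kernelOp_apply, h1, h2, map_one, one_mul, ← map_map']
  rfl

theorem eval_of_unique (D : Diagram c d) [IsEmpty D.Edge] [Unique D.Int]
    (h : ∀ p, D.tgt p = none) (x : State c) :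
    D.eval x = algebraMap ℚ _ (tr _ (map (D.pt default ∘ₗ D.inMap) x)) := by
  have h1 : edgeProd D.diff = 1 := centralProd_isEmpty _ _
  have h2 : volProd D.pt = map (D.pt default).dualMap (cotopElt _) := centralProd_unique _ _
  have h3 : D.outMap = 0 := by
    rw [outMap, show D.tgt = fun _ => none from funext h]
    exact wmap_none
  rw [eval_apply, kernelOp_apply, h1, h2, one_mul, h3, map_zero_apply, ← eps_map (D.pt default),
    map_act, eps_act_cotopElt, map_map']

end Diagram

section BasicDiagrams

variable {I J : Type} [Finite I] [Finite J]

/-- The points `J`, with neither edges nor integrations. -/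
abbrev relabelDiagram (σ : I ≃ J) (d : J → Nbar N) : Diagram (fun i => d (σ i)) d where
  Pt := J
  Edge := Empty
  Int := Empty
  finite_pt := inferInstance
  finite_edge := inferInstance
  finite_int := inferInstance
  pd := d
  ed := Empty.elim
  en := Empty.elim
  ip := Empty.elim
  src := σ
  tgt := some
  en_le e := e.elim
  src_le _ := le_rfl
  tgt_le := by rintro p j ⟨⟩; exact le_rfl

/-- A single point of direction `0`, not integrated over. -/
abbrev mulDiagram (c : I → Nbar N) : Diagram c (oneObj Nbar.zero) where
  Pt := Unit
  Edge := Empty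
  Int := Empty
  finite_pt := inferInstance
  finite_edge := inferInstance
  finite_int := inferInstance
  pd _ := Nbar.zero
  ed := Empty.elim
  en := Empty.elim
  ip := Empty.elim
  src _ := ()
  tgt := some
  en_le e := e.elim
  src_le _ := perp_le_perp_zero _
  tgt_le := by rintro p j ⟨⟩; exact le_rfl

/-- A single integrated point. -/
abbrev traceDiagram (c : I → Nbar N) (n : Nbar N) (h : ∀ i, perp (c i) ≤ perp n) :
    Diagram c (emptyObj : Empty → Nbar N) where
  Pt := Unit
  Edge := Empty
  Int := Unit
  finite_pt := inferInstance
  finite_edge := inferInstance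
  finite_int := inferInstance
  pd _ := n
  ed := Empty.elim
  en := Empty.elim
  ip := id
  src _ := ()
  tgt _ := none
  en_le e := e.elim
  src_le := h
  tgt_le := by rintro p j ⟨⟩

/-- An integrated point of direction `0` joined to an outgoing point. -/
abbrev starDiagram (c : I → Nbar N) (n : Nbar N) : Diagram c (oneObj n) where
  Pt := Unit ⊕ Unit
  Edge := Unit
  Int := Unit
  finite_pt := inferInstance
  finite_edge := inferInstance
  finite_int := inferInstance
  pd := Sum.elim (fun _ => Nbar.zero) (fun _ => n)
  ed _ := n
  en _ b := if b then .inl () else .inr ()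
  ip := .inl
  src _ := .inl ()
  tgt := Sum.elim (fun _ => none) some
  en_le := by rintro e (_ | _); exacts [le_rfl, perp_le_perp_zero _]
  src_le _ := perp_le_perp_zero _
  tgt_le := by rintro (p | p) j h <;> cases h; exact le_rfl

/-- Each incoming mark is integrated away along its edge, leaving the relabelled outgoing marks. -/
theorem eval_diagram_ofEquiv (σ : I ≃ J) (d : J → Nbar N) :
    (Cob.ofEquiv σ d).diagram.eval = (reindex σ d).toLinearMap := by
  have h : (Cob.ofEquiv σ d).diagram.eval = (relabelDiagram σ d).eval := by
    refine Diagram.eval_eq_of_elim (Cob.ofEquiv σ d).diagram (relabelDiagram σ d) (X := I)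
      (Equiv.emptySum _ _)
      ((Equiv.emptySum _ _).trans ((Equiv.emptySum Empty I).symm.trans
        (Equiv.emptySum Empty (Empty ⊕ I)).symm))
      (Sum.elim Empty.elim (Sum.elim Empty.elim (Sum.elim σ id))) (fun j => .inr (.inr (.inr j)))
      ?_ ?_ ?_ ?_ ?_ ?_ ?_ Empty.rec Empty.rec Empty.rec ?_ ?_
    · intro j; rfl
    · intro j; rfl
    · rintro (⟨⟨⟩⟩ | ⟨⟨⟩⟩ | i | j)
      · exact .inr ⟨i, rfl⟩
      · exact .inl rfl
    · intro i
      exact ⟨false, rfl, rfl⟩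
    · intro i; rfl
    · intro i p h
      cases h
    · intro i i' h
      cases h
      rfl
    · intro i; rfl
    · intro j; rfl
  rw [h]
  refine LinearMap.ext fun x => ?_
  rw [Diagram.eval_of_isEmpty, AlgHom.toLinearMap_apply, reindex]
  refine congrArg (fun f => map f x) (wsingle_ext fun i => ?_)
  rw [LinearMap.comp_assoc, Diagram.inMap_wsingle _ _ _ le_rfl]
  refine (wmap_wsingle_some (f := some) (pd := d) (pd' := d) rfl le_rfl le_rfl).trans ?_
  refine LinearMap.ext fun v => funext fun j => ?_
  obtain ⟨i', rfl⟩ := σ.surjective j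
  refine Eq.trans ?_ (Equiv.piCongrLeft_apply_apply (fun j => Dbl (d j)) σ _ i').symm
  by_cases h : i = i'
  · subst h
    exact (wsingle_apply_self (pd := d) (σ i) v).trans
      (wsingle_apply_self (pd := fun i => d (σ i)) i v).symm
  · exact (wsingle_apply_of_ne (pd := d) (σ.injective.ne h) v).trans
      (wsingle_apply_of_ne (pd := fun i => d (σ i)) h v).symm

theorem eval_diagram_corolla_one (c : I → Nbar N) (n : Nbar N) :
    (Cob.corolla c (oneObj n)).diagram.eval = (starDiagram c n).eval := by
  refine Diagram.eval_eq_of_elim (Cob.corolla c (oneObj n)).diagram (starDiagram c n) (X := I)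
    (Equiv.sumComm _ _)
    (Equiv.sumCongr (Equiv.refl _) (Equiv.emptySum Empty I).symm)
    (Sum.elim .inl (Sum.elim Empty.elim (Sum.elim (fun _ => .inl ()) .inr)))
    (Sum.elim .inl (fun j => .inr (.inr (.inr j))))
    ?_ ?_ ?_ ?_ ?_ ?_ ?_ ?_ ?_ ?_ ?_ ?_
  · rintro (j | j) <;> rfl
  · rintro (j | j) <;> rfl
  · rintro (v | ⟨⟨⟩⟩ | i | j)
    · exact .inl rfl
    · exact .inr ⟨i, rfl⟩
    · exact .inl rfl
  · intro i
    exact ⟨false, rfl, rfl⟩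
  · intro i; rfl
  · rintro i (p | p) h <;> cases h
  · intro i i' h
    cases h
    rfl
  · intro e; rfl
  · intro e
    exact ⟨false, by rintro (_ | _) <;> rfl⟩
  · intro q; rfl
  · intro i; rfl
  · rintro (j | j) <;> rfl

/-- If the outgoing edge has direction `0` as well, the vertex itself can be integrated away, and
what is left is multiplication in `C_0`. -/
theorem eval_starDiagram_zero (c : I → Nbar N) :
    (starDiagram c Nbar.zero).eval = (mulDiagram c).eval := by
  refine Diagram.eval_eq_of_elim (starDiagram c Nbar.zero) (mulDiagram c) (X := Unit)
    (Equiv.emptySum _ _) (Equiv.emptySum _ _) (fun _ => ()) .inr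
    ?_ ?_ ?_ ?_ ?_ ?_ ?_ Empty.rec Empty.rec Empty.rec ?_ ?_
  · intro p; rfl
  · intro p; rfl
  · rintro (p | p)
    · exact .inr ⟨(), rfl⟩
    · exact .inl rfl
  · intro p
    exact ⟨true, rfl, rfl⟩
  · intro p; rfl
  · intro p q h
    cases h
  · intro p q _; rfl
  · intro i; rfl
  · intro p; rfl

theorem eval_diagram_corolla_counit :
    (Cob.corolla (oneObj (Nbar.zero : Nbar N)) emptyObj).diagram.eval =
      (traceDiagram (oneObj Nbar.zero) Nbar.zero fun _ => le_rfl).eval := by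
  refine Diagram.eval_eq_of_elim (Cob.corolla (oneObj (Nbar.zero : Nbar N)) emptyObj).diagram
    (traceDiagram (oneObj Nbar.zero) Nbar.zero fun _ => le_rfl) (X := Unit)
    (Equiv.sumComm _ _)
    (Equiv.sumCongr (Equiv.refl _) (Equiv.emptySum Empty Unit).symm) (fun _ => ()) .inl
    ?_ ?_ ?_ ?_ ?_ ?_ ?_ Empty.rec Empty.rec ?_ ?_ ?_
  · intro p; rfl
  · intro p; rfl
  · rintro (p | ⟨⟨⟩⟩ | p | ⟨⟨⟩⟩)
    · exact .inl rfl
    · exact .inr ⟨(), rfl⟩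
  · intro p
    exact ⟨false, rfl, rfl⟩
  · intro p; rfl
  · intro p q h
    cases h
  · intro p q _; rfl
  · intro p; rfl
  · intro i; rfl
  · intro p; rfl

theorem eval_diagram_cap (n : Nbar N) :
    (Cob.cap n).diagram.eval = (traceDiagram (fun _ : Bool => n) n fun _ => le_rfl).eval := by
  refine Diagram.eval_eq_of_elim (Cob.cap n).diagram
    (traceDiagram (fun _ : Bool => n) n fun _ => le_rfl) (X := Unit)
    (Equiv.emptySum _ _)
    { toFun := Sum.elim (fun _ => .inr (.inr false)) (fun _ => .inr (.inr true))
      invFun := Sum.elim Empty.elim (Sum.elim Empty.elim fun b => if b then .inr () else .inl ())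
      left_inv := by rintro (_ | _) <;> rfl
      right_inv := by rintro (⟨⟨⟩⟩ | ⟨⟨⟩⟩ | _ | _) <;> rfl } (fun _ => ())
    (fun _ => .inr (.inr (.inl false)))
    ?_ ?_ ?_ ?_ ?_ ?_ ?_ Empty.rec Empty.rec ?_ ?_ ?_
  · intro p; rfl
  · intro p; rfl
  · rintro (⟨⟨⟩⟩ | ⟨⟨⟩⟩ | (_ | _) | ⟨⟨⟩⟩)
    · exact .inl rfl
    · exact .inr ⟨(), rfl⟩
  · intro p
    exact ⟨true, rfl, rfl⟩
  · intro p; rfl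
  · intro p q h
    cases h
  · intro p q _; rfl
  · intro p; rfl
  · intro i; rfl
  · intro p; rfl

end BasicDiagrams

section Functor

variable {I J K : Type} [Finite I] [Finite J] [Finite K] {c : I → Nbar N} {d : J → Nbar N}
  {k : K → Nbar N}

open Classical in
/-- Cobordisms with a vertex of positive genus are sent to zero, unless `N = 0`. -/
def genusFactor (Γ : Cob c d) : ℚ :=
  if finrank ℤ N = 0 ∨ ∀ v, Γ.genus v = 0 then 1 else 0

/-- The linear map attached to a cobordism by the multiplicity TrQFT. -/
def multMap (Γ : Cob c d) : State c →ₗ[ℚ] State d := genusFactor Γ • Γ.diagram.eval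

theorem genusFactor_congr {I' J' : Type} {c' : I' → Nbar N}
    {d' : J' → Nbar N} {Γ : Cob c d} {Γ' : Cob c' d'}
    (h : (∀ v, Γ.genus v = 0) ↔ ∀ v, Γ'.genus v = 0) : genusFactor Γ = genusFactor Γ' := by
  unfold genusFactor
  rw [h]

theorem multMap_of_genus {Γ : Cob c d} (h : ∀ v, Γ.genus v = 0) :
    multMap Γ = Γ.diagram.eval := by
  rw [multMap, genusFactor, if_pos (.inr h), one_smul]

/-- Three cases. In rank zero all integrals agree. A contracted loop has a vanishing delta function
on one side and creates positive genus on the other. An edge between distinct vertices is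
eliminated, and the sum of two genera is zero only if both are. -/
theorem multMap_contraction {Γ Γ' : Cob c d} (h : Cob.IsContraction Γ Γ') :
    multMap Γ = multMap Γ' := by
  obtain ⟨e₀, f₀, f₁, p, e, f, j, hd, h₀, h₁, hp, hpe, hg, hg1, hg2, hroot, hdir, hends⟩ := h
  by_cases hr : finrank ℤ N = 0
  · rw [multMap, multMap, genusFactor, genusFactor, if_pos (.inl hr), if_pos (.inl hr),
      Diagram.eval_eq_of_rank_zero hr]
  by_cases hne : Γ.root f₀ = Γ.root f₁
  · have h1 : Γ.diagram.eval = 0 := by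
      refine Diagram.eval_eq_zero_of_loop Γ.diagram e₀ ?_ ?_
      · change Γ.endPt (Γ.ends (e₀, true)) = Γ.endPt (Γ.ends (e₀, false))
        rw [h₀, h₁]
        exact congrArg Sum.inl hne.symm
      · change finrank ℚ (Dbl (Γ.dir e₀)) ≠ 0
        rw [hd, finrank_dbl, finrank_perp_zero]
        omega
    have h2 : genusFactor Γ' = 0 := by
      refine if_neg ?_
      push Not
      exact ⟨hr, p (Γ.root f₀), by rw [hg2 hne]; omega⟩
    rw [multMap, multMap, h1, h2, smul_zero, zero_smul]
  · have hgen : (∀ v, Γ.genus v = 0) ↔ ∀ v, Γ'.genus v = 0 := by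
      have h01 : p (Γ.root f₁) = p (Γ.root f₀) := by rw [hpe]; simp
      constructor
      · intro h v
        obtain ⟨w, rfl⟩ := hp v
        by_cases hw0 : w = Γ.root f₀
        · rw [hw0, hg1 hne, h, h]
        by_cases hw1 : w = Γ.root f₁
        · rw [hw1, h01, hg1 hne, h, h]
        rw [hg w hw0 hw1, h]
      · intro h w
        have := hg1 hne
        rw [h] at this
        by_cases hw0 : w = Γ.root f₀
        · rw [hw0]; omega
        by_cases hw1 : w = Γ.root f₁
        · rw [hw1]; omega
        rw [← hg w hw0 hw1, h]
    rw [multMap, multMap, genusFactor_congr hgen,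
      Cob.IsContraction.eval_diagram_eq e j (fun y => (f y).1) hd h₀ h₁ hp hpe hne hroot hdir hends]

theorem multMap_equivalent {Γ Γ' : Cob c d} (h : Cob.Equivalent Γ Γ') :
    multMap Γ = multMap Γ' := by
  induction h with
  | rel Γ Γ' h =>
    rcases h with h | h | h
    · have h' := h
      obtain ⟨a, f, j, e, t, s, -, -, -, hg, -⟩ := h'
      rw [multMap, multMap, h.eval_diagram_eq, genusFactor_congr]
      exact ⟨fun H v => by rw [← a.apply_symm_apply v, hg, H], fun H v => by rw [← hg, H]⟩
    · exact multMap_contraction h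
    · have h' := h
      obtain ⟨j₀, e₁, e₂, a, f, j, e, -, -, -, -, hg, -⟩ := h'
      rw [multMap, multMap, h.eval_diagram_eq, genusFactor_congr]
      exact ⟨fun H v => by rw [← hg, H], fun H v => by rw [← a.apply_symm_apply v, hg, H]⟩
  | refl => rfl
  | symm _ _ _ h => exact h.symm
  | trans _ _ _ _ _ h h' => exact h.trans h'

theorem genusFactor_mul {I' J' I'' J'' : Type} {c' : I' → Nbar N}
    {d' : J' → Nbar N} {c'' : I'' → Nbar N} {d'' : J'' → Nbar N} {Γ : Cob c d} {Γ' : Cob c' d'}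
    {Γ'' : Cob c'' d''}
    (h : (∀ v, Γ''.genus v = 0) ↔ (∀ v, Γ.genus v = 0) ∧ ∀ v, Γ'.genus v = 0) :
    genusFactor Γ'' = genusFactor Γ * genusFactor Γ' := by
  unfold genusFactor
  rw [h]
  by_cases h0 : finrank ℤ N = 0
  · simp [h0]
  · by_cases h1 : ∀ v, Γ.genus v = 0 <;> by_cases h2 : ∀ v, Γ'.genus v = 0 <;> simp [h0, h1, h2]

end Functor

variable (N) in
/-- The multiplicity TrQFT. -/
def multTrQFT : TrQFT N where
  map Γ := multMap Γ
  map_parity Γ x := by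
    rw [multMap, LinearMap.smul_apply, LinearMap.smul_apply, Diagram.eval_parity, map_smul]
  map_equivalent _ _ h := multMap_equivalent h
  map_comp Γ Γ' := by
    have hg : genusFactor (Γ.comp Γ') = genusFactor Γ * genusFactor Γ' := genusFactor_mul
      ⟨fun h => ⟨fun v => h (.inl v), fun v => h (.inr v)⟩, fun h v => by
        rcases v with v | v
        exacts [h.1 v, h.2 v]⟩
    rw [multMap, multMap, multMap, Cob.eval_diagram_comp, LinearMap.smul_comp, LinearMap.comp_smul,
      smul_smul, hg, mul_comm]
  map_ofEquiv σ d := by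
    rw [multMap_of_genus (Γ := Cob.ofEquiv σ d) (fun v => Empty.elim v), eval_diagram_ofEquiv]
  map_union Γ Γ' x y := by
    have hg : genusFactor (Γ.union Γ') = genusFactor Γ * genusFactor Γ' := genusFactor_mul
      ⟨fun h => ⟨fun v => h (.inl v), fun v => h (.inr v)⟩, fun h v => by
        rcases v with v | v
        exacts [h.1 v, h.2 v]⟩
    rw [multMap, multMap, multMap, LinearMap.smul_apply, LinearMap.smul_apply,
      LinearMap.smul_apply, Cob.eval_diagram_union, map_smul, map_smul, smul_mul_smul_comm, hg]

end MultiplicityTheory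

/-! ### Unit, product, trace, pairing and contraction of the theory -/

section MultiplicityData

open ExteriorAlgebra Module

variable {N : Type u} [AddCommGroup N] [Module.Free ℤ N] [Module.Finite ℤ N]

/-- The projection of `0^⊥ ⊕ 0^⊥` onto `n^⊥ ⊕ n^⊥` along `(m, 0)` and `(0, m)`, for `m(n) = 1`. -/
def dblProj (n : N) (m : N →ₗ[ℤ] ℚ) (hm : m n = 1) :
    Dbl (Nbar.zero : Nbar N) →ₗ[ℚ] Dbl (Nbar.mk n) :=
  let f : perp (Nbar.zero : Nbar N) →ₗ[ℚ] perp (Nbar.mk n) :=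
    LinearMap.codRestrict _ ((perp Nbar.zero).subtype -
      (evalAt n ∘ₗ (perp Nbar.zero).subtype).smulRight m) fun a => by
      rw [mem_perp_mk]
      simp [hm, evalAt]
  f.prodMap f

theorem dblProj_comp_dblIncl (n : N) (m : N →ₗ[ℤ] ℚ) (hm : m n = 1) :
    dblProj n m hm ∘ₗ dblIncl (Nbar.mk n) = LinearMap.id := by
  have h : ∀ a : perp (Nbar.mk n), (a : N →ₗ[ℤ] ℚ) n = 0 := fun a => a.2
  refine LinearMap.ext fun x => Prod.ext (Subtype.ext ?_) (Subtype.ext ?_)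
  · change (x.1 : N →ₗ[ℤ] ℚ) - (x.1 : N →ₗ[ℤ] ℚ) n • m = x.1
    rw [h, zero_smul, sub_zero]
  · change (x.2 : N →ₗ[ℤ] ℚ) - (x.2 : N →ₗ[ℤ] ℚ) n • m = x.2
    rw [h, zero_smul, sub_zero]

theorem dblIncl_comp_dblProj (n : N) (m : N →ₗ[ℤ] ℚ) (hm : m n = 1) :
    dblIncl (Nbar.mk n) ∘ₗ dblProj n m hm =
      shear (zeroSnd m) (pairSnd n) ∘ₗ shear (zeroFst m) (pairFst n) := by
  refine LinearMap.ext fun x => Prod.ext (Subtype.ext ?_) (Subtype.ext ?_)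
  · change (x.1 : N →ₗ[ℤ] ℚ) - (x.1 : N →ₗ[ℤ] ℚ) n • m = x.1 - _ • m - _ • 0
    rw [smul_zero, sub_zero]
    rfl
  · change (x.2 : N →ₗ[ℤ] ℚ) - (x.2 : N →ₗ[ℤ] ℚ) n • m = x.2 - _ • 0 - _ • m
    rw [smul_zero, sub_zero]
    congr 2
    change _ = (x.2 - _ • 0 : N →ₗ[ℤ] ℚ) n
    rw [smul_zero, sub_zero]

theorem pairFst_comp_dblIncl (n : N) : pairFst n ∘ₗ dblIncl (Nbar.mk n) = 0 :=
  LinearMap.ext fun x => x.1.2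

theorem pairSnd_comp_dblIncl (n : N) : pairSnd n ∘ₗ dblIncl (Nbar.mk n) = 0 :=
  LinearMap.ext fun x => x.2.2

/-- Both contractions annihilate the result, so the two shears, whose composite is the projection,
fix it; in other words, it lies in the image of `C_n`. -/
theorem contract_fixed (n : N) (m : N →ₗ[ℤ] ℚ) (hm : m n = 1) (x : Frob (Nbar.zero : Nbar N)) :
    map (dblIncl (Nbar.mk n) ∘ₗ dblProj n m hm) (contract n x) = contract n x := by
  have h1 : ctr (pairFst n) (contract n x) = 0 := by
    change ctr (pairFst n) (ctr (pairSnd n) (ctr (pairFst n) x)) = 0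
    rw [ctr_comm, ctr_ctr, map_zero, neg_zero]
  have h2 : ctr (pairSnd n) (contract n x) = 0 := ctr_ctr _ _
  rw [dblIncl_comp_dblProj, ← map_map', map_shear (zeroFst m), h1, mul_zero, sub_zero, map_shear, h2,
    mul_zero, sub_zero]

theorem tr_topElt (c : Nbar N) : tr c (topElt c) = 1 := by
  rw [topElt, map_smul, ← ιMulti_eq_list, ← volScale, smul_eq_mul,
    inv_mul_cancel₀ (volScale_ne_zero c)]

/-- Two products of as many linear forms as the dimension are proportional to `cotopElt`. -/
theorem exists_eq_smul_cotopElt (c : Nbar N) (l : List (Dual ℚ (Dbl c)))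
    (hl : l.length = finrank ℚ (Dbl c)) :
    ∃ s : ℚ, (l.map (ι ℚ)).prod = s • cotopElt c := by
  -- The basis is reversed because `cotopElt` lists the coordinate forms in reverse order.
  set b : Basis (Fin (finrank ℚ (Dbl c))) ℚ (Dual ℚ (Dbl c)) :=
    (dblBasis c).dualBasis.reindex Fin.revPerm with hb
  have e1 : (List.ofFn (dblBasis c).coord).reverse = List.ofFn b := by
    refine List.ext_get (by simp) fun i h1 h2 => ?_
    simp only [List.get_eq_getElem, List.getElem_reverse, List.getElem_ofFn, hb,
      Basis.reindex_apply, Basis.coe_dualBasis]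
    congr 1
    ext
    simp
    omega
  have e2 : l = List.ofFn (fun i => l.get (i.cast hl.symm)) :=
    List.ext_get (by simp [hl]) fun i h1 h2 => by simp
  refine ⟨b.det (fun i => l.get (i.cast hl.symm)) * (volScale c)⁻¹, ?_⟩
  conv_lhs => rw [e2]
  rw [← ιMulti_eq_list, ιMulti_eq_det_smul b, cotopElt, e1, ← ιMulti_eq_list, smul_smul, mul_assoc,
    inv_mul_cancel₀ (volScale_ne_zero c), mul_one]

/-- Both sides have top degree, so they are proportional. The factor is 1 because both give 1 on
`(m, 0) ∧ (0, m)` times the top element of `n^⊥ ⊕ n^⊥`; for `cotopElt 0` this is the normalization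
of the trace of `C_n`. -/
theorem cotopElt_zero_eq {n : N} (hn : n ≠ 0) : ∃ (m : N →ₗ[ℤ] ℚ) (hm : m n = 1),
    cotopElt (Nbar.zero : Nbar N) = map (dblProj n m hm).dualMap (cotopElt (Nbar.mk n)) *
      (ι ℚ (pairSnd n) * ι ℚ (pairFst n)) := by
  obtain ⟨m, hm, htr⟩ := exists_tr_eq n hn
  refine ⟨m, hm, ?_⟩
  have hc : Nbar.mk n ≠ Nbar.zero := fun h => hn (mk_eq_zero.1 h)
  obtain ⟨s, hs⟩ := exists_eq_smul_cotopElt (Nbar.zero : Nbar N)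
    (((List.ofFn (dblBasis (Nbar.mk n)).coord).reverse.map (dblProj n m hm).dualMap) ++
      [pairSnd n, pairFst n]) (by
      have h1 := finrank_dbl (Nbar.mk n)
      have h2 := finrank_dbl (Nbar.zero : Nbar N)
      have h3 := finrank_perp hc
      have h4 := finrank_perp_zero (N := N)
      simp only [List.length_append, List.length_map, List.length_reverse, List.length_ofFn,
        List.length_cons, List.length_nil]
      omega)
  have hs' : map (dblProj n m hm).dualMap (cotopElt (Nbar.mk n)) *
      (ι ℚ (pairSnd n) * ι ℚ (pairFst n)) =
      (volScale (Nbar.mk n) * s) • cotopElt (Nbar.zero : Nbar N) := by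
    rw [← smul_smul, ← hs, cotopElt, map_smul, map_list, smul_mul_assoc]
    simp
  have h1 : eps (act (cotopElt (Nbar.zero : Nbar N))
      (sqv zeroFst zeroSnd m * kappa _ (topElt (Nbar.mk n)))) = 1 := by
    rw [eps_act_cotopElt, tr_zero_apply, ← htr, tr_topElt]
  have h2 : eps (act (map (dblProj n m hm).dualMap (cotopElt (Nbar.mk n)) *
      (ι ℚ (pairSnd n) * ι ℚ (pairFst n)))
      (sqv zeroFst zeroSnd m * kappa _ (topElt (Nbar.mk n)))) = 1 := by
    have e1 : act (ι ℚ (pairSnd n) * ι ℚ (pairFst n))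
        (sqv zeroFst zeroSnd m * kappa _ (topElt (Nbar.mk n))) = kappa _ (topElt (Nbar.mk n)) := by
      have k1 : ctr (pairFst n) (kappa _ (topElt (Nbar.mk n))) = 0 :=
        ctr_map_eq_zero _ _ (pairFst_comp_dblIncl n) _
      have k2 : ctr (pairSnd n) (kappa _ (topElt (Nbar.mk n))) = 0 :=
        ctr_map_eq_zero _ _ (pairSnd_comp_dblIncl n) _
      rw [act_ι_mul, act_ι, sqv, mul_assoc, ctr_ι_mul, ctr_ι_mul, k1, pairFst_zeroFst,
        pairFst_zeroSnd, hm]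
      simp only [one_smul, zero_smul, mul_zero, sub_zero]
      rw [ctr_ι_mul, k2, pairSnd_zeroSnd, hm]
      simp
    rw [act_mul, e1, ← eps_map (dblProj n m hm), map_act, kappa, map_map', dblProj_comp_dblIncl,
      map_id', eps_act_cotopElt, tr_topElt]
  rw [hs', map_smul, LinearMap.smul_apply, map_smul, h1, smul_eq_mul, mul_one] at h2
  rw [hs', h2, one_smul]

/-- The contractions by `n` commute with the edge element, since they vanish on `n^⊥`, and therefore
act on `z` alone. The remaining integral over `n^⊥ ⊕ n^⊥` uses the edge as a delta function, which
carries the result to the outgoing end. -/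
theorem kappa_map_act_cotopElt_zero {W : Type*} [AddCommGroup W] [Module ℚ W] {n : N} (hn : n ≠ 0)
    (p : W →ₗ[ℚ] Dbl (Nbar.zero : Nbar N)) (inn : Dbl (Nbar.zero : Nbar N) →ₗ[ℚ] W)
    (out : W →ₗ[ℚ] Dbl (Nbar.mk n)) (δ : Dbl (Nbar.mk n) →ₗ[ℚ] W)
    (hpin : p ∘ₗ inn = LinearMap.id) (houtin : out ∘ₗ inn = 0)
    (hpδ : p ∘ₗ δ = dblIncl (Nbar.mk n)) (houtδ : out ∘ₗ δ = -LinearMap.id)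
    (z : Frob (Nbar.zero : Nbar N)) :
    kappa (Nbar.mk n) (map out (act (map p.dualMap (cotopElt Nbar.zero))
      (map δ (topElt (Nbar.mk n)) * map inn z))) = contract n z := by
  obtain ⟨m, hm, hcot⟩ := cotopElt_zero_eq hn
  have hctr : ∀ ξ : Dual ℚ (Dbl (Nbar.zero : Nbar N)), ξ ∘ₗ dblIncl (Nbar.mk n) = 0 →
      ∀ y, ctr (ξ ∘ₗ p) (map δ (topElt (Nbar.mk n)) * map inn y) =
        map δ (topElt (Nbar.mk n)) * map inn (ctr ξ y) := by
    intro ξ hξ y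
    rw [ctr_map_mul _ _ (by rw [LinearMap.comp_assoc, hpδ, hξ]), map_neg_topElt, ← map_ctr,
      LinearMap.comp_assoc, hpin, LinearMap.comp_id]
  have hact : act (map p.dualMap (ι ℚ (pairSnd n) * ι ℚ (pairFst n)))
      (map δ (topElt (Nbar.mk n)) * map inn z) =
      map δ (topElt (Nbar.mk n)) * map inn (contract n z) := by
    rw [map_mul (map p.dualMap), map_apply_ι, map_apply_ι, act_ι_mul, act_ι,
      LinearMap.dualMap_apply', LinearMap.dualMap_apply', hctr _ (pairFst_comp_dblIncl n),
      hctr _ (pairSnd_comp_dblIncl n)]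
    rfl
  have hπδ : (dblProj n m hm ∘ₗ p) ∘ₗ δ = LinearMap.id := by
    rw [LinearMap.comp_assoc, hpδ, dblProj_comp_dblIncl]
  have hd : (dblProj n m hm ∘ₗ p).dualMap = p.dualMap ∘ₗ (dblProj n m hm).dualMap := rfl
  rw [hcot, map_mul (map p.dualMap), act_mul, hact, map_map', ← hd, act_cotopElt_delta _ _ hπδ, map_map',
    map_map', kappa, map_map']
  refine Eq.trans ?_ (contract_fixed n m hm _)
  -- The two signs, from the substitution and from `out ∘ δ = -id`, cancel, so `out` reads off the
  -- projection `dblProj`.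
  refine congrArg (fun f => map f _) (LinearMap.ext fun v => congrArg (dblIncl (Nbar.mk n)) ?_)
  have h1 := LinearMap.congr_fun houtδ (dblProj n m hm v)
  have h2 := LinearMap.congr_fun houtin v
  have h3 := LinearMap.congr_fun hpin v
  simp only [LinearMap.comp_apply, LinearMap.id_apply, LinearMap.neg_apply,
    LinearMap.zero_apply] at h1 h2 h3
  simp only [LinearMap.comp_apply, LinearMap.sub_apply, LinearMap.id_apply, map_sub, h1, h2, h3,
    zero_sub, neg_neg]

section

variable {W : Type*} [AddCommGroup W] [Module ℚ W] (n : Nbar N)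

/-- The projection to the only summand. -/
def projOne : ((i : Unit) → Dbl (oneObj n i)) →ₗ[ℚ] Dbl n :=
  LinearMap.proj (φ := fun i => Dbl (oneObj n i)) ()

theorem evalOne_map (f : W →ₗ[ℚ] ((i : Unit) → Dbl (oneObj n i))) (z : ExteriorAlgebra ℚ W) :
    evalOne n (map f z) = map (projOne n ∘ₗ f) z := map_map' f (projOne n) z

theorem map_evalOne (f : Dbl n →ₗ[ℚ] W) (z : State (oneObj n)) :
    map f (evalOne n z) = map (f ∘ₗ projOne n) z := map_map' (projOne n) f z

theorem projOne_wsingle (u : Unit) (v : Dbl n) : projOne n (wsingle (oneObj n) u n v) = v :=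
  wsingle_apply_self (pd := oneObj n) u v

end

theorem kappa_evalOne_starDiagram {n : N} (hn : n ≠ 0) (x : State (oneObj (Nbar.zero : Nbar N))) :
    kappa (Nbar.mk n) (evalOne (Nbar.mk n) ((starDiagram (oneObj Nbar.zero) (Nbar.mk n)).eval x)) =
      contract n (evalOne Nbar.zero x) := by
  set D := starDiagram (oneObj (Nbar.zero : Nbar N)) (Nbar.mk n) with hD
  set p : D.Space →ₗ[ℚ] Dbl (Nbar.zero : Nbar N) := D.pt () with hp
  set inn : Dbl (Nbar.zero : Nbar N) →ₗ[ℚ] D.Space := wsingle D.pd (.inl ()) Nbar.zero with hinn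
  set out : D.Space →ₗ[ℚ] Dbl (Nbar.mk n) :=
    LinearMap.proj (φ := fun p => Dbl (D.pd p)) (Sum.inr ()) with hout
  set δ : Dbl (Nbar.mk n) →ₗ[ℚ] D.Space := D.diff () with hδ
  have hvol : volProd D.pt = map p.dualMap (cotopElt Nbar.zero) := centralProd_unique _ _
  have hedge : edgeProd D.diff = map δ (topElt (Nbar.mk n)) := centralProd_unique _ _
  have hin : map D.inMap x = map inn (evalOne Nbar.zero x) := by
    refine Eq.trans ?_ (map_evalOne Nbar.zero inn x).symm
    refine congrArg (fun f => map f x) (wsingle_ext (pd := oneObj Nbar.zero) fun i => ?_)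
    refine (D.inMap_wsingle i _ le_rfl).trans (LinearMap.ext fun v => ?_)
    exact congrArg inn (projOne_wsingle Nbar.zero i v).symm
  have hev : ∀ z : ExteriorAlgebra ℚ D.Space,
      evalOne (Nbar.mk n) (map D.outMap z) = map out z := by
    intro z
    refine (evalOne_map _ _ z).trans ?_
    refine congrArg (fun f => map f z) (wsingle_ext (pd := D.pd) fun p => ?_)
    have h1 := wmap_wsingle (pd' := oneObj (Nbar.mk n)) D.tgt p _ le_rfl (D.tgt_le p)
    refine (congrArg (fun f => projOne (Nbar.mk n) ∘ₗ f) h1).trans ?_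
    rcases p with p | p
    · exact (LinearMap.comp_zero _).trans
        (proj_wsingle_of_ne (pd := D.pd) (p := Sum.inl p) (q := Sum.inr ()) (by simp) _).symm
    · refine LinearMap.ext fun v => (projOne_wsingle (Nbar.mk n) p v).trans ?_
      exact (wsingle_apply_self (pd := D.pd) (Sum.inr p) v).symm
  have hpin : p ∘ₗ inn = LinearMap.id := (proj_wsingle _ _).trans (incl_self _)
  have houtin : out ∘ₗ inn = 0 :=
    proj_wsingle_of_ne (pd := D.pd) (p := Sum.inl ()) (q := Sum.inr ()) (by simp) _
  have hpδ : p ∘ₗ δ = dblIncl (Nbar.mk n) := by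
    have h1 : p ∘ₗ wsingle D.pd (.inl ()) (Nbar.mk n) = dblIncl (Nbar.mk n) :=
      (proj_wsingle _ _).trans (incl_zero _)
    have h2 : p ∘ₗ wsingle D.pd (.inr ()) (Nbar.mk n) = 0 :=
      proj_wsingle_of_ne (pd := D.pd) (p := Sum.inr ()) (q := Sum.inl ()) (by simp) _
    refine LinearMap.ext fun v => ?_
    have h3 := LinearMap.congr_fun h1 v
    have h4 := LinearMap.congr_fun h2 v
    refine (map_sub p _ _).trans ?_
    exact (congrArg₂ (· - ·) h3 h4).trans (sub_zero _)
  have houtδ : out ∘ₗ δ = -LinearMap.id := by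
    have h1 : out ∘ₗ wsingle D.pd (.inr ()) (Nbar.mk n) = LinearMap.id :=
      (proj_wsingle _ _).trans (incl_self _)
    have h2 : out ∘ₗ wsingle D.pd (.inl ()) (Nbar.mk n) = 0 :=
      proj_wsingle_of_ne (pd := D.pd) (p := Sum.inl ()) (q := Sum.inr ()) (by simp) _
    refine LinearMap.ext fun v => ?_
    have h3 := LinearMap.congr_fun h1 v
    have h4 := LinearMap.congr_fun h2 v
    refine (map_sub out _ _).trans ?_
    exact (congrArg₂ (· - ·) h4 h3).trans (zero_sub _)
  have e1 : D.eval x = map D.outMap (act (map p.dualMap (cotopElt Nbar.zero))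
      (map δ (topElt (Nbar.mk n)) * map inn (evalOne Nbar.zero x))) := by
    rw [← hvol, ← hedge, ← hin]
    rfl
  rw [e1]
  exact (congrArg (kappa (Nbar.mk n)) (hev _)).trans
    (kappa_map_act_cotopElt_zero hn p inn out δ hpin houtin hpδ houtδ _)

theorem sum_dblIncl_wsingle {I : Type} [Fintype I] (c : I → Nbar N) (i : I) :
    (∑ i, dblIncl (c i) ∘ₗ LinearMap.proj (φ := fun i => Dbl (c i)) i) ∘ₗ wsingle c i (c i) =
      dblIncl (c i) := by
  rw [lin_sum_comp, Finset.sum_eq_single i]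
  · rw [LinearMap.comp_assoc, proj_wsingle, incl_self, LinearMap.comp_id]
  · intro j _ hj
    rw [LinearMap.comp_assoc, proj_wsingle_of_ne hj.symm, LinearMap.comp_zero]
  · simp

theorem pt_inMap_traceDiagram {I : Type} [Finite I] (c : I → Nbar N) (n : Nbar N)
    (h : ∀ i, perp (c i) ≤ perp n) (i : I) :
    ((traceDiagram c n h).pt () ∘ₗ (traceDiagram c n h).inMap) ∘ₗ wsingle c i (c i) =
      incl (c i) n := by
  rw [LinearMap.comp_assoc, Diagram.inMap_wsingle _ _ _ le_rfl]
  exact proj_wsingle _ _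

-- Each elementary cobordism has genus `0` and reduces by elimination to a diagram with at most two
-- points, where the required formula can be read off.
variable (N) in
theorem multTrQFT_isMult : (multTrQFT N).IsMult where
  map_vertex {I} _ c x := by
    change evalOne _ (multMap _ x) = _
    rw [multMap_of_genus (fun v => rfl), eval_diagram_corolla_one, eval_starDiagram_zero,
      Diagram.eval_of_isEmpty]
    refine (evalOne_map _ _ x).trans ?_
    refine congrArg (fun f => map f x) (wsingle_ext (pd := c) fun i => ?_)
    refine Eq.trans (LinearMap.ext fun v => ?_) (sum_dblIncl_wsingle c i).symm
    have h1 := LinearMap.congr_fun ((mulDiagram c).inMap_wsingle i (c i) le_rfl) v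
    have h2 : (mulDiagram c).outMap ∘ₗ wsingle (mulDiagram c).pd () (c i) =
        wsingle (oneObj Nbar.zero) () (c i) :=
      wmap_wsingle_some (f := some) rfl (perp_le_perp_zero _) le_rfl
    refine (congrArg (fun w => projOne Nbar.zero ((mulDiagram c).outMap w)) h1).trans ?_
    refine (congrArg (projOne Nbar.zero) (LinearMap.congr_fun h2 v)).trans ?_
    have h3 := LinearMap.congr_fun (proj_wsingle (pd := oneObj (Nbar.zero : Nbar N)) () (c i)) v
    exact h3.trans (LinearMap.congr_fun (incl_zero (c i)) v)
  map_counit x := by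
    change multMap _ x = _
    rw [multMap_of_genus (fun v => rfl), eval_diagram_corolla_counit]
    refine (Diagram.eval_of_unique (traceDiagram (oneObj Nbar.zero) Nbar.zero fun _ => le_rfl)
      (fun _ => rfl) x).trans ?_
    refine congrArg (fun f => algebraMap ℚ _ (tr Nbar.zero (map f x)))
      (wsingle_ext (pd := oneObj Nbar.zero) (g := projOne Nbar.zero) fun i => ?_)
    refine (pt_inMap_traceDiagram (oneObj Nbar.zero) Nbar.zero (fun _ => le_rfl) i).trans ?_
    exact (proj_wsingle (pd := oneObj Nbar.zero) _ _).symm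
  map_cap n x := by
    change multMap _ x = _
    rw [multMap_of_genus (Γ := Cob.cap n) (fun v => Empty.elim v), eval_diagram_cap]
    refine (Diagram.eval_of_unique (traceDiagram (fun _ : Bool => n) n fun _ => le_rfl)
      (fun _ => rfl) x).trans ?_
    refine congrArg (fun f => algebraMap ℚ _ (tr n (map f x)))
      (wsingle_ext (pd := fun _ : Bool => n) fun b => ?_)
    refine (pt_inMap_traceDiagram (fun _ : Bool => n) n (fun _ => le_rfl) b).trans ?_
    rw [LinearMap.add_comp, incl_self]
    have h1 : ∀ b : Bool, LinearMap.proj b ∘ₗ wsingle (fun _ : Bool => n) b n = LinearMap.id :=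
      fun b => (proj_wsingle _ _).trans (incl_self _)
    cases b
    · rw [h1, proj_wsingle_of_ne (by simp), add_zero]
    · rw [h1, proj_wsingle_of_ne (by simp), zero_add]
  map_kappa_dual n hn x := by
    change kappa _ (evalOne _ (multMap _ x)) = _
    rw [multMap_of_genus (fun v => rfl), eval_diagram_corolla_one, kappa_evalOne_starDiagram hn]

end MultiplicityData

/-! ### Nondegeneracy of the integration pairing -/

section Nondegeneracy

open ExteriorAlgebra Module

section

variable {W W' : Type*} [AddCommGroup W] [Module ℚ W] [AddCommGroup W'] [Module ℚ W']

theorem ι_mul_map_of_disjoint (b : W') (y : ExteriorAlgebra ℚ W) :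
    ι ℚ (LinearMap.inr ℚ W W' b) * map (LinearMap.inl ℚ W W') y =
      map (LinearMap.inl ℚ W W') (map (-LinearMap.id) y) * ι ℚ (LinearMap.inr ℚ W W' b) := by
  induction y using ext_induction with
  | one => rw [map_one, map_one, map_one, mul_one, one_mul]
  | smul r y h => rw [map_smul, map_smul, map_smul, mul_smul_comm, h, smul_mul_assoc]
  | add y y' h h' => simp only [map_add, mul_add, add_mul, h, h']
  | mul a y h =>
    have hs : ι ℚ (LinearMap.inr ℚ W W' b) * ι ℚ (LinearMap.inl ℚ W W' a) =
      -(ι ℚ (LinearMap.inl ℚ W W' a) * ι ℚ (LinearMap.inr ℚ W W' b)) :=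
      eq_neg_of_add_eq_zero_left (ι_add_mul_swap _ _)
    rw [map_mul, map_apply_ι, ← mul_assoc, hs, neg_mul, mul_assoc, h, map_mul, map_mul,
      map_apply_ι, map_apply_ι, LinearMap.neg_apply, LinearMap.id_apply, map_neg, map_neg, neg_mul,
      neg_mul, mul_assoc]

/-- The exterior algebra of a direct sum is spanned by products from the two summands. -/
theorem prod_induction {P : ExteriorAlgebra ℚ (W × W') → Prop}
    (add : ∀ x y, P x → P y → P (x + y))
    (mul : ∀ y q, P (map (LinearMap.inl ℚ W W') y * map (LinearMap.inr ℚ W W') q))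
    (e : ExteriorAlgebra ℚ (W × W')) : P e := by
  have h0 : P 0 := by simpa using mul 0 0
  suffices H : e ∈ AddSubmonoid.closure {z | ∃ y q, z =
      map (LinearMap.inl ℚ W W') y * map (LinearMap.inr ℚ W W') q} by
    induction H using AddSubmonoid.closure_induction with
    | mem z hz => obtain ⟨y, q, rfl⟩ := hz; exact mul y q
    | zero => exact h0
    | add x y _ _ hx hy => exact add x y hx hy
  have hm : ∀ y q, map (LinearMap.inl ℚ W W') y * map (LinearMap.inr ℚ W W') q ∈
      AddSubmonoid.closure {z | ∃ y q, z =
      map (LinearMap.inl ℚ W W') y * map (LinearMap.inr ℚ W W') q} := fun y q =>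
    AddSubmonoid.subset_closure ⟨y, q, rfl⟩
  induction e using ext_induction with
  | one => simpa using hm 1 1
  | smul r x h =>
    induction h using AddSubmonoid.closure_induction with
    | mem z hz =>
      obtain ⟨y, q, rfl⟩ := hz
      simpa using hm (r • y) q
    | zero => rw [smul_zero]; exact AddSubmonoid.zero_mem _
    | add x y _ _ hx hy => rw [smul_add]; exact AddSubmonoid.add_mem _ hx hy
  | add x y hx hy => exact AddSubmonoid.add_mem _ hx hy
  | mul a x h =>
    induction h using AddSubmonoid.closure_induction with
    | mem z hz =>
      obtain ⟨y, q, rfl⟩ := hz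
      have ha : ι ℚ a = map (LinearMap.inl ℚ W W') (ι ℚ a.1) + ι ℚ (LinearMap.inr ℚ W W' a.2) := by
        rw [map_apply_ι, ← map_add]
        simp
      rw [ha, add_mul]
      refine AddSubmonoid.add_mem _ ?_ ?_
      · rw [← mul_assoc, ← map_mul]
        exact hm _ _
      · rw [← mul_assoc, ι_mul_map_of_disjoint, mul_assoc, ← map_apply_ι, ← map_mul]
        exact hm _ _
    | zero => rw [mul_zero]; exact AddSubmonoid.zero_mem _
    | add x y _ _ hx hy => rw [mul_add]; exact AddSubmonoid.add_mem _ hx hy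

end

variable {N : Type u} [AddCommGroup N]

/-- The maps out of a tensor product are determined on elementary tensors. -/
theorem state_sum_ext {I I' : Type} {c : I → Nbar N} {c' : I' → Nbar N} {V : Type*}
    [AddCommGroup V] [Module ℚ V] {f g : State (Sum.elim c c') →ₗ[ℚ] V}
    (h : ∀ x y, f (leftPart c c' x * rightPart c c' y) = g (leftPart c c' x * rightPart c c' y)) :
    f = g := by
  set φ := LinearEquiv.sumPiEquivProdPi ℚ I I' fun x => Dbl (Sum.elim c c' x) with hφ
  have key : ∀ e, f (map φ.symm.toLinearMap e) = g (map φ.symm.toLinearMap e) := by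
    intro e
    induction e using prod_induction with
    | add x y hx hy => simp only [map_add, hx, hy]
    | mul y q =>
      rw [map_mul, map_map', map_map']
      exact h y q
  refine LinearMap.ext fun x => ?_
  have hx : map φ.symm.toLinearMap (map φ.toLinearMap x) = x := by
    rw [map_map', LinearEquiv.symm_comp, map_id']
  rw [← hx, key]

variable [Module.Free ℤ N] [Module.Finite ℤ N]

/-- The pairing given by integration over all points is nondegenerate. -/
theorem eq_zero_of_integral_mul {J : Type} [Finite J] {d : J → Nbar N} {W : Type u}
    [AddCommGroup W] [Module ℚ W] (prj : ∀ j, W →ₗ[ℚ] Dbl (d j)) (sgl : ∀ j, Dbl (d j) →ₗ[ℚ] W)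
    (hsame : ∀ j, prj j ∘ₗ sgl j = LinearMap.id) (hne : ∀ i j, i ≠ j → prj i ∘ₗ sgl j = 0)
    (hext : ∀ w, (∀ j, prj j w = 0) → w = 0) (x : ExteriorAlgebra ℚ W)
    (h : ∀ y, eps (act (volProd prj) (x * y)) = 0) : x = 0 := by
  -- The space is doubled, and a delta function between the two copies is integrated over the first
  -- one; it reproduces `x` in the second copy.
  let δ : ∀ j, Dbl (d j) →ₗ[ℚ] W × W := fun j => (LinearMap.inl ℚ W W - LinearMap.inr ℚ W W) ∘ₗ sgl j
  let π : ∀ j, W × W →ₗ[ℚ] Dbl (d j) := fun j => prj j ∘ₗ LinearMap.fst ℚ W W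
  have hfst : LinearMap.fst ℚ W W ∘ₗ (LinearMap.inl ℚ W W - LinearMap.inr ℚ W W) =
      LinearMap.id := by
    rw [LinearMap.comp_sub, LinearMap.fst_comp_inl, LinearMap.fst_comp_inr, sub_zero]
  have hδπ : ∀ i j, π i ∘ₗ δ j = prj i ∘ₗ sgl j := by
    intro i j
    change (prj i ∘ₗ LinearMap.fst ℚ W W) ∘ₗ
      ((LinearMap.inl ℚ W W - LinearMap.inr ℚ W W) ∘ₗ sgl j) = _
    rw [LinearMap.comp_assoc, ← LinearMap.comp_assoc (sgl j), hfst, LinearMap.id_comp]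
  have hk : kernelOp δ π (map (LinearMap.inl ℚ W W) x) = map (LinearMap.inr ℚ W W) x := by
    rw [kernelOp_delta δ π δ (fun _ => rfl) (fun j => (hδπ j j).trans (hsame j))
      (fun i j hij => (hδπ i j).trans (hne i j hij))
      (LinearMap.inr ℚ W W ∘ₗ (LinearMap.fst ℚ W W + LinearMap.snd ℚ W W))]
    · rw [map_map', LinearMap.comp_assoc, LinearMap.add_comp, LinearMap.fst_comp_inl,
        LinearMap.snd_comp_inl, add_zero, LinearMap.comp_id]
    · intro j
      change (LinearMap.inr ℚ W W ∘ₗ (LinearMap.fst ℚ W W + LinearMap.snd ℚ W W)) ∘ₗ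
        ((LinearMap.inl ℚ W W - LinearMap.inr ℚ W W) ∘ₗ sgl j) = 0
      have h0 : (LinearMap.fst ℚ W W + LinearMap.snd ℚ W W) ∘ₗ
          (LinearMap.inl ℚ W W - LinearMap.inr ℚ W W) = 0 := by
        rw [LinearMap.comp_sub, LinearMap.add_comp, LinearMap.add_comp, LinearMap.fst_comp_inl,
          LinearMap.snd_comp_inl, LinearMap.fst_comp_inr, LinearMap.snd_comp_inr, add_zero,
          zero_add, sub_self]
      rw [LinearMap.comp_assoc, ← LinearMap.comp_assoc (sgl j), h0, LinearMap.zero_comp,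
        LinearMap.comp_zero]
    · intro w hw
      have h1 : w.1 = 0 := hext _ fun j => hw j
      refine Prod.ext h1.symm ?_
      change w.1 + w.2 = w.2
      rw [h1, zero_add]
  have hvol : volProd π = map (LinearMap.fst ℚ W W).dualMap (volProd prj) :=
    (map_volProd _ _).symm
  -- In the expansion of the delta function into products of elements of the two copies, each term
  -- contains an integral of `x * y` over the first copy, which vanishes by assumption.
  have key : ∀ e, map (LinearMap.snd ℚ W W) (act (volProd π)
      (map (LinearMap.inl ℚ W W) x * e)) = 0 := by
    intro e
    induction e using prod_induction with
    | add a b ha hb => rw [mul_add, map_add, map_add, ha, hb, add_zero]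
    | mul y q =>
      have hzero : ∀ j, π j ∘ₗ LinearMap.inr ℚ W W = 0 := by
        intro j
        change (prj j ∘ₗ LinearMap.fst ℚ W W) ∘ₗ LinearMap.inr ℚ W W = 0
        rw [LinearMap.comp_assoc, LinearMap.fst_comp_inr, LinearMap.comp_zero]
      have e1 : act (volProd π) (map (LinearMap.inl ℚ W W) (x * y)) =
          map (LinearMap.inl ℚ W W) (act (volProd prj) (x * y)) := by
        rw [← map_act, map_volProd]
        congr 3
      rw [← mul_assoc, ← map_mul, act_volProd_mul_map _ _ hzero, map_mul, e1, map_map',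
        LinearMap.snd_comp_inl, map_zero_apply, h, map_zero, zero_mul]
  have hx := congrArg (map (LinearMap.snd ℚ W W)) hk
  rw [kernelOp_apply, ← (edgeProd_central _).comm, key, map_map', LinearMap.snd_comp_inr,
    map_id'] at hx
  exact hx.symm

end Nondegeneracy

/-! ### Insertion of joints -/

section Subdivision

variable {N : Type u} [AddCommGroup N]

namespace Cob

variable {I J K : Type} {c : I → Nbar N} {d : J → Nbar N} {k : K → Nbar N}

theorem IsIso.equivalent {Γ Γ' : Cob c d} (h : IsIso Γ Γ') : Equivalent Γ Γ' :=
  .rel _ _ (.inl h)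

theorem IsContraction.equivalent {Γ Γ' : Cob c d} (h : IsContraction Γ Γ') : Equivalent Γ Γ' :=
  .rel _ _ (.inr (.inl h))

theorem IsSmoothing.equivalent {Γ Γ' : Cob c d} (h : IsSmoothing Γ Γ') : Equivalent Γ Γ' :=
  .rel _ _ (.inr (.inr h))

/-- The position of an edge end after the insertion of joints `X`. -/
def embEnd (F T X P : Type) : F ⊕ (T × Bool) ⊕ P → F ⊕ ((T ⊕ X) × Bool) ⊕ P :=
  Sum.map id (Sum.map (Prod.map .inl id) id)

/-- The bookkeeping bijection for the insertion of a joint next to each of the edge ends `r x`. -/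
def insertEquiv {F T X P : Type} (r : X → F ⊕ (T × Bool) ⊕ P) (q : F ⊕ (T × Bool) ⊕ P → Option X)
    (h : ∀ x y, q y = some x ↔ r x = y) :
    (F ⊕ (T × Bool) ⊕ P) ⊕ (X × Bool) ≃ F ⊕ ((T ⊕ X) × Bool) ⊕ P where
  toFun
    | .inl y => (q y).elim (embEnd F T X P y) fun x => .inr (.inl (.inr x, false))
    | .inr (x, false) => .inr (.inl (.inr x, true))
    | .inr (x, true) => embEnd F T X P (r x)
  invFun
    | .inl f => (q (.inl f)).elim (.inl (.inl f)) fun x => .inr (x, true)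
    | .inr (.inl (.inl j, b)) =>
      (q (.inr (.inl (j, b)))).elim (.inl (.inr (.inl (j, b)))) fun x => .inr (x, true)
    | .inr (.inl (.inr x, false)) => .inl (r x)
    | .inr (.inl (.inr x, true)) => .inr (x, false)
    | .inr (.inr m) => (q (.inr (.inr m))).elim (.inl (.inr (.inr m))) fun x => .inr (x, true)
  left_inv := by
    rintro (y | ⟨x, _ | _⟩)
    · rcases hy : q y with _ | x
      · rcases y with f | ⟨j, b⟩ | m <;> simp [hy, embEnd]
      · simp [hy, (h x y).1 hy]
    · rfl
    · have hy := (h x (r x)).2 rfl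
      change (match embEnd F T X P (r x) with
        | .inl f => _
        | .inr (.inl (.inl j, b)) => _
        | .inr (.inl (.inr x, false)) => .inl (r x)
        | .inr (.inl (.inr x, true)) => .inr (x, false)
        | .inr (.inr m) => _ : (F ⊕ (T × Bool) ⊕ P) ⊕ (X × Bool)) = _
      rcases hz : r x with f | ⟨j, b⟩ | m <;> rw [hz] at hy <;> simp [hy, embEnd]
  right_inv := by
    rintro (f | ⟨j | x, b⟩ | m)
    · rcases hy : q (.inl f) with _ | x
      · simp [hy, embEnd]
      · simp [hy, embEnd, (h x _).1 hy]
    · rcases hy : q (.inr (.inl (j, b))) with _ | x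
      · simp [hy, embEnd]
      · simp [hy, embEnd, (h x _).1 hy]
    · cases b
      · have hy := (h x (r x)).2 rfl
        simp [hy]
      · rfl
    · rcases hy : q (.inr (.inr m)) with _ | x
      · simp [hy, embEnd]
      · simp [hy, embEnd, (h x _).1 hy]

/-- Insertion of a joint next to each of the edge ends `r x`. -/
def insertJoints (Γ : Cob c d) {X : Type} [Finite X] (r : X → Γ.Flag ⊕ (Γ.Joint × Bool) ⊕ (I ⊕ J))
    (q : Γ.Flag ⊕ (Γ.Joint × Bool) ⊕ (I ⊕ J) → Option X) (h : ∀ x y, q y = some x ↔ r x = y) :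
    Cob c d where
  Vert := Γ.Vert
  Flag := Γ.Flag
  Joint := Γ.Joint ⊕ X
  Edge := Γ.Edge ⊕ X
  finite_vert := Γ.finite_vert
  finite_flag := Γ.finite_flag
  finite_joint := have := Γ.finite_joint; inferInstance
  finite_edge := have := Γ.finite_edge; inferInstance
  root := Γ.root
  genus := Γ.genus
  dir := Sum.elim Γ.dir fun x => Γ.dir (Γ.ends.symm (r x)).1
  ends := (Equiv.sumProdDistrib Γ.Edge X Bool).trans
    ((Equiv.sumCongr Γ.ends (Equiv.refl _)).trans (insertEquiv r q h))
  dir_in i := by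
    rcases hy : q (.inr (.inr (.inl i))) with _ | x
    · simpa [insertEquiv, hy] using Γ.dir_in i
    · simpa [insertEquiv, hy, (h x _).1 hy] using Γ.dir_in i
  dir_out j := by
    rcases hy : q (.inr (.inr (.inr j))) with _ | x
    · simpa [insertEquiv, hy] using Γ.dir_out j
    · simpa [insertEquiv, hy, (h x _).1 hy] using Γ.dir_out j
  dir_joint := by
    have key : ∀ (j : Γ.Joint) (b : Bool), Sum.elim Γ.dir (fun x => Γ.dir (Γ.ends.symm (r x)).1)
        (((Equiv.sumProdDistrib Γ.Edge X Bool).trans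
          ((Equiv.sumCongr Γ.ends (Equiv.refl _)).trans (insertEquiv r q h))).symm
          (.inr (.inl (.inl j, b)))).1 = Γ.dir (Γ.ends.symm (.inr (.inl (j, b)))).1 := by
      intro j b
      rcases hy : q (.inr (.inl (j, b))) with _ | x
      · simp [insertEquiv, hy]
      · simp [insertEquiv, hy, (h x _).1 hy]
    rintro (j | x)
    · rw [key, key]
      exact Γ.dir_joint j
    · simp [insertEquiv]

/-- Reversing all edges. -/
def flip (Γ : Cob c d) : Cob c d :=
  { Γ with
    ends := ((Equiv.refl Γ.Edge).prodCongr Equiv.boolNot).trans Γ.ends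
    dir_in := Γ.dir_in
    dir_out := Γ.dir_out
    dir_joint := Γ.dir_joint }

theorem isIso_flip (Γ : Cob c d) : IsIso Γ Γ.flip := by
  refine ⟨.refl _, .refl _, .refl _, .refl _, .refl _, (Equiv.refl Γ.Edge).prodCongr Equiv.boolNot,
    fun _ => rfl, fun _ => rfl, fun _ => rfl, fun _ => rfl, fun _ => rfl, ?_⟩
  rintro ⟨e, b⟩
  change Γ.ends (e, !!b) = Sum.map id (Sum.map id id) (Γ.ends (e, b))
  rw [Bool.not_not]
  rcases Γ.ends (e, b) with f | j | m <;> rfl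

variable (Γ : Cob c d) {X : Type} [Finite X] (r : X → Γ.Flag ⊕ (Γ.Joint × Bool) ⊕ (I ⊕ J))
  (q : Γ.Flag ⊕ (Γ.Joint × Bool) ⊕ (I ⊕ J) → Option X) (h : ∀ x y, q y = some x ↔ r x = y)

/-- A smoothing requires the joint to lie at the second end of the edge that is kept; reversing all
edges allows joints at first ends to be treated in the same way. -/
theorem isIso_insertJoints_flip :
    IsIso (Γ.insertJoints r q h) (Γ.flip.insertJoints r q h) := by
  refine ⟨.refl _, .refl _, .refl _, .refl _, .refl _,
    { toFun := fun | (.inl e, b) => (.inl e, !b) | (.inr x, b) => (.inr x, b)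
      invFun := fun | (.inl e, b) => (.inl e, !b) | (.inr x, b) => (.inr x, b)
      left_inv := by rintro ⟨e | x, b⟩ <;> simp
      right_inv := by rintro ⟨e | x, b⟩ <;> simp },
    fun _ => rfl, ?_, fun _ => rfl, fun _ => rfl, ?_, ?_⟩
  · rintro ⟨e | x, b⟩ <;> rfl
  · rintro (e | x) <;> rfl
  · have hid : ∀ y : Γ.Flag ⊕ ((Γ.Joint ⊕ X) × Bool) ⊕ (I ⊕ J),
        Sum.map id (Sum.map id id) y = y := by rintro (y | y | y) <;> rfl
    rintro ⟨e | x, b⟩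
    · change insertEquiv r q h (.inl (Γ.ends (e, !!b))) =
        Sum.map id (Sum.map id id) (insertEquiv r q h (.inl (Γ.ends (e, b))))
      rw [Bool.not_not, hid]
    · exact (hid _).symm

theorem isIso_insertJoints_congr {Y : Type} [Finite Y] (f : Y ≃ X) :
    IsIso (Γ.insertJoints (fun y => r (f y)) (fun y => (q y).map f.symm) (by
      intro y z; rw [← h]; cases q z <;> simp [Equiv.symm_apply_eq]))
      (Γ.insertJoints r q h) := by
  have hh : ∀ x y, (q y).map f.symm = some x ↔ r (f x) = y := by
    intro y z; rw [← h]; cases q z <;> simp [Equiv.symm_apply_eq]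
  refine ⟨.refl _, .refl _, (Equiv.refl _).sumCongr f, (Equiv.refl _).sumCongr f,
    ((Equiv.refl _).sumCongr f).prodCongr (.refl _), ((Equiv.refl _).sumCongr f).prodCongr (.refl _),
    fun _ => rfl, fun _ => rfl, fun _ => rfl, fun _ => rfl, ?_, ?_⟩
  · rintro (e | x) <;> rfl
  · rintro ⟨e | x, b⟩
    · change insertEquiv r q h (.inl (Γ.ends (e, b))) =
        Sum.map id _ (insertEquiv (fun y => r (f y)) (fun y => (q y).map f.symm) hh
          (.inl (Γ.ends (e, b))))
      generalize Γ.ends (e, b) = y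
      rcases hy : q y with _ | x
      · rcases y with y | ⟨j, b⟩ | y <;> simp [insertEquiv, hy, embEnd] <;> rfl
      · simp only [insertEquiv, Equiv.coe_fn_mk, hy, Option.map_some, Option.elim_some]
        exact congrArg (fun x => Sum.inr (Sum.inl (Sum.inr x, false))) (f.apply_symm_apply x).symm
    · cases b
      · rfl
      · change embEnd _ _ _ _ (r (f x)) = Sum.map id _ (embEnd _ _ _ _ (r (f x)))
        generalize r (f x) = y
        rcases y with y | ⟨j, b⟩ | y <;> rfl

/-- The joint `none` separates `e` from the short edge attached to it, so erasing it merges these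
two and leaves the other inserted joints in place. -/
theorem isSmoothing_insertJoints_option (r : Option X → Γ.Flag ⊕ (Γ.Joint × Bool) ⊕ (I ⊕ J))
    (q : Γ.Flag ⊕ (Γ.Joint × Bool) ⊕ (I ⊕ J) → Option (Option X))
    (h : ∀ x y, q y = some x ↔ r x = y) (e : Γ.Edge) (he : Γ.ends (e, true) = r none) :
    IsSmoothing (Γ.insertJoints r q h) (Γ.insertJoints (fun x => r (some x)) (fun y => (q y).join)
      (by intro x y; rw [← h]; rcases q y with _ | _ | _ <;> simp)) := by
  have hh : ∀ (x : X) y, (q y).join = some x ↔ r (some x) = y := by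
    intro x y; rw [← h]; rcases q y with _ | _ | _ <;> simp
  have hq : q (Γ.ends (e, true)) = some none := by rw [h, he]
  have hne : ∀ e' b, (e' ≠ e ∨ b = false) → q (Γ.ends (e', b)) ≠ some none := by
    intro e' b hb hq'
    rw [h, ← he] at hq'
    have := Γ.ends.injective hq'
    simp only [Prod.mk.injEq] at this
    rcases hb with hb | hb
    · exact hb this.1.symm
    · simp [hb] at this
  refine ⟨.inr none, .inl e, .inr none, .refl _, .refl _,
    { toFun := fun | .inl j => ⟨.inl j, Sum.inl_ne_inr⟩ | .inr x => ⟨.inr (some x), fun h => Option.some_ne_none _ (Sum.inr_injective h)⟩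
      invFun := fun
        | ⟨.inl j, _⟩ => .inl j
        | ⟨.inr (some x), _⟩ => .inr x
        | ⟨.inr none, h⟩ => (h rfl).elim
      left_inv := by rintro (j | x) <;> rfl
      right_inv := by rintro ⟨j | _ | x, h⟩ <;> first | rfl | exact (h rfl).elim },
    { toFun := fun | .inl j => ⟨.inl j, Sum.inl_ne_inr⟩ | .inr x => ⟨.inr (some x), fun h => Option.some_ne_none _ (Sum.inr_injective h)⟩
      invFun := fun
        | ⟨.inl j, _⟩ => .inl j
        | ⟨.inr (some x), _⟩ => .inr x
        | ⟨.inr none, h⟩ => (h rfl).elim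
      left_inv := by rintro (j | x) <;> rfl
      right_inv := by rintro ⟨j | _ | x, h⟩ <;> first | rfl | exact (h rfl).elim },
    Sum.inl_ne_inr, ?_, rfl, fun _ => rfl, fun _ => rfl, ?_, ?_, ?_⟩
  · change insertEquiv r q h (.inl (Γ.ends (e, true))) = .inr (.inl (.inr none, false))
    simp [insertEquiv, hq]
  · rintro (e | x) <;> rfl
  · rintro (e' | x) b hb
    · have hb' : e' ≠ e ∨ b = false := hb.imp (fun h h' => h (congrArg Sum.inl h')) id
      change insertEquiv r q h (.inl (Γ.ends (e', b))) =
        Sum.map id _ (insertEquiv (fun x => r (some x)) (fun y => (q y).join) hh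
          (.inl (Γ.ends (e', b))))
      have := hne e' b hb'
      generalize Γ.ends (e', b) = y at this
      rcases hy : q y with _ | _ | x
      · rcases y with y | ⟨j, b⟩ | y <;> simp [insertEquiv, hy, embEnd] <;> rfl
      · exact (this hy).elim
      · simp only [insertEquiv, Equiv.coe_fn_mk, hy, Option.join_some, Option.elim_some]
        rfl
    · cases b
      · rfl
      · change embEnd _ _ _ _ (r (some x)) = Sum.map id _ (embEnd _ _ _ _ (r (some x)))
        generalize r (some x) = y
        rcases y with y | ⟨j, b⟩ | y <;> rfl
  · rintro (e' | x) hx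
    · have hx' : e' = e := Sum.inl_injective hx
      subst hx'
      change embEnd _ _ _ _ (r none) =
        Sum.map id _ (insertEquiv (fun x => r (some x)) (fun y => (q y).join) hh
          (.inl (Γ.ends (e', true))))
      rw [← he]
      generalize Γ.ends (e', true) = y at hq
      rcases y with y | ⟨j, b⟩ | y <;> simp [insertEquiv, hq, embEnd] <;> rfl
    · cases hx

/-- The insertion of joints does not change the morphism. -/
theorem insertJoints_equivalent : Equivalent (Γ.insertJoints r q h) Γ := by
  suffices H : ∀ (X : Type), Finite X → ∀ (_ : Finite X) (Γ : Cob c d)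
      (r : X → Γ.Flag ⊕ (Γ.Joint × Bool) ⊕ (I ⊕ J))
      (q : Γ.Flag ⊕ (Γ.Joint × Bool) ⊕ (I ⊕ J) → Option X) (h : ∀ x y, q y = some x ↔ r x = y),
      Equivalent (Γ.insertJoints r q h) Γ from H X ‹_› ‹_› Γ r q h
  intro X hX
  refine Finite.induction_empty_option (P := fun X => ∀ (_ : Finite X) (Γ : Cob c d)
      (r : X → Γ.Flag ⊕ (Γ.Joint × Bool) ⊕ (I ⊕ J))
      (q : Γ.Flag ⊕ (Γ.Joint × Bool) ⊕ (I ⊕ J) → Option X) (h : ∀ x y, q y = some x ↔ r x = y),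
      Equivalent (Γ.insertJoints r q h) Γ) ?_ ?_ ?_ X
  · intro Y Z e ih hZ Γ r q h
    have := Finite.of_equiv _ e.symm
    exact ((isIso_insertJoints_congr Γ r q h e).equivalent.symm _ _).trans _ _ _ (ih this Γ _ _ _)
  · intro _ Γ r q h
    refine Relation.EqvGen.symm _ _ (IsIso.equivalent ?_)
    refine ⟨.refl _, .refl _, (Equiv.sumEmpty _ _).symm, (Equiv.sumEmpty _ _).symm,
      (Equiv.sumEmpty _ _).symm.prodCongr (.refl _), (Equiv.sumEmpty _ _).symm.prodCongr (.refl _),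
      fun _ => rfl, fun _ => rfl, fun _ => rfl, fun _ => rfl, fun _ => rfl, ?_⟩
    rintro ⟨e, b⟩
    change insertEquiv r q h (.inl (Γ.ends (e, b))) = Sum.map id (Sum.map _ id) (Γ.ends (e, b))
    rcases Γ.ends (e, b) with y | ⟨j, b⟩ | y
    all_goals
      simp only [insertEquiv, Equiv.coe_fn_mk]
      generalize q _ = z
      rcases z with _ | x
      · rfl
      · exact x.elim
  -- The joint `none` is erased first. If it sits at the first end of its edge, all edges are
  -- reversed before and restored afterwards.
  · intro X _ ih _ Γ r q h
    have hs := Γ.ends.surjective (r none)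
    rcases hs with ⟨⟨e, _ | _⟩, he⟩
    · refine (isIso_insertJoints_flip Γ r q h).equivalent.trans _ _ _ ?_
      refine (isSmoothing_insertJoints_option Γ.flip r q h e he).equivalent.trans _ _ _ ?_
      exact (ih inferInstance Γ.flip _ _ _).trans _ _ _ (.symm _ _ (isIso_flip Γ).equivalent)
    · exact (isSmoothing_insertJoints_option Γ r q h e he).equivalent.trans _ _ _
        (ih inferInstance Γ _ _ _)

end Cob

end Subdivision

/-! ### Relabelling of marks, folding and the zigzag relation -/

section Folding

variable {N : Type u} [AddCommGroup N]

namespace Cob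

variable {I J I' J' : Type} {c : I → Nbar N} {d : J → Nbar N} {c' : I' → Nbar N} {d' : J' → Nbar N}

/-- Relabelling of the incoming marks. -/
def relabelIn (Γ : Cob c d) (σ : I' ≃ I) : Cob (fun i => c (σ i)) d :=
  { Γ with
    ends := Γ.ends.trans ((Equiv.refl _).sumCongr ((Equiv.refl _).sumCongr
      (σ.symm.sumCongr (.refl _))))
    dir_in := fun i => Γ.dir_in (σ i)
    dir_out := Γ.dir_out
    dir_joint := Γ.dir_joint }

/-- Relabelling of the outgoing marks. -/
def relabelOut (Γ : Cob c d) (τ : J' ≃ J) : Cob c (fun j => d (τ j)) :=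
  { Γ with
    ends := Γ.ends.trans ((Equiv.refl _).sumCongr ((Equiv.refl _).sumCongr
      ((Equiv.refl _).sumCongr τ.symm)))
    dir_in := Γ.dir_in
    dir_out := fun j => Γ.dir_out (τ j)
    dir_joint := Γ.dir_joint }

/-- The outgoing marks are turned into incoming ones. -/
def fold (Γ : Cob c d) : Cob (Sum.elim c d) (emptyObj : Empty → Nbar N) :=
  { Γ with
    ends := Γ.ends.trans ((Equiv.refl _).sumCongr ((Equiv.refl _).sumCongr
      (Equiv.sumEmpty (I ⊕ J) Empty).symm))
    dir_in := by
      rintro (i | j)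
      · exact Γ.dir_in i
      · exact Γ.dir_out j
    dir_out := fun j => j.elim
    dir_joint := Γ.dir_joint }

/-- Gluing vertexless edges to the incoming marks only inserts one joint next to each of these
marks. -/
theorem comp_ofEquiv_equivalent [Finite I] [Finite I'] (Γ : Cob c d) (σ : I' ≃ I) :
    Equivalent ((ofEquiv σ c).comp Γ) (Γ.relabelIn σ) := by
  let r : I → Γ.Flag ⊕ (Γ.Joint × Bool) ⊕ (I' ⊕ J) := fun i => .inr (.inr (.inl (σ.symm i)))
  let q : Γ.Flag ⊕ (Γ.Joint × Bool) ⊕ (I' ⊕ J) → Option I :=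
    Sum.elim (fun _ => none) (Sum.elim (fun _ => none) (Sum.elim (fun i => some (σ i))
      (fun _ => none)))
  have h : ∀ x y, q y = some x ↔ r x = y := by
    rintro x (y | y | y | y) <;> simp [q, r, Equiv.symm_apply_eq, eq_comm (a := x)]
  refine Relation.EqvGen.trans _ ((Γ.relabelIn σ).insertJoints r q h) _ (IsIso.equivalent ?_)
    (insertJoints_equivalent _ _ _ _)
  let e : I' ⊕ Γ.Edge ≃ Γ.Edge ⊕ I :=
    { toFun := Sum.elim (fun i => .inr (σ i)) Sum.inl
      invFun := Sum.elim Sum.inr (fun i => .inl (σ.symm i))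
      left_inv := by rintro (i | e) <;> simp
      right_inv := by rintro (e | i) <;> simp }
  let t : (Empty ⊕ Γ.Joint ⊕ I) × Bool ≃ (Γ.Joint ⊕ I) × Bool :=
    { toFun := fun | (.inr (.inl j), b) => (.inl j, b) | (.inr (.inr i), b) => (.inr i, !b)
      invFun := fun | (.inl j, b) => (.inr (.inl j), b) | (.inr i, b) => (.inr (.inr i), !b)
      left_inv := by rintro ⟨⟨⟨⟩⟩ | j | i, _ | _⟩ <;> rfl
      right_inv := by rintro ⟨j | i, _ | _⟩ <;> rfl }
  let s : (I' ⊕ Γ.Edge) × Bool ≃ (Γ.Edge ⊕ I) × Bool :=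
    { toFun := fun | (.inl i, b) => (.inr (σ i), !b) | (.inr e, b) => (.inl e, b)
      invFun := fun | (.inl e, b) => (.inr e, b) | (.inr i, b) => (.inl (σ.symm i), !b)
      left_inv := by rintro ⟨i | e, b⟩ <;> simp
      right_inv := by rintro ⟨e | i, b⟩ <;> simp }
  let j : Empty ⊕ Γ.Joint ⊕ I ≃ Γ.Joint ⊕ I := Equiv.emptySum _ _
  let a : Empty ⊕ Γ.Vert ≃ Γ.Vert := Equiv.emptySum _ _
  let f : Empty ⊕ Γ.Flag ≃ Γ.Flag := Equiv.emptySum _ _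
  refine ⟨a, f, j, e, t, s, ?_, ?_, ?_, ?_, ?_, ?_⟩
  · rintro ⟨⟨⟨⟩⟩ | j | i, _ | _⟩ <;> rfl
  · rintro ⟨i | e, b⟩ <;> rfl
  · rintro (⟨⟨⟩⟩ | f); rfl
  · rintro (⟨⟨⟩⟩ | f); rfl
  · rintro (i | e)
    · exact (Γ.dir_in (σ (σ.symm (σ i)))).trans (congrArg (fun i => c (σ i)) (σ.symm_apply_apply i))
    · rfl
  · rintro ⟨i | e, b⟩
    · cases b
      · exact congrArg (fun i => Sum.inr (Sum.inr (Sum.inl i))) (σ.symm_apply_apply i)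
      · rfl
    · change insertEquiv r q h (.inl (Sum.map id (Sum.map id (Sum.map σ.symm id)) (Γ.ends (e, b)))) =
        Sum.map f (Sum.map t id) (glueEquiv _ _ _ _ _ _ _ (.inr (Γ.ends (e, b))))
      rcases Γ.ends (e, b) with f | j | i | j
      · rfl
      · rfl
      · exact congrArg (fun i => Sum.inr (Sum.inl (Sum.inr i, false))) (σ.apply_symm_apply i)
      · rfl

theorem relabelOut_comp_equivalent [Finite J] [Finite J'] (Γ : Cob c d) (τ : J' ≃ J) :
    Equivalent ((Γ.relabelOut τ).comp (ofEquiv τ d)) Γ := by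
  let r : J' → Γ.Flag ⊕ (Γ.Joint × Bool) ⊕ (I ⊕ J) := fun j => .inr (.inr (.inr (τ j)))
  let q : Γ.Flag ⊕ (Γ.Joint × Bool) ⊕ (I ⊕ J) → Option J' :=
    Sum.elim (fun _ => none) (Sum.elim (fun _ => none) (Sum.elim (fun _ => none)
      (fun j => some (τ.symm j))))
  have h : ∀ x y, q y = some x ↔ r x = y := by
    rintro x (y | y | y | y) <;> simp [q, r, Equiv.symm_apply_eq, eq_comm (a := y)]
  refine Relation.EqvGen.trans _ (Γ.insertJoints r q h) _ (IsIso.equivalent ?_)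
    (insertJoints_equivalent _ _ _ _)
  let j : Γ.Joint ⊕ Empty ⊕ J' ≃ Γ.Joint ⊕ J' := (Equiv.refl _).sumCongr (Equiv.emptySum _ _)
  let a : Γ.Vert ⊕ Empty ≃ Γ.Vert := Equiv.sumEmpty _ _
  let f : Γ.Flag ⊕ Empty ≃ Γ.Flag := Equiv.sumEmpty _ _
  refine ⟨a, f, j, .refl _, j.prodCongr (.refl _), .refl _,
    fun _ => rfl, fun _ => rfl, ?_, ?_, ?_, ?_⟩
  · rintro (f | ⟨⟨⟩⟩); rfl
  · rintro (f | ⟨⟨⟩⟩); rfl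
  · rintro (e | j)
    · rfl
    · exact Γ.dir_out (τ j)
  · rintro ⟨e | j', b⟩
    · change insertEquiv r q h (.inl (Γ.ends (e, b))) =
        Sum.map f (Sum.map (j.prodCongr (.refl _)) id) (glueEquiv _ _ _ _ _ _ _
          (.inl (Sum.map id (Sum.map id (Sum.map id τ.symm)) (Γ.ends (e, b)))))
      rcases Γ.ends (e, b) with f | j | i | j <;> rfl
    · cases b <;> rfl

/-- The identity cobordism. -/
abbrev idCob [Finite J] (d : J → Nbar N) : Cob d d := ofEquiv (Equiv.refl J) d

/-- The zigzag relation: each outgoing edge of `Γ` is prolonged by a cap and by an identity edge, so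
that the two sides differ by two joints on each of these edges. -/
theorem union_comp_fold_equivalent [Finite J] (Γ : Cob c d) :
    Equivalent (comp (c := Sum.elim c d) (d := Sum.elim d d) (Γ.union (idCob d)) (idCob d).fold)
      Γ.fold := by
  let r : J → Γ.Flag ⊕ (Γ.Joint × Bool) ⊕ ((I ⊕ J) ⊕ Empty) := fun j => .inr (.inr (.inl (.inr j)))
  let q : Γ.Flag ⊕ (Γ.Joint × Bool) ⊕ ((I ⊕ J) ⊕ Empty) → Option J :=
    Sum.elim (fun _ => none) (Sum.elim (fun _ => none) (Sum.elim (Sum.elim (fun _ => none)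
      some) Empty.elim))
  have h : ∀ x y, q y = some x ↔ r x = y := by
    rintro x (y | y | (y | y) | ⟨⟨⟩⟩) <;> simp [q, r, eq_comm (a := y)]
  let r' : J → Γ.Flag ⊕ ((Γ.Joint ⊕ J) × Bool) ⊕ ((I ⊕ J) ⊕ Empty) :=
    fun j => .inr (.inr (.inl (.inr j)))
  let q' : Γ.Flag ⊕ ((Γ.Joint ⊕ J) × Bool) ⊕ ((I ⊕ J) ⊕ Empty) → Option J :=
    Sum.elim (fun _ => none) (Sum.elim (fun _ => none) (Sum.elim (Sum.elim (fun _ => none)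
      some) Empty.elim))
  have h' : ∀ x y, q' y = some x ↔ r' x = y := by
    rintro x (y | y | (y | y) | ⟨⟨⟩⟩) <;> simp [q', r', eq_comm (a := y)]
  refine Relation.EqvGen.trans _ ((Γ.fold.insertJoints r q h).insertJoints r' q' h') _
    (IsIso.equivalent ?_)
    (Relation.EqvGen.trans _ _ _ (insertJoints_equivalent _ _ _ _) (insertJoints_equivalent _ _ _ _))
  let a : (Γ.Vert ⊕ Empty) ⊕ Empty ≃ Γ.Vert := (Equiv.sumEmpty _ _).trans (Equiv.sumEmpty _ _)
  let f : (Γ.Flag ⊕ Empty) ⊕ Empty ≃ Γ.Flag := (Equiv.sumEmpty _ _).trans (Equiv.sumEmpty _ _)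
  let j : (Γ.Joint ⊕ Empty) ⊕ Empty ⊕ (J ⊕ J) ≃ (Γ.Joint ⊕ J) ⊕ J :=
    { toFun := fun
        | .inl (.inl j) => .inl (.inl j)
        | .inr (.inr (.inl j)) => .inl (.inr j)
        | .inr (.inr (.inr j)) => .inr j
      invFun := fun
        | .inl (.inl j) => .inl (.inl j)
        | .inl (.inr j) => .inr (.inr (.inl j))
        | .inr j => .inr (.inr (.inr j))
      left_inv := by rintro ((j | ⟨⟨⟩⟩) | ⟨⟨⟩⟩ | j | j) <;> rfl
      right_inv := by rintro ((j | j) | j) <;> rfl }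
  let t : ((Γ.Joint ⊕ Empty) ⊕ Empty ⊕ (J ⊕ J)) × Bool ≃ ((Γ.Joint ⊕ J) ⊕ J) × Bool :=
    { toFun := fun
        | (.inl (.inl j), b) => (.inl (.inl j), b)
        | (.inr (.inr (.inl j)), b) => (.inl (.inr j), b)
        | (.inr (.inr (.inr j)), b) => (.inr j, !b)
      invFun := fun
        | (.inl (.inl j), b) => (.inl (.inl j), b)
        | (.inl (.inr j), b) => (.inr (.inr (.inl j)), b)
        | (.inr j, b) => (.inr (.inr (.inr j)), !b)
      left_inv := by rintro ⟨(j | ⟨⟨⟩⟩) | ⟨⟨⟩⟩ | j | j, _ | _⟩ <;> rfl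
      right_inv := by rintro ⟨(j | j) | j, _ | _⟩ <;> rfl }
  let e : (Γ.Edge ⊕ J) ⊕ J ≃ (Γ.Edge ⊕ J) ⊕ J :=
    { toFun := fun
        | .inl (.inl x) => .inl (.inl x)
        | .inl (.inr j) => .inr j
        | .inr j => .inl (.inr j)
      invFun := fun
        | .inl (.inl x) => .inl (.inl x)
        | .inl (.inr j) => .inr j
        | .inr j => .inl (.inr j)
      left_inv := by rintro ((j | j) | j) <;> rfl
      right_inv := by rintro ((j | j) | j) <;> rfl }
  let s : ((Γ.Edge ⊕ J) ⊕ J) × Bool ≃ ((Γ.Edge ⊕ J) ⊕ J) × Bool :=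
    { toFun := fun
        | (.inl (.inl x), b) => (.inl (.inl x), b)
        | (.inl (.inr j), b) => (.inr j, !b)
        | (.inr j, b) => (.inl (.inr j), b)
      invFun := fun
        | (.inl (.inl x), b) => (.inl (.inl x), b)
        | (.inl (.inr j), b) => (.inr j, b)
        | (.inr j, b) => (.inl (.inr j), !b)
      left_inv := by rintro ⟨(j | j) | j, _ | _⟩ <;> rfl
      right_inv := by rintro ⟨(j | j) | j, _ | _⟩ <;> rfl }
  refine ⟨a, f, j, e, t, s, ?_, ?_, ?_, ?_, ?_, ?_⟩
  · rintro ⟨(j | ⟨⟨⟩⟩) | ⟨⟨⟩⟩ | j | j, b⟩ <;> rfl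
  · rintro ⟨(j | j) | j, b⟩ <;> rfl
  · rintro ((f | ⟨⟨⟩⟩) | ⟨⟨⟩⟩); rfl
  · rintro ((f | ⟨⟨⟩⟩) | ⟨⟨⟩⟩); rfl
  · rintro ((x | j) | j)
    · rfl
    · exact ((Γ.fold.insertJoints r q h).dir_in (.inr j))
    · exact Γ.dir_out j
  · rintro ⟨(x | j) | j, b⟩
    · change insertEquiv r' q' h' (.inl (insertEquiv r q h (.inl (Sum.map id (Sum.map id Sum.inl)
          (Γ.ends (x, b)))))) =
        Sum.map f (Sum.map t id) (glueEquiv _ _ _ _ _ _ _ (.inl (unionEquiv _ _ _ _ _ _ _ _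
          (.inl (Γ.ends (x, b))))))
      rcases Γ.ends (x, b) with f | j | i | j <;> rfl
    · cases b <;> rfl
    · cases b <;> rfl

end Cob

end Folding

/-! ### Cobordisms on which the data determine the value -/

section Uniqueness

open ExteriorAlgebra Module

variable {N : Type u} [AddCommGroup N] [Module.Free ℤ N] [Module.Finite ℤ N]

variable {I J I' J' K : Type} [Finite I] [Finite J] [Finite I'] [Finite J'] [Finite K]
  {c : I → Nbar N} {d : J → Nbar N} {c' : I' → Nbar N} {d' : J' → Nbar N} {k : K → Nbar N}

/-- Integrated points `J`, each of which carries two incoming marks. -/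
abbrev pairDiagram (d : J → Nbar N) : Diagram (Sum.elim d d) (emptyObj : Empty → Nbar N) where
  Pt := J
  Edge := Empty
  Int := J
  finite_pt := inferInstance
  finite_edge := inferInstance
  finite_int := inferInstance
  pd := d
  ed := Empty.elim
  en := Empty.elim
  ip := id
  src := Sum.elim id id
  tgt _ := none
  en_le e := e.elim
  src_le := by rintro (j | j) <;> exact le_rfl
  tgt_le := by rintro p j ⟨⟩

theorem eval_diagram_fold_idCob (d : J → Nbar N) :
    (Cob.idCob d).fold.diagram.eval = (pairDiagram d).eval := by
  refine Diagram.eval_eq_of_elim (Cob.idCob d).fold.diagram (pairDiagram d) (X := J)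
    (Equiv.emptySum _ _)
    ((Equiv.emptySum Empty (J ⊕ J)).symm.trans (Equiv.emptySum Empty (Empty ⊕ (J ⊕ J))).symm)
    (Sum.elim Empty.elim (Sum.elim Empty.elim (Sum.elim (Sum.elim id id) Empty.elim)))
    (fun j => .inr (.inr (.inl (.inl j))))
    ?_ ?_ ?_ ?_ ?_ ?_ ?_ Empty.rec Empty.rec ?_ ?_ ?_
  · intro j; rfl
  · intro j; rfl
  · rintro (⟨⟨⟩⟩ | ⟨⟨⟩⟩ | (j | j) | ⟨⟨⟩⟩)
    · exact .inl rfl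
    · exact .inr ⟨j, rfl⟩
  · intro j
    exact ⟨true, rfl, rfl⟩
  · intro i; rfl
  · intro i p h
    cases h
  · intro i i' h
    cases h
    rfl
  · intro i; rfl
  · rintro (i | i) <;> rfl
  · intro j; rfl

/-- Both inputs are placed at the same points and multiplied there before integration, so this is
the pairing whose nondegeneracy has been proved. -/
theorem eval_pairDiagram (d : J → Nbar N) (x y : State d) :
    (pairDiagram d).eval (leftPart d d x * rightPart d d y) =
      algebraMap ℚ _ (eps (act (volProd fun j : J =>
        LinearMap.proj (R := ℚ) (φ := fun j => Dbl (d j)) j) (x * y))) := by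
  have h1 : edgeProd (pairDiagram d).diff = 1 := centralProd_isEmpty _ _
  have h3 : (pairDiagram d).outMap = 0 := wmap_none
  have h4 : (pairDiagram d).inMap ∘ₗ (wmap d (Sum.elim d d) fun i => some (.inl i)) =
      LinearMap.id := by
    refine wsingle_ext (pd := d) fun i => ?_
    rw [LinearMap.comp_assoc, wmap_wsingle_some (f := fun i => some (Sum.inl i)) rfl le_rfl le_rfl]
    exact (pairDiagram d).inMap_wsingle (.inl i) (d i) le_rfl
  have h5 : (pairDiagram d).inMap ∘ₗ (wmap d (Sum.elim d d) fun i => some (.inr i)) =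
      LinearMap.id := by
    refine wsingle_ext (pd := d) fun i => ?_
    rw [LinearMap.comp_assoc, wmap_wsingle_some (f := fun i => some (Sum.inr i)) rfl le_rfl le_rfl]
    exact (pairDiagram d).inMap_wsingle (.inr i) (d i) le_rfl
  have h6 : map (pairDiagram d).inMap (leftPart d d x) = x := by
    rw [leftPart_eq, map_map', h4, map_id']
  have h7 : map (pairDiagram d).inMap (rightPart d d y) = y := by
    rw [rightPart_eq, map_map', h5, map_id']
  have h8 : map (pairDiagram d).inMap (leftPart d d x * rightPart d d y) = x * y :=
    (map_mul (map (pairDiagram d).inMap) _ _).trans (congrArg₂ (· * ·) h6 h7)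
  rw [Diagram.eval_apply, kernelOp_apply, h1, one_mul, h3, map_zero_apply]
  exact congrArg (fun z => algebraMap ℚ _ (eps (act (volProd (pairDiagram d).pt) z))) h8

/-- Every multiplicity TrQFT has the same value on this cobordism. -/
def Determined (Γ : Cob c d) : Prop :=
  ∀ F : TrQFT N, F.IsMult → F.map Γ = (multTrQFT N).map Γ

theorem Determined.comp {Γ : Cob c d} {Γ' : Cob d k} (h : Determined Γ) (h' : Determined Γ') :
    Determined (Γ.comp Γ') := fun F hF => by
  rw [F.map_comp, (multTrQFT N).map_comp, h F hF, h' F hF]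

theorem Determined.union {Γ : Cob c d} {Γ' : Cob c' d'} (h : Determined Γ) (h' : Determined Γ') :
    Determined (Γ.union Γ') := fun F hF => state_sum_ext fun x y => by
  rw [F.map_union, (multTrQFT N).map_union, h F hF, h' F hF]

theorem Determined.congr {Γ Γ' : Cob c d} (h : Determined Γ) (e : Cob.Equivalent Γ Γ') :
    Determined Γ' := fun F hF => by
  rw [← F.map_equivalent _ _ e, ← (multTrQFT N).map_equivalent _ _ e, h F hF]

theorem determined_ofEquiv (σ : I ≃ J) (d : J → Nbar N) : Determined (Cob.ofEquiv σ d) :=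
  fun F _ => by rw [F.map_ofEquiv, (multTrQFT N).map_ofEquiv]

theorem Determined.relabelIn {Γ : Cob c d} (h : Determined Γ) (σ : I' ≃ I) :
    Determined (Γ.relabelIn σ) :=
  ((determined_ofEquiv σ c).comp h).congr (Γ.comp_ofEquiv_equivalent σ)

theorem reindex_injective (σ : I ≃ J) (d : J → Nbar N) : Function.Injective (reindex σ d) := by
  refine Function.LeftInverse.injective (g := ExteriorAlgebra.map
    (LinearEquiv.piCongrLeft ℚ (fun j => Dbl (d j)) σ).symm.toLinearMap) fun x => ?_
  rw [reindex, map_map', LinearEquiv.symm_comp, map_id']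

theorem Determined.relabelOut {Γ : Cob c d} (h : Determined Γ) (τ : J' ≃ J) :
    Determined (Γ.relabelOut τ) := fun F hF => LinearMap.ext fun x => reindex_injective τ d <| by
  have key : ∀ G : TrQFT N, reindex τ d (G.map (Γ.relabelOut τ) x) = G.map Γ x := fun G => by
    rw [← G.map_equivalent _ _ (Γ.relabelOut_comp_equivalent τ), G.map_comp, G.map_ofEquiv]
    rfl
  rw [key, key, h F hF]

/-- Isomorphism of cobordisms up to relabelling of the marks. -/
theorem Determined.of_similar {Γ : Cob c d} {Γ' : Cob c' d'} (h' : Determined Γ')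
    (σ : I ≃ I') (τ : J ≃ J') (a : Γ.Vert ≃ Γ'.Vert) (f : Γ.Flag ≃ Γ'.Flag)
    (j : Γ.Joint ≃ Γ'.Joint) (e : Γ.Edge ≃ Γ'.Edge) (t : Γ.Joint × Bool ≃ Γ'.Joint × Bool)
    (s : Γ.Edge × Bool ≃ Γ'.Edge × Bool) (ht : ∀ x, (t x).1 = j x.1) (hs : ∀ x, (s x).1 = e x.1)
    (ha : ∀ x, Γ'.root (f x) = a (Γ.root x)) (hg : ∀ v, Γ'.genus (a v) = Γ.genus v)
    (hd : ∀ x, Γ'.dir (e x) = Γ.dir x)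
    (hends : ∀ x, Γ'.ends (s x) = Sum.map f (Sum.map t (Sum.map σ τ)) (Γ.ends x)) :
    Determined Γ := by
  have key : ∀ y, Γ.dir (Γ.ends.symm y).1 =
      Γ'.dir (Γ'.ends.symm (Sum.map f (Sum.map t (Sum.map σ τ)) y)).1 := by
    intro y
    rw [← Γ.ends.apply_symm_apply y, ← hends, Equiv.symm_apply_apply, Equiv.symm_apply_apply, hs,
      hd]
  -- The directions agree only propositionally; they are read off from the edges carrying the marks
  -- and then substituted.
  have hc : c = fun i => c' (σ i) := funext fun i => by
    rw [← Γ.dir_in, key]; exact Γ'.dir_in _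
  have hd' : d = fun j => d' (τ j) := funext fun j => by
    rw [← Γ.dir_out, key]; exact Γ'.dir_out _
  subst hc hd'
  refine ((h'.relabelIn σ).relabelOut τ).congr (.symm _ _ (Cob.IsIso.equivalent
    ⟨a, f, j, e, t, s, ht, hs, ha, hg, hd, fun x => ?_⟩))
  change Sum.map id (Sum.map id (Sum.map id τ.symm)) (Sum.map id (Sum.map id (Sum.map σ.symm id))
    (Γ'.ends (s x))) = _
  rw [hends]
  rcases Γ.ends x with y | y | y | y
  · rfl
  · rfl
  · exact congrArg (fun i => Sum.inr (Sum.inr (Sum.inl i))) (σ.symm_apply_apply y)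
  · exact congrArg (fun i => Sum.inr (Sum.inr (Sum.inr i))) (τ.symm_apply_apply y)

theorem multTrQFT_map_fold_idCob (d : J → Nbar N) (x y : State d) :
    (multTrQFT N).map (Cob.idCob d).fold (leftPart d d x * rightPart d d y) =
      algebraMap ℚ _ (eps (act (volProd fun j : J =>
        LinearMap.proj (R := ℚ) (φ := fun j => Dbl (d j)) j) (x * y))) := by
  rw [← eval_pairDiagram, ← eval_diagram_fold_idCob]
  exact LinearMap.congr_fun
    (multMap_of_genus (Γ := (Cob.idCob d).fold) (fun v => Empty.elim v)) _

/-- A cobordism can be recovered from its fold, as the pairings are nondegenerate. -/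
theorem Determined.of_fold {Γ : Cob c d} (h : Determined Γ.fold)
    (hd : Determined (Cob.idCob d).fold) : Determined Γ := by
  intro F hF
  refine LinearMap.ext fun x => ?_
  -- By the zigzag relation, pairing the value `G.map Γ x` with `y` gives the value of the fold,
  -- which does not depend on `G`. Nondegeneracy then determines the value itself.
  have key : ∀ (G : TrQFT N), G.IsMult → ∀ y, (multTrQFT N).map (Cob.idCob d).fold
      (leftPart d d (G.map Γ x) * rightPart d d y) =
      (multTrQFT N).map Γ.fold (leftPart c d x * rightPart c d y) := by
    intro G hG y
    have h1 := LinearMap.congr_fun (G.map_equivalent _ _ Γ.union_comp_fold_equivalent)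
      (leftPart c d x * rightPart c d y)
    rw [h G hG] at h1
    rw [← h1, ← hd G hG]
    have h2 := G.map_union Γ (Cob.idCob d) x y
    have h3 : G.map (Cob.idCob d) y = y := by
      refine (LinearMap.congr_fun (G.map_ofEquiv (Equiv.refl J) d) y).trans ?_
      exact (congrArg (fun f => ExteriorAlgebra.map f y) (LinearMap.ext fun v => rfl)).trans
        (map_id' y)
    rw [h3] at h2
    rw [← h2]
    exact (LinearMap.congr_fun (G.map_comp (c := Sum.elim c d) (d := Sum.elim d d)
      (Γ.union (Cob.idCob d)) (Cob.idCob d).fold) _).symm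
  have hz : F.map Γ x - (multTrQFT N).map Γ x = 0 := by
    refine eq_zero_of_integral_mul (fun j : J =>
      LinearMap.proj (R := ℚ) (φ := fun j => Dbl (d j)) j) (fun j => wsingle d j (d j))
      (fun j => (proj_wsingle j _).trans (incl_self _))
      (fun i j hij => proj_wsingle_of_ne (Ne.symm hij) _) (fun w hw => funext hw) _ fun y => ?_
    refine (algebraMap ℚ (State (emptyObj : Empty → Nbar N))).injective ?_
    rw [← multTrQFT_map_fold_idCob, map_sub, sub_mul, map_sub, key F hF,
      key _ (multTrQFT_isMult N), sub_self, map_zero]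
  exact sub_eq_zero.1 hz

end Uniqueness

/-! ### Cutting cobordisms into edges and stars -/

section Generation

variable {N : Type u} [AddCommGroup N]

/-- Vertices of genus `0` with incoming marks. -/
def Cob.star {V I : Type} [Finite V] [Finite I] (root : I → V) (c : I → Nbar N) :
    Cob c (emptyObj : Empty → Nbar N) where
  Vert := V
  Flag := I
  Joint := Empty
  Edge := I
  finite_vert := inferInstance
  finite_flag := inferInstance
  finite_joint := inferInstance
  finite_edge := inferInstance
  root := root
  genus _ := 0
  dir := c
  ends :=
    { toFun := fun
        | (x, false) => .inr (.inr (.inl x))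
        | (x, true) => .inl x
      invFun := fun
        | .inl x => (x, true)
        | .inr (.inl x) => x.1.elim
        | .inr (.inr (.inl x)) => (x, false)
        | .inr (.inr (.inr x)) => x.elim
      left_inv := by rintro ⟨i, _ | _⟩ <;> rfl
      right_inv := by rintro (x | x | x | x) <;> first | exact x.elim | exact x.1.elim | rfl }
  dir_in _ := rfl
  dir_out j := j.elim
  dir_joint j := j.elim

/-- A vertex with incoming marks, joined to a second vertex by an edge of direction `0`. -/
def Cob.bar {I : Type} [Finite I] (c : I → Nbar N) : Cob c (emptyObj : Empty → Nbar N) where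
  Vert := Bool
  Flag := I ⊕ Bool
  Joint := Empty
  Edge := I ⊕ Unit
  finite_vert := inferInstance
  finite_flag := inferInstance
  finite_joint := inferInstance
  finite_edge := inferInstance
  root := Sum.elim (fun _ => false) id
  genus _ := 0
  dir := Sum.elim c fun _ => Nbar.zero
  ends :=
    { toFun := fun
        | (.inl x, false) => .inr (.inr (.inl x))
        | (.inl x, true) => .inl (.inl x)
        | (.inr _, b) => .inl (.inr b)
      invFun := fun
        | .inl (.inl x) => (.inl x, true)
        | .inl (.inr b) => (.inr (), b)
        | .inr (.inl x) => x.1.elim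
        | .inr (.inr (.inl x)) => (.inl x, false)
        | .inr (.inr (.inr x)) => x.elim
      left_inv := by rintro ⟨i | i, _ | _⟩ <;> rfl
      right_inv := by rintro ((x | x) | x | x | x) <;> first | exact x.elim | exact x.1.elim | rfl }
  dir_in _ := rfl
  dir_out j := j.elim
  dir_joint j := j.elim

/-- The edges of a cobordism, cut off from the vertices. -/
def Cob.cutEdges {I : Type} {c : I → Nbar N} (Γ : Cob c (emptyObj : Empty → Nbar N)) :
    Cob c fun f => Γ.dir (Γ.ends.symm (.inl f)).1 where
  Vert := Empty
  Flag := Empty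
  Joint := Γ.Joint
  Edge := Γ.Edge
  finite_vert := inferInstance
  finite_flag := inferInstance
  finite_joint := Γ.finite_joint
  finite_edge := Γ.finite_edge
  root := Empty.elim
  genus := Empty.elim
  dir := Γ.dir
  ends := Γ.ends.trans
    { toFun := fun
        | .inl f => .inr (.inr (.inr f))
        | .inr (.inl j) => .inr (.inl j)
        | .inr (.inr (.inl i)) => .inr (.inr (.inl i))
        | .inr (.inr (.inr x)) => x.elim
      invFun := fun
        | .inl x => x.elim
        | .inr (.inl j) => .inr (.inl j)
        | .inr (.inr (.inl i)) => .inr (.inr (.inl i))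
        | .inr (.inr (.inr f)) => .inl f
      left_inv := by rintro (x | x | x | x) <;> first | exact x.elim | rfl
      right_inv := by rintro (x | x | x | x) <;> first | exact x.elim | rfl }
  dir_in := Γ.dir_in
  dir_out _ := rfl
  dir_joint := Γ.dir_joint

theorem Cob.isContraction_bar {I : Type} [Finite I] (c : I → Nbar N) :
    IsContraction (bar c) (star (fun _ => ()) c) := by
  let p : Bool → Unit := fun _ => ()
  let e : I ≃ {x : I ⊕ Unit // x ≠ .inr ()} :=
    { toFun := fun i => ⟨.inl i, Sum.inl_ne_inr⟩
      invFun := fun | ⟨.inl i, _⟩ => i | ⟨.inr (), h⟩ => (h rfl).elim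
      left_inv := fun i => rfl
      right_inv := by rintro ⟨i | i, h⟩ <;> first | rfl | exact (h rfl).elim }
  let f : I ≃ {x : I ⊕ Bool // x ≠ .inr false ∧ x ≠ .inr true} :=
    { toFun := fun i => ⟨.inl i, Sum.inl_ne_inr, Sum.inl_ne_inr⟩
      invFun := fun
        | ⟨.inl i, _⟩ => i
        | ⟨.inr false, h⟩ => (h.1 rfl).elim
        | ⟨.inr true, h⟩ => (h.2 rfl).elim
      left_inv := fun i => rfl
      right_inv := by
        rintro ⟨i | _ | _, h⟩ <;> first | rfl | exact (h.1 rfl).elim | exact (h.2 rfl).elim }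
  refine ⟨.inr (), .inr false, .inr true, p, e, f, .refl _, rfl, rfl, rfl, fun v => ⟨false, rfl⟩,
    ?_, fun _ _ _ => rfl, fun _ => rfl, ?_, fun _ => rfl, fun _ => rfl, ?_⟩
  · rintro (_ | _) (_ | _)
    · exact ⟨fun _ => .inl rfl, fun _ => rfl⟩
    · exact ⟨fun _ => .inr (.inl ⟨rfl, rfl⟩), fun _ => rfl⟩
    · exact ⟨fun _ => .inr (.inr ⟨rfl, rfl⟩), fun _ => rfl⟩
    · exact ⟨fun _ => .inl rfl, fun _ => rfl⟩
  · intro h; cases h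
  · rintro x (_ | _) <;> rfl

/-- The composite consists of two vertices joined by an edge of direction `0` with a joint on it.
Erasing the joint gives `bar`, and contracting the edge gives the star. -/
theorem Cob.corolla_comp_equivalent {I : Type} [Finite I] (c : I → Nbar N) :
    Equivalent ((corolla c (oneObj Nbar.zero)).comp (corolla (oneObj Nbar.zero) emptyObj))
      (star (fun _ => ()) c) := by
  let r : Unit → (I ⊕ Bool) ⊕ (Empty × Bool) ⊕ (I ⊕ Empty) := fun _ => .inl (.inr true)
  let q : (I ⊕ Bool) ⊕ (Empty × Bool) ⊕ (I ⊕ Empty) → Option Unit :=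
    Sum.elim (Sum.elim (fun _ => none) fun b => if b then some () else none) (fun _ => none)
  have h : ∀ x y, q y = some x ↔ r x = y := by
    rintro x ((y | _ | _) | y) <;> simp [q, r]
  refine Relation.EqvGen.trans _ ((bar c).insertJoints r q h) _ (IsIso.equivalent ?_)
    (Relation.EqvGen.trans _ _ _ (insertJoints_equivalent _ _ _ _) (isContraction_bar c).equivalent)
  let a : Unit ⊕ Unit ≃ Bool :=
    { toFun := Sum.elim (fun _ => false) (fun _ => true)
      invFun := fun b => if b then .inr () else .inl ()
      left_inv := by rintro (_ | _) <;> rfl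
      right_inv := by rintro (_ | _) <;> rfl }
  let f : (I ⊕ Unit) ⊕ (Unit ⊕ Empty) ≃ I ⊕ Bool :=
    { toFun := fun
        | .inl (.inl i) => .inl i
        | .inl (.inr _) => .inr false
        | .inr (.inl _) => .inr true
      invFun := fun
        | .inl i => .inl (.inl i)
        | .inr false => .inl (.inr ())
        | .inr true => .inr (.inl ())
      left_inv := by rintro ((_ | _) | _ | ⟨⟨⟩⟩) <;> rfl
      right_inv := by rintro (_ | _ | _) <;> rfl }
  let j : Empty ⊕ Empty ⊕ Unit ≃ Empty ⊕ Unit := Equiv.emptySum _ _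
  let t : (Empty ⊕ Empty ⊕ Unit) × Bool ≃ (Empty ⊕ Unit) × Bool := j.prodCongr (.refl _)
  let e : (I ⊕ Unit) ⊕ (Unit ⊕ Empty) ≃ (I ⊕ Unit) ⊕ Unit :=
    (Equiv.refl _).sumCongr (Equiv.sumEmpty _ _)
  let s : ((I ⊕ Unit) ⊕ (Unit ⊕ Empty)) × Bool ≃ ((I ⊕ Unit) ⊕ Unit) × Bool :=
    { toFun := fun
        | (.inl (.inl i), b) => (.inl (.inl i), b)
        | (.inl (.inr i), b) => (.inl (.inr i), !b)
        | (.inr (.inl i), b) => (.inr i, b)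
      invFun := fun
        | (.inl (.inl i), b) => (.inl (.inl i), b)
        | (.inl (.inr i), b) => (.inl (.inr i), !b)
        | (.inr i, b) => (.inr (.inl i), b)
      left_inv := by rintro ⟨(_ | _) | _ | ⟨⟨⟩⟩, _ | _⟩ <;> rfl
      right_inv := by rintro ⟨(_ | _) | _, _ | _⟩ <;> rfl }
  refine ⟨a, f, j, e, t, s, fun _ => rfl, ?_, ?_, ?_, ?_, ?_⟩
  · rintro ⟨(_ | _) | _ | ⟨⟨⟩⟩, b⟩ <;> rfl
  · rintro ((_ | _) | _ | ⟨⟨⟩⟩) <;> rfl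
  · rintro (_ | _) <;> rfl
  · rintro ((_ | _) | _ | ⟨⟨⟩⟩) <;> rfl
  · rintro ⟨(_ | _) | _ | ⟨⟨⟩⟩, _ | _⟩ <;> rfl

/-- Gluing the vertices back to their edges only introduces a joint next to each flag. -/
theorem Cob.cutEdges_comp_equivalent {I : Type} {c : I → Nbar N}
    (Γ : Cob c (emptyObj : Empty → Nbar N)) [Finite Γ.Flag] [Finite Γ.Vert]
    (hg : ∀ v, Γ.genus v = 0) : Equivalent (Γ.cutEdges.comp (star Γ.root _)) Γ := by
  let r : Γ.Flag → Γ.Flag ⊕ (Γ.Joint × Bool) ⊕ (I ⊕ Empty) := .inl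
  let q : Γ.Flag ⊕ (Γ.Joint × Bool) ⊕ (I ⊕ Empty) → Option Γ.Flag :=
    Sum.elim some (fun _ => none)
  have h : ∀ x y, q y = some x ↔ r x = y := by
    rintro x (y | y) <;> simp [q, r, eq_comm (a := x)]
  refine Relation.EqvGen.trans _ (Γ.insertJoints r q h) _ (IsIso.equivalent ?_)
    (insertJoints_equivalent _ _ _ _)
  let a : Empty ⊕ Γ.Vert ≃ Γ.Vert := Equiv.emptySum _ _
  let f : Empty ⊕ Γ.Flag ≃ Γ.Flag := Equiv.emptySum _ _
  let j : Γ.Joint ⊕ Empty ⊕ Γ.Flag ≃ Γ.Joint ⊕ Γ.Flag := (Equiv.refl _).sumCongr (Equiv.emptySum _ _)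
  refine ⟨a, f, j, .refl _, j.prodCongr (.refl _), .refl _, fun _ => rfl, fun _ => rfl, ?_, ?_, ?_, ?_⟩
  · rintro (⟨⟨⟩⟩ | _); rfl
  · rintro (⟨⟨⟩⟩ | v); exact hg v
  · rintro (_ | _) <;> rfl
  · rintro ⟨e | x, b⟩
    · change insertEquiv r q h (.inl (Γ.ends (e, b))) =
        Sum.map f (Sum.map (j.prodCongr (.refl _)) id) (glueEquiv _ _ _ _ _ _ _
          (.inl (Γ.cutEdges.ends (e, b))))
      unfold cutEdges
      simp only [Equiv.trans_apply]
      rcases Γ.ends (e, b) with f | j | i | ⟨⟨⟩⟩ <;> rfl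
    · cases b <;> rfl

variable [Module.Free ℤ N] [Module.Finite ℤ N]

theorem determined_cap (n : Nbar N) : Determined (Cob.cap n) := fun F hF =>
  LinearMap.ext fun x => by rw [hF.map_cap, (multTrQFT_isMult N).map_cap]

theorem determined_of_isEmpty {I : Type} [Finite I] {c : I → Nbar N}
    (Γ : Cob c (emptyObj : Empty → Nbar N)) [IsEmpty I] [IsEmpty Γ.Vert] [IsEmpty Γ.Flag]
    [IsEmpty Γ.Joint] [IsEmpty Γ.Edge] : Determined Γ := by
  refine (determined_ofEquiv (Equiv.refl Empty) emptyObj).of_similar (Equiv.equivOfIsEmpty _ _)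
    (.refl _) (Equiv.equivOfIsEmpty _ Empty) (Equiv.equivOfIsEmpty _ Empty)
    (Equiv.equivOfIsEmpty _ Empty) (Equiv.equivOfIsEmpty _ Empty)
    (Equiv.equivOfIsEmpty _ (Empty × Bool)) (Equiv.equivOfIsEmpty _ (Empty × Bool))
    isEmptyElim isEmptyElim isEmptyElim isEmptyElim isEmptyElim isEmptyElim

/-- The folded identity is a disjoint union of caps; the induction splits off the cap of one index.
-/
theorem determined_fold_idCob {J : Type} [Finite J] (d : J → Nbar N) :
    Determined (Cob.idCob d).fold := by
  suffices H : ∀ (J : Type), Finite J → ∀ (_ : Finite J) (d : J → Nbar N),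
      Determined (Cob.idCob d).fold from H J ‹_› ‹_› d
  intro J hJ
  refine Finite.induction_empty_option (P := fun J => ∀ (_ : Finite J) (d : J → Nbar N),
      Determined (Cob.idCob d).fold) ?_ ?_ ?_ J
  · intro X Y e ih hY d
    have hX := Finite.of_equiv _ e.symm
    refine (ih hX fun x => d (e x)).of_similar (e.symm.sumCongr e.symm) (.refl _) (.refl _) (.refl _)
      (.refl _) e.symm (.refl _) (e.symm.prodCongr (.refl _)) (fun x => rfl) (fun x => rfl)
      (fun v => Empty.elim v) (fun v => Empty.elim v)
      (fun y => congrArg d (e.apply_symm_apply y)) ?_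
    rintro ⟨y, _ | _⟩ <;> rfl
  · intro _ d
    have : IsEmpty (Cob.idCob d).fold.Vert := inferInstanceAs (IsEmpty Empty)
    have : IsEmpty (Cob.idCob d).fold.Flag := inferInstanceAs (IsEmpty Empty)
    have : IsEmpty (Cob.idCob d).fold.Joint := inferInstanceAs (IsEmpty Empty)
    have : IsEmpty (Cob.idCob d).fold.Edge := inferInstanceAs (IsEmpty PEmpty)
    exact determined_of_isEmpty _
  · intro X _ ih hX d
    let σ : Option X ⊕ Option X ≃ Bool ⊕ (X ⊕ X) :=
      { toFun := fun
          | .inl none => .inl false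
          | .inr none => .inl true
          | .inl (some x) => .inr (.inl x)
          | .inr (some x) => .inr (.inr x)
        invFun := fun
          | .inl false => .inl none
          | .inl true => .inr none
          | .inr (.inl x) => .inl (some x)
          | .inr (.inr x) => .inr (some x)
        left_inv := by rintro ((_ | _) | (_ | _)) <;> rfl
        right_inv := by rintro ((_ | _) | (_ | _)) <;> rfl }
    let e : Option X ≃ Unit ⊕ X :=
      { toFun := fun | none => .inl () | some x => .inr x
        invFun := fun | .inl _ => none | .inr x => some x
        left_inv := by rintro (_ | _) <;> rfl
        right_inv := by rintro (_ | _) <;> rfl }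
    refine ((determined_cap (d none)).union (ih inferInstance fun x => d (some x))).of_similar σ
      (Equiv.emptySum _ _).symm (Equiv.emptySum Empty Empty).symm (Equiv.emptySum Empty Empty).symm
      (Equiv.emptySum Empty Empty).symm e ((Equiv.emptySum Empty Empty).symm.prodCongr (.refl _))
      (e.prodCongr (.refl _))
      (fun x => rfl) (fun x => rfl) (fun v => Empty.elim v) (fun v => Empty.elim v) ?_ ?_
    · rintro (_ | _) <;> rfl
    · rintro ⟨_ | _, _ | _⟩ <;> rfl

theorem determined_star_unit {I : Type} [Finite I] (c : I → Nbar N) :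
    Determined (Cob.star (fun _ => ()) c) := by
  have := Fintype.ofFinite I
  have hinj : Function.Injective (evalOne (Nbar.zero : Nbar N)) := by
    refine Function.LeftInverse.injective (g := ExteriorAlgebra.map
      (wsingle (oneObj (Nbar.zero : Nbar N)) () Nbar.zero)) fun x => ?_
    rw [map_evalOne]
    refine (congrArg (fun f => ExteriorAlgebra.map f x) (LinearMap.ext fun v => ?_)).trans (map_id' x)
    exact funext fun u => wsingle_apply_self (pd := oneObj (Nbar.zero : Nbar N)) () (v ())
  have h1 : Determined (Cob.corolla c (oneObj Nbar.zero)) := fun F hF =>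
    LinearMap.ext fun x => hinj <| by rw [hF.map_vertex, (multTrQFT_isMult N).map_vertex]
  have h2 : Determined (Cob.corolla (oneObj (Nbar.zero : Nbar N)) emptyObj) := fun F hF =>
    LinearMap.ext fun x => by rw [hF.map_counit, (multTrQFT_isMult N).map_counit]
  exact (h1.comp h2).congr (Cob.corolla_comp_equivalent c)

/-- Induction on the number of vertices: the vertex `none`, with the marks attached to it, is a
disjoint summand. -/
theorem determined_star {V I : Type} [Finite V] [Finite I] (root : I → V) (c : I → Nbar N) :
    Determined (Cob.star root c) := by
  suffices H : ∀ (V : Type), Finite V → ∀ (_ : Finite V) (I : Type) (_ : Finite I)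
      (root : I → V) (c : I → Nbar N), Determined (Cob.star root c) from H V ‹_› ‹_› I ‹_› root c
  intro V hV
  refine Finite.induction_empty_option (P := fun V => ∀ (_ : Finite V) (I : Type) (_ : Finite I)
      (root : I → V) (c : I → Nbar N), Determined (Cob.star root c)) ?_ ?_ ?_ V
  · intro X Y a ih hY I _ root c
    have hX := Finite.of_equiv _ a.symm
    refine (ih hX I inferInstance (fun x => a.symm (root x)) c).of_similar (.refl _) (.refl _) a.symm
      (.refl _) (.refl _) (.refl _) (.refl _) (.refl _) (fun x => rfl) (fun x => rfl)
      (fun v => rfl) (fun v => rfl) (fun y => rfl) ?_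
    rintro ⟨y, _ | _⟩ <;> rfl
  · intro _ I _ root c
    have : IsEmpty I := ⟨fun i => (root i).elim⟩
    have : IsEmpty (Cob.star root c).Vert := inferInstanceAs (IsEmpty PEmpty)
    have : IsEmpty (Cob.star root c).Flag := inferInstanceAs (IsEmpty I)
    have : IsEmpty (Cob.star root c).Joint := inferInstanceAs (IsEmpty Empty)
    have : IsEmpty (Cob.star root c).Edge := inferInstanceAs (IsEmpty I)
    exact determined_of_isEmpty _
  · intro X _ ih hX I _ root c
    classical
    let σ : I ≃ {x // root x = none} ⊕ {x // ¬ root x = none} := (Equiv.sumCompl _).symm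
    let a : Option X ≃ Unit ⊕ X :=
      { toFun := fun | none => .inl () | some x => .inr x
        invFun := fun | .inl _ => none | .inr x => some x
        left_inv := by rintro (_ | _) <;> rfl
        right_inv := by rintro (_ | _) <;> rfl }
    refine ((determined_star_unit fun x : {x // root x = none} => c x).union
      (ih inferInstance {x // ¬ root x = none} inferInstance
        (fun x => (root x.1).get (Option.isSome_iff_ne_none.2 x.2)) fun x => c x)).of_similar σ
      (Equiv.emptySum _ _).symm a σ (Equiv.emptySum Empty Empty).symm σ
      ((Equiv.emptySum Empty Empty).symm.prodCongr (.refl _)) (σ.prodCongr (.refl _))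
      (fun x => rfl) (fun x => rfl) ?_ ?_ ?_ ?_
    · intro x
      change Sum.map (fun _ => ()) (fun x : {x // ¬ root x = none} =>
        (root x.1).get (Option.isSome_iff_ne_none.2 x.2)) (σ x) = a (root x)
      by_cases hx : root x = none
      · rw [Equiv.sumCompl_symm_apply_of_pos (p := fun x => root x = none) hx, hx]
        rfl
      · rw [Equiv.sumCompl_symm_apply_of_neg (p := fun x => root x = none) hx]
        exact congrArg a (Option.some_get (Option.isSome_iff_ne_none.2 hx))
    · rintro (_ | _) <;> rfl
    · intro x
      change Sum.elim (fun x : {x // root x = none} => c x.1)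
        (fun x : {x // ¬ root x = none} => c x.1) (σ x) = c x
      by_cases hx : root x = none
      · rw [Equiv.sumCompl_symm_apply_of_pos (p := fun x => root x = none) hx]
        rfl
      · rw [Equiv.sumCompl_symm_apply_of_neg (p := fun x => root x = none) hx]
        rfl
    · have key : ∀ (y : {x // root x = none} ⊕ {x // ¬ root x = none}) (b : Bool),
          ((Cob.star (fun _ => ()) fun x : {x // root x = none} => c x).union
            (Cob.star (fun x : {x // ¬ root x = none} =>
              (root x.1).get (Option.isSome_iff_ne_none.2 x.2)) fun x => c x)).ends (y, b) =
          cond b (.inl y) (.inr (.inr (.inl y))) := by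
        rintro (y | y) (_ | _) <;> rfl
      rintro ⟨x, _ | _⟩
      · exact key (σ x) false
      · exact key (σ x) true

/-- Once all marks are incoming, a joint-free family of edges is a disjoint union of caps, one for
each edge. The nondegenerate pairing then undoes the folding. -/
theorem determined_cutEdges {I : Type} [Finite I] {c : I → Nbar N}
    (Γ : Cob c (emptyObj : Empty → Nbar N)) [Finite Γ.Flag] [IsEmpty Γ.Joint] :
    Determined Γ.cutEdges := by
  refine Determined.of_fold ?_ (determined_fold_idCob _)
  have := Γ.finite_edge
  let φ : I ⊕ Γ.Flag ≃ Γ.cutEdges.Flag ⊕ (Γ.Joint × Bool) ⊕ (I ⊕ Γ.Flag) :=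
    (Equiv.emptySum (Γ.Joint × Bool) _).symm.trans (Equiv.emptySum Empty _).symm
  let β : Γ.Edge × Bool ≃ Γ.Edge ⊕ Γ.Edge :=
    { toFun := fun | (x, false) => .inl x | (x, true) => .inr x
      invFun := fun | .inl x => (x, false) | .inr x => (x, true)
      left_inv := by rintro ⟨_, _ | _⟩ <;> rfl
      right_inv := by rintro (_ | _) <;> rfl }
  -- Without vertices and joints, every edge end is a mark; this bijection matches the marks with
  -- the two ends of the caps.
  let σ : I ⊕ Γ.Flag ≃ Γ.Edge ⊕ Γ.Edge := φ.trans (Γ.cutEdges.ends.symm.trans β)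
  refine (determined_fold_idCob Γ.dir).of_similar σ (.refl _) (.refl _) (.refl _)
    (Equiv.equivOfIsEmpty Γ.Joint Empty) (.refl _) (Equiv.equivOfIsEmpty (Γ.Joint × Bool) (Empty × Bool))
    (.refl _) (fun x => isEmptyElim (α := Γ.Joint) x.1) (fun x => rfl)
    (fun v => Empty.elim v) (fun v => Empty.elim v) (fun _ => rfl) ?_
  rintro ⟨x, b⟩
  change (Cob.idCob Γ.dir).fold.ends (x, b) = Sum.map id (Sum.map _ (Sum.map σ id))
    (Sum.map id (Sum.map id Sum.inl) (Γ.cutEdges.ends (x, b)))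
  rcases hy : Γ.cutEdges.ends (x, b) with v | j | m
  · exact Empty.elim v
  · exact isEmptyElim (α := Γ.Joint) j.1
  · have hm : σ m = β (x, b) := by
      change β (Γ.cutEdges.ends.symm (.inr (.inr m))) = _
      exact (congrArg (fun z => β (Γ.cutEdges.ends.symm z)) hy.symm).trans
        (congrArg β (Γ.cutEdges.ends.symm_apply_apply (x, b)))
    have h1 : (Cob.idCob Γ.dir).fold.ends (x, b) = .inr (.inr (.inl (β (x, b)))) := by
      cases b <;> rfl
    exact h1.trans (congrArg (fun m => Sum.inr (Sum.inr (Sum.inl m))) hm.symm)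

/-- A joint-free cobordism of genus `0` without outgoing marks is determined. -/
theorem determined_of_genus {I : Type} [Finite I] {c : I → Nbar N}
    (Γ : Cob c (emptyObj : Empty → Nbar N)) [IsEmpty Γ.Joint] (hg : ∀ v, Γ.genus v = 0) :
    Determined Γ := by
  have := Γ.finite_flag
  have := Γ.finite_vert
  exact ((determined_cutEdges Γ).comp (determined_star Γ.root _)).congr
    (Γ.cutEdges_comp_equivalent hg)

end Generation

/-! ### Lattice bases, primitive vectors and annihilators -/

section Lattices

open ExteriorAlgebra Module

variable {N : Type u} [AddCommGroup N]

/-- The rational basis of `M ⊗ ℚ` dual to a lattice basis. -/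
def ratBasis {ι : Type*} [Finite ι] (ν : Basis ι ℤ N) : Basis ι ℚ (N →ₗ[ℤ] ℚ) :=
  (Pi.basisFun ℚ _).map (ν.constr ℚ)

theorem ratBasis_apply {ι : Type*} [Finite ι] [DecidableEq ι] (ν : Basis ι ℤ N) (i j) :
    ratBasis ν i (ν j) = if i = j then 1 else 0 := by
  simp [ratBasis, Pi.single_apply, eq_comm]

theorem ratBasis_repr {ι : Type*} [Finite ι] (ν : Basis ι ℤ N) (m : N →ₗ[ℤ] ℚ) (i) :
    (ratBasis ν).repr m i = m (ν i) := by
  simp [ratBasis]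

theorem ratBasis_det {ι : Type*} [Fintype ι] [DecidableEq ι] (ν : Basis ι ℤ N)
    (a : ι → (N →ₗ[ℤ] ℚ)) : (ratBasis ν).det a = (Matrix.of fun i j => a j (ν i)).det := by
  rw [Basis.det_apply]
  congr 1

/-- A change of lattice bases has integral determinant `± 1`, so squared volumes do not depend on
the lattice basis. -/
theorem ratBasis_det_ratBasis_sq {ι : Type*} [Fintype ι] [DecidableEq ι] (ν ν' : Basis ι ℤ N) :
    (ratBasis ν).det (ratBasis ν') ^ 2 = 1 := by
  have h1 : (ratBasis ν).det (ratBasis ν') = ((ν'.det ν : ℤ) : ℚ) := by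
    rw [ratBasis_det, Basis.det_apply, Int.cast_det, ← Matrix.det_transpose]
    congr 1
    ext i j
    have h := ν'.sum_repr (ν j)
    simp only [Matrix.transpose_apply, Matrix.of_apply, Matrix.map_apply, Basis.toMatrix_apply]
    conv_lhs => rw [← h, map_sum]
    simp [ratBasis_apply]
  rw [h1]
  rcases Int.isUnit_iff.1 (ν'.isUnit_det ν) with h | h <;> rw [h] <;> norm_num

variable [Module.Free ℤ N] [Module.Finite ℤ N]

theorem trZero_ratBasis {k : ℕ} (ν : Basis (Fin k) ℤ N) :
    trZero ((List.ofFn (ratBasis ν)).map (sqv zeroFst zeroSnd)).prod = 1 := by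
  have hk : k = finrank ℤ N := by rw [finrank_eq_card_basis ν, Fintype.card_fin]
  subst hk
  rw [trZero_sq]
  exact ratBasis_det_ratBasis_sq (finBasis ℤ N) ν

theorem trZero_sq_eq_det {k : ℕ} (ν : Basis (Fin k) ℤ N) (a : Fin k → (N →ₗ[ℤ] ℚ)) :
    trZero ((List.ofFn a).map (sqv zeroFst zeroSnd)).prod =
      (Matrix.of fun i j => a j (ν i)).det ^ 2 := by
  rw [list_ofFn_sqv_eq_det _ _ (ratBasis ν), map_smul, trZero_ratBasis, smul_eq_mul, mul_one,
    ratBasis_det]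

theorem exists_predual_basis {k : ℕ} (B : Basis (Fin k) ℤ (Dual ℤ N)) :
    ∃ ν : Basis (Fin k) ℤ N, ∀ i j, B i (ν j) = if i = j then 1 else 0 := by
  refine ⟨B.dualBasis.map (evalEquiv ℤ N).symm, fun i j => ?_⟩
  have h : Dual.eval ℤ N ((evalEquiv ℤ N).symm (B.dualBasis j)) = B.dualBasis j :=
    (evalEquiv ℤ N).apply_symm_apply _
  have h2 := LinearMap.congr_fun h (B i)
  rw [B.dualBasis_apply_self] at h2
  simpa using h2

/-- The values of integral forms on `n` make up an ideal generated by some `g`. All coordinates of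
`n` are divisible by `g`, so primitivity forces `g` to be a unit. -/
theorem IsPrimitiveVector.exists_dual {n : N} (hn : IsPrimitiveVector N n) :
    ∃ p : Dual ℤ N, p n = 1 := by
  obtain ⟨g, hg⟩ := (IsPrincipalIdealRing.principal (LinearMap.range (Dual.eval ℤ N n))).principal
  have hdvd : ∀ f : Dual ℤ N, g ∣ f n := by
    intro f
    have : f n ∈ LinearMap.range (Dual.eval ℤ N n) := ⟨f, rfl⟩
    rw [hg] at this
    obtain ⟨a, ha⟩ := Submodule.mem_span_singleton.1 this
    exact ⟨a, by rw [← ha, smul_eq_mul, mul_comm]⟩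
  choose q hq using fun i => hdvd ((finBasis ℤ N).coord i)
  have hv : n = g.natAbs • (g.sign • ∑ i, q i • finBasis ℤ N i) := by
    rw [← natCast_zsmul, smul_smul, mul_comm, Int.sign_mul_natAbs, Finset.smul_sum]
    conv_lhs => rw [← (finBasis ℤ N).sum_repr n]
    refine Finset.sum_congr rfl fun i _ => ?_
    rw [smul_smul, ← hq]
    rfl
  have h1 := hn.2 _ _ hv
  have hu : IsUnit g := Int.natAbs_eq_iff_associated.1 (h1.trans (by simp : (1 : ℤ).natAbs = 1).symm)
    |>.symm.isUnit isUnit_one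
  have : (1 : ℤ) ∈ LinearMap.range (Dual.eval ℤ N n) := by
    rw [hg]
    exact Ideal.mem_span_singleton.2 hu.dvd
  exact this

/-- The intersection of `N` with a real subspace is saturated, as nonzero integers are invertible in
`ℝ`. -/
theorem isTorsionFree_quotient_latticePart (W : Submodule ℝ (ℝ ⊗[ℤ] N)) :
    IsTorsionFree ℤ (N ⧸ latticePart W) := by
  rw [Module.isTorsionFree_iff_smul_eq_zero]
  intro k x hx
  obtain ⟨n, rfl⟩ := Submodule.Quotient.mk_surjective _ x
  rw [← Submodule.Quotient.mk_smul, Submodule.Quotient.mk_eq_zero] at hx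
  rw [Submodule.Quotient.mk_eq_zero]
  by_cases hk : k = 0
  · exact .inl hk
  · right
    have h1 : (1 : ℝ) ⊗ₜ[ℤ] (k • n) ∈ W := hx
    have h2 : (1 : ℝ) ⊗ₜ[ℤ] n = (k : ℝ)⁻¹ • ((1 : ℝ) ⊗ₜ[ℤ] (k • n)) := by
      rw [TensorProduct.tmul_smul, ← Int.cast_smul_eq_zsmul ℝ, smul_smul, inv_mul_cancel₀
        (Int.cast_ne_zero.2 hk), one_smul]
    change (1 : ℝ) ⊗ₜ[ℤ] n ∈ W
    rw [h2]
    exact W.smul_mem _ h1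

/-- A lattice basis of the annihilator gives coordinates of the quotient. -/
theorem exists_quotient_equiv (W : Submodule ℝ (ℝ ⊗[ℤ] N)) {d : ℕ}
    (m : Basis (Fin d) ℤ (annLattice W)) :
    ∃ φ : (N ⧸ latticePart W) ≃ₗ[ℤ] (Fin d → ℤ),
      ∀ n j, φ (Submodule.Quotient.mk n) j = (m j : Dual ℤ N) n := by
  have := isTorsionFree_quotient_latticePart W
  have : Module.Free ℤ (N ⧸ latticePart W) := Module.free_of_finite_type_torsion_free'
  let m' : Basis (Fin d) ℤ (Dual ℤ (N ⧸ latticePart W)) :=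
    m.map (latticePart W).dualQuotEquivDualAnnihilator.symm
  refine ⟨(evalEquiv ℤ _).trans (m'.constr ℤ).symm, fun n j => ?_⟩
  change (m'.constr ℤ).symm (evalEquiv ℤ _ (Submodule.Quotient.mk n)) j = _
  have : (m'.constr ℤ).symm (evalEquiv ℤ _ (Submodule.Quotient.mk n)) j =
      (evalEquiv ℤ _ (Submodule.Quotient.mk n)) (m' j) := rfl
  rw [this]
  change (latticePart W).dualQuotEquivDualAnnihilator.symm (m j) (Submodule.Quotient.mk n) = _
  exact Submodule.dualQuotEquivDualAnnihilator_symm_apply_mk _ _ _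

/-- By flatness, `ℝ ⊗ (W ∩ N)` embeds in `ℝ ⊗ N`, and rational slope says that its image is all of
`W`. Hence the rank of the annihilator lattice is the real codimension. -/
theorem card_add_finrank_of_span {W : Submodule ℝ (ℝ ⊗[ℤ] N)}
    (hW : Submodule.span ℝ (toReal '' (latticePart W : Set N)) = W) {d : ℕ}
    (m : Basis (Fin d) ℤ (annLattice W)) : d + finrank ℝ W = finrank ℤ N := by
  obtain ⟨φ, -⟩ := exists_quotient_equiv W m
  have h1 := (latticePart W).finrank_quotient_add_finrank
  rw [φ.finrank_eq, finrank_fin_fun] at h1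
  rw [← h1]
  congr 1
  let f : (ℝ ⊗[ℤ] latticePart W) →ₗ[ℝ] ℝ ⊗[ℤ] N := (latticePart W).subtype.baseChange ℝ
  have hf : Function.Injective f :=
    Module.Flat.lTensor_preserves_injective_linearMap (M := ℝ) (latticePart W).subtype
      Subtype.val_injective
  have hr : LinearMap.range f = W := by
    refine le_antisymm ?_ ?_
    · rintro _ ⟨x, rfl⟩
      induction x using TensorProduct.induction_on with
      | zero => rw [map_zero]; exact W.zero_mem
      | tmul a n =>
        have hn : (1 : ℝ) ⊗ₜ[ℤ] (n : N) ∈ W := n.2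
        have h2 : f (a ⊗ₜ n) = a • ((1 : ℝ) ⊗ₜ[ℤ] (n : N)) := by
          simp [f, TensorProduct.smul_tmul']
        rw [h2]
        exact W.smul_mem _ hn
      | add x y hx hy => rw [map_add]; exact W.add_mem hx hy
    · conv_lhs => rw [← hW]
      refine Submodule.span_le.2 ?_
      rintro _ ⟨n, hn, rfl⟩
      exact ⟨1 ⊗ₜ ⟨n, hn⟩, by simp [f, toReal]⟩
  rw [← finrank_baseChange (R := ℝ) (S := ℤ) (M' := latticePart W), ← LinearMap.finrank_range_of_inj hf,
    hr]

theorem mem_latticePart_span (n : N) : n ∈ latticePart (Submodule.span ℝ {toReal n}) :=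
  Submodule.mem_span_singleton_self _

theorem mem_annLattice_span {n : N} {f : Dual ℤ N} :
    f ∈ annLattice (Submodule.span ℝ {toReal n}) ↔ f n = 0 := by
  constructor
  · intro h
    exact (Submodule.mem_dualAnnihilator f).1 h n (mem_latticePart_span n)
  · intro h
    refine (Submodule.mem_dualAnnihilator f).2 fun x hx => ?_
    obtain ⟨t, ht⟩ := Submodule.mem_span_singleton.1 (show (1 : ℝ) ⊗ₜ[ℤ] x ∈ _ from hx)
    have h2 := congrArg (TensorProduct.rid ℤ ℝ ∘ LinearMap.baseChange ℝ f) ht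
    simp only [Function.comp, toReal, map_smul, LinearMap.baseChange_tmul, h] at h2
    simpa using h2.symm

/-- A primitive vector and a lattice basis of its annihilator come from a lattice basis. -/
theorem IsPrimitiveVector.exists_basis {n : N} (hn : IsPrimitiveVector N n) {k : ℕ}
    (m : Basis (Fin k) ℤ (annLattice (Submodule.span ℝ {toReal n}))) :
    ∃ ν : Basis (Fin (k + 1)) ℤ N, ν 0 = n ∧
      ∀ i j, (m j : Dual ℤ N) (ν i) = if i = j.succ then 1 else 0 := by
  obtain ⟨p, hp⟩ := hn.exists_dual
  -- Since `p n = 1`, every integral form is a multiple of `p` plus a form vanishing on `n`, so `p`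
  -- and `m` together form a basis of the dual lattice.
  let B : Basis (Fin (k + 1)) ℤ (Dual ℤ N) := Basis.mkFinCons p m
    (fun c x hx h => by
      have h1 := LinearMap.congr_fun h n
      simpa [hp, mem_annLattice_span.1 hx] using h1)
    (fun z => ⟨-z n, mem_annLattice_span.2 (by simp [hp])⟩)
  have hB : ⇑B = Fin.cons p (fun j => (m j : Dual ℤ N)) := Basis.coe_mkFinCons _ _ _ _
  obtain ⟨ν, hν⟩ := exists_predual_basis B
  -- The first predual basis vector and `n` have the same values on `B`, so reflexivity identifies
  -- them.
  have h0 : ∀ f : Dual ℤ N, f (ν 0) = f n := by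
    intro f
    have : Dual.eval ℤ N (ν 0) = Dual.eval ℤ N n := B.ext fun i => by
      change B i (ν 0) = B i n
      rw [hν]
      refine Fin.cases ?_ (fun j => ?_) i
      · rw [hB, if_pos rfl]; exact hp.symm
      · rw [hB, if_neg (Fin.succ_ne_zero j)]
        exact (mem_annLattice_span.1 (m j).2).symm
    exact LinearMap.congr_fun this f
  refine ⟨ν, (evalEquiv ℤ N).injective (LinearMap.ext h0), fun i j => ?_⟩
  have := hν j.succ i
  rw [hB, Fin.cons_succ] at this
  rw [this]
  simp only [eq_comm]

theorem toRat_mem_perp {n : N} {f : Dual ℤ N} (h : f n = 0) (w : ℕ) :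
    toRat f ∈ perp (Nbar.mk (w • n)) := by
  rw [mem_perp_mk]
  simp [toRat, h]

/-- The trace uses a form `p` with `p(w n) = 1`, hence `p(n) = 1/w`. In an adapted lattice basis the
matrix is triangular with diagonal `1/w, 1, …, 1`, and its determinant enters squared. This is the
source of the edge weights. -/
theorem tr_list_sqv {n : N} (hn : IsPrimitiveVector N n) {w : ℕ} (hw : 0 < w) {k : ℕ}
    (m : Basis (Fin k) ℤ (annLattice (Submodule.span ℝ {toReal n}))) :
    tr (Nbar.mk (w • n)) ((List.ofFn fun j => (⟨toRat (m j), toRat_mem_perp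
      (mem_annLattice_span.1 (m j).2) w⟩ : perp (Nbar.mk (w • n)))).map
      (sqv (dblFst _) (dblSnd _))).prod = ((w : ℚ) ^ 2)⁻¹ := by
  obtain ⟨ν, h0, hν⟩ := hn.exists_basis m
  have hwn : w • n ≠ 0 := by
    rw [← natCast_zsmul]
    exact smul_ne_zero (by exact_mod_cast hw.ne') hn.1
  obtain ⟨p, hp, htr⟩ := exists_tr_eq (w • n) hwn
  have hw' : (w : ℚ) ≠ 0 := by exact_mod_cast hw.ne'
  have hp' : p n = (w : ℚ)⁻¹ := by
    rw [map_nsmul, nsmul_eq_mul] at hp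
    exact eq_inv_of_mul_eq_one_right hp
  rw [htr, kappa_list_sqv, List.map_ofFn (g := (perp _).subtype), ← List.prod_cons, ← List.map_cons,
    ← List.ofFn_cons, trZero_sq_eq_det ν, Matrix.det_of_isLowerTriangular, Fin.prod_univ_succ]
  · simp [h0, hp', toRat, hν]
  · intro i j hij
    have hij' : i < j := hij
    obtain ⟨j, rfl⟩ := Fin.exists_succ_eq.2 (Fin.ne_zero_of_lt hij')
    simp [toRat, hν, hij'.ne]

theorem ι_list_eq_smul_topElt {c : Nbar N} (l : List (Dbl c)) (hl : l.length = finrank ℚ (Dbl c)) :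
    (l.map (ι ℚ)).prod = tr c (l.map (ι ℚ)).prod • topElt c := by
  have h1 : (l.map (ι ℚ)).prod = ιMulti ℚ (finrank ℚ (Dbl c)) fun i => l.get (i.cast hl.symm) := by
    rw [ιMulti_eq_list]
    congr 2
    exact List.ext_get (by simp [hl]) fun i h1 h2 => by simp
  rw [h1, ιMulti_eq_det_smul (dblBasis c), map_smul, topElt, ← ιMulti_eq_list, smul_eq_mul, smul_smul,
    mul_assoc]
  change _ = ((dblBasis c).det _ * (volScale c * (volScale c)⁻¹)) • _
  rw [mul_inv_cancel₀ (volScale_ne_zero c), mul_one]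

theorem list_sqv_eq_smul_topElt {c : Nbar N} {k : ℕ} (hk : k = finrank ℚ (perp c))
    (a : Fin k → perp c) :
    ((List.ofFn a).map (sqv (dblFst c) (dblSnd c))).prod =
      tr c ((List.ofFn a).map (sqv (dblFst c) (dblSnd c))).prod • topElt c := by
  rw [list_sqv, map_list, map_list, ← List.prod_append, ← List.map_append, map_smul, smul_eq_mul,
    mul_smul, ← ι_list_eq_smul_topElt]
  rw [finrank_dbl, ← hk]
  simp [mul_two]

end Lattices

/-! ### Lattice index as a determinant -/

section Index

open Module

/-- The singular case must give index `0`, the value for infinite index. If the index `n` were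
nonzero, then `n • id` would factor through `f`, contradicting `det f = 0`. -/
theorem index_range_eq_natAbs_det {M : Type*} [AddCommGroup M] [Module.Free ℤ M]
    [Module.Finite ℤ M] (f : M →ₗ[ℤ] M) :
    (LinearMap.range f).toAddSubgroup.index = (LinearMap.det f).natAbs := by
  by_cases h : LinearMap.det f = 0
  · rw [h, Int.natAbs_zero]
    by_contra hi
    set n := (LinearMap.range f).toAddSubgroup.index with hn
    have hmem : ∀ x : M, ∃ y, f y = (n : ℤ) • x := fun x => by
      rw [natCast_zsmul]
      exact AddSubgroup.nsmul_index_mem (LinearMap.range f).toAddSubgroup x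
    choose y hy using hmem
    let b := finBasis ℤ M
    let g : M →ₗ[ℤ] M := b.constr ℤ fun i => y (b i)
    have hfg : f ∘ₗ g = (n : ℤ) • LinearMap.id := b.ext fun i => by simp [g, hy]
    have h1 := congrArg LinearMap.det hfg
    rw [LinearMap.det_comp, h, zero_mul, LinearMap.det_smul, LinearMap.det_id, mul_one] at h1
    exact pow_ne_zero _ (Int.natCast_ne_zero.2 hi) h1.symm
  · have hf : Function.Injective f := by
      rw [← LinearMap.ker_eq_bot]
      by_contra hk
      exact h (LinearMap.det_eq_zero_iff_ker_ne_bot.2 hk)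
    exact (Submodule.natAbs_det_equiv (LinearMap.range f) (LinearEquiv.ofInjective f hf)).symm

theorem index_range_eq {ι : Type*} [Fintype ι] [DecidableEq ι] {M P : Type*} [AddCommGroup M]
    [AddCommGroup P] (b : Basis ι ℤ M) (φ : P ≃ₗ[ℤ] (ι → ℤ)) (f : M →ₗ[ℤ] P) :
    (LinearMap.range f).toAddSubgroup.index =
      (Matrix.of fun i j => φ (f (b j)) i).det.natAbs := by
  have := Module.Free.of_basis b
  have := Module.Finite.of_basis b
  let e : P ≃ₗ[ℤ] M := φ.trans b.equivFun.symm
  have h1 : (LinearMap.range (e.toLinearMap ∘ₗ f)).toAddSubgroup =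
      (LinearMap.range f).toAddSubgroup.map e.toAddEquiv.toAddMonoidHom := by
    ext x
    simp [AddSubgroup.mem_map]
  have h2 := index_range_eq_natAbs_det (e.toLinearMap ∘ₗ f)
  rw [h1] at h2
  refine ((LinearMap.range f).toAddSubgroup.index_map_equiv e.toAddEquiv).symm.trans (h2.trans ?_)
  rw [← LinearMap.det_toMatrix b]
  congr 2
  ext i j
  rw [LinearMap.toMatrix_apply]
  change b.equivFun (b.equivFun.symm (φ (f (b j)))) i = _
  rw [LinearEquiv.apply_symm_apply]
  rfl

end Index

/-! ### Products of squares over arbitrary finite index sets -/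

section SquareProducts

open ExteriorAlgebra Module

variable {W W' : Type*} [AddCommGroup W] [Module ℚ W] [AddCommGroup W'] [Module ℚ W']

section

variable {E : Type*} (f : E → ExteriorAlgebra ℚ W) (hf : ∀ e, IsCentral (f e))

theorem list_ofFn_prod_eq_centralProd {k : ℕ} (f : Fin k → ExteriorAlgebra ℚ W)
    (hf : ∀ e, IsCentral (f e)) : (List.ofFn f).prod = centralProd f hf := by
  rw [centralProd_eq, ← List.prod_ofFn]
  change _ = (Subalgebra.center ℚ (ExteriorAlgebra ℚ W)).val _
  rw [map_list_prod, List.map_ofFn]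
  rfl

theorem toList_prod_eq_centralProd [Fintype E] :
    ((Finset.univ.toList (α := E)).map f).prod = centralProd f hf := by
  rw [centralProd_eq, ← Finset.prod_map_toList]
  change _ = (Subalgebra.center ℚ (ExteriorAlgebra ℚ W)).val _
  rw [map_list_prod, List.map_map]
  rfl

theorem centralProd_smul [Fintype E] (s : E → ℚ) (h : ∀ e, IsCentral (s e • f e)) :
    centralProd (fun e => s e • f e) h = (∏ e, s e) • centralProd f hf := by
  rw [centralProd_eq, centralProd_eq]
  have : ∀ e, (⟨s e • f e, h e⟩ : Subalgebra.center ℚ (ExteriorAlgebra ℚ W)) =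
      algebraMap ℚ _ (s e) * ⟨f e, hf e⟩ := fun e => by
    rw [← Algebra.smul_def]; rfl
  rw [Finset.prod_congr rfl fun _ _ => this _, Finset.prod_mul_distrib, ← map_prod, ← Algebra.smul_def]
  rfl

theorem centralProd_sigma [Finite E] {k : E → Type*} [∀ e, Finite (k e)]
    (g : (e : E) → k e → ExteriorAlgebra ℚ W) (hg : ∀ e j, IsCentral (g e j)) :
    centralProd (fun x : Σ e, k e => g x.1 x.2) (fun x => hg x.1 x.2) =
      centralProd (fun e => centralProd (g e) (hg e)) fun _ => centralProd_central _ _ := by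
  have := Fintype.ofFinite E
  have := fun e => Fintype.ofFinite (k e)
  rw [centralProd_eq, centralProd_eq, ← Finset.univ_sigma_univ, Finset.prod_sigma]
  congr 1
  refine Finset.prod_congr rfl fun e _ => Subtype.ext ?_
  exact (centralProd_eq _ _).symm

end

variable {K : Type*} [Finite K] {U : Type*} [AddCommGroup U] [Module ℚ U]

/-- The product of a family of squares. -/
def sqvProd (j₁ j₂ : U →ₗ[ℚ] W) (a : K → U) : ExteriorAlgebra ℚ W :=
  centralProd (fun k => sqv j₁ j₂ (a k)) fun _ => sqv_central _ _ _

theorem list_ofFn_map_sqv {k : ℕ} (j₁ j₂ : U →ₗ[ℚ] W) (a : Fin k → U) :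
    ((List.ofFn a).map (sqv j₁ j₂)).prod = sqvProd j₁ j₂ a := by
  rw [List.map_ofFn]
  exact list_ofFn_prod_eq_centralProd _ _

theorem sqvProd_central (j₁ j₂ : U →ₗ[ℚ] W) (a : K → U) : IsCentral (sqvProd j₁ j₂ a) :=
  centralProd_central _ _

theorem sqvProd_reindex {K' : Type*} [Finite K'] (σ : K' ≃ K) (j₁ j₂ : U →ₗ[ℚ] W) (a : K → U) :
    sqvProd j₁ j₂ (a ∘ σ) = sqvProd j₁ j₂ a :=
  centralProd_equiv _ _ _ σ fun _ => rfl

theorem map_sqvProd (T : W →ₗ[ℚ] W') (j₁ j₂ : U →ₗ[ℚ] W) (a : K → U) :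
    map T (sqvProd j₁ j₂ a) = sqvProd (T ∘ₗ j₁) (T ∘ₗ j₂) a := by
  unfold sqvProd
  rw [map_centralProd _ _ _ fun k => by rw [map_sqv]; exact sqv_central _ _ _]
  congr 1
  funext k
  exact map_sqv _ _ _ _

theorem sqvProd_comp {U' : Type*} [AddCommGroup U'] [Module ℚ U'] (T : U' →ₗ[ℚ] U)
    (j₁ j₂ : U →ₗ[ℚ] W) (a : K → U') :
    sqvProd (j₁ ∘ₗ T) (j₂ ∘ₗ T) a = sqvProd j₁ j₂ fun k => T (a k) := rfl

theorem sqvProd_sigma {E : Type*} [Finite E] {k : E → Type*} [∀ e, Finite (k e)]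
    (j₁ j₂ : U →ₗ[ℚ] W) (a : (e : E) → k e → U) :
    sqvProd j₁ j₂ (fun x : Σ e, k e => a x.1 x.2) =
      centralProd (fun e => sqvProd j₁ j₂ (a e)) fun _ => sqvProd_central _ _ _ :=
  centralProd_sigma (fun e j => sqv j₁ j₂ (a e j)) fun _ _ => sqv_central _ _ _

theorem sqvProd_sum {K' : Type*} [Finite K'] (j₁ j₂ : U →ₗ[ℚ] W) (a : K → U) (a' : K' → U) :
    sqvProd j₁ j₂ (Sum.elim a a') = sqvProd j₁ j₂ a * sqvProd j₁ j₂ a' :=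
  centralProd_sum _ _ (Equiv.refl _)

theorem sqvProd_eq_det {K : Type*} [Fintype K] [DecidableEq K] (j₁ j₂ : U →ₗ[ℚ] W) (B : Basis K ℚ U)
    (a : K → U) : sqvProd j₁ j₂ a = B.det a ^ 2 • sqvProd j₁ j₂ B := by
  let σ := (Fintype.equivFin K).symm
  rw [← sqvProd_reindex σ, ← sqvProd_reindex σ j₁ j₂ B, ← list_ofFn_map_sqv, ← list_ofFn_map_sqv,
    list_ofFn_sqv_eq_det _ _ (B.reindex σ.symm), Basis.det_reindex]
  have h1 : ⇑(B.reindex σ.symm) = B ∘ σ := by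
    funext k; simp
  have h2 : (a ∘ σ) ∘ σ.symm = a := by funext k; simp
  rw [h1, h2]

/-- More vectors than the dimension are linearly dependent, so already their wedge product vanishes
in each copy. -/
theorem sqvProd_eq_zero [FiniteDimensional ℚ U] {K : Type*} [Fintype K]
    (h : finrank ℚ U < Fintype.card K) (j₁ j₂ : U →ₗ[ℚ] W) (a : K → U) : sqvProd j₁ j₂ a = 0 := by
  let σ := (Fintype.equivFin K).symm
  rw [← sqvProd_reindex σ, ← list_ofFn_map_sqv, list_ofFn_sqv,
    AlternatingMap.map_linearDependent _ _ fun hi => ?_, map_zero, zero_mul, smul_zero]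
  have := hi.fintype_card_le_finrank
  rw [Fintype.card_fin] at this
  omega

end SquareProducts

/-! ### Integration over the positions of the vertices -/

section VertexIntegral

open ExteriorAlgebra Module

variable {N : Type u} [AddCommGroup N] [Module.Free ℤ N] [Module.Finite ℤ N]

/-- The auxiliary normalization of `topElt` agrees with the lattice normalization, because both
elements have trace 1. -/
theorem topElt_zero : topElt (Nbar.zero : Nbar N) = sqvProd zeroFst zeroSnd (latBasis N) := by
  have h := list_sqv_eq_smul_topElt (c := (Nbar.zero : Nbar N)) finrank_perp_zero.symm
    fun i => toZero (latBasis N i)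
  have h2 : ((List.ofFn fun i => (toZero (latBasis N i) : perp (Nbar.zero : Nbar N))).map
      (sqv (dblFst _) (dblSnd _))).prod =
      ((List.ofFn (latBasis N)).map (sqv zeroFst zeroSnd)).prod := by
    rw [List.map_ofFn, List.map_ofFn]
    rfl
  rw [h2, tr_zero_apply, trZero_latBasis, one_smul] at h
  rw [← h, list_ofFn_map_sqv]

variable (N) (V : Type) [Fintype V]

/-- `(m_v)_v ↦ ((m_v, 0))_v`. -/
def piFst : (V → (N →ₗ[ℤ] ℚ)) →ₗ[ℚ] (V → Dbl (Nbar.zero : Nbar N)) := zeroFst.compLeft V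

/-- `(m_v)_v ↦ ((0, m_v))_v`. -/
def piSnd : (V → (N →ₗ[ℤ] ℚ)) →ₗ[ℚ] (V → Dbl (Nbar.zero : Nbar N)) := zeroSnd.compLeft V

/-- The integral over the positions of all vertices. -/
def vertexIntegral : ExteriorAlgebra ℚ (V → Dbl (Nbar.zero : Nbar N)) →ₗ[ℚ] ℚ :=
  eps.toLinearMap ∘ₗ act (volProd fun v : V =>
    LinearMap.proj (R := ℚ) (φ := fun _ : V => Dbl (Nbar.zero : Nbar N)) v)

-- The product of the squares of this basis is the product of the delta functions at all vertices;
-- integrating it substitutes zero everywhere and leaves 1.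
open Classical in
theorem vertexIntegral_basis :
    vertexIntegral N V (sqvProd (piFst N V) (piSnd N V) (Pi.basis fun _ : V => latBasis N)) = 1 := by
  let W := V → Dbl (Nbar.zero : Nbar N)
  let π : ∀ v : V, W →ₗ[ℚ] Dbl (Nbar.zero : Nbar N) := fun v =>
    LinearMap.proj (R := ℚ) (φ := fun _ : V => Dbl (Nbar.zero : Nbar N)) v
  let δ : ∀ v : V, Dbl (Nbar.zero : Nbar N) →ₗ[ℚ] W := fun v =>
    LinearMap.single ℚ (fun _ : V => Dbl (Nbar.zero : Nbar N)) v
  have hk : kernelOp δ π 1 = map (0 : W →ₗ[ℚ] W) 1 := by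
    refine kernelOp_delta δ π δ (fun _ => rfl) ?_ ?_ 0 (fun x => LinearMap.zero_comp _) ?_ 1
    · exact fun v => LinearMap.ext fun x => Pi.single_eq_same (M := fun _ : V => _) v x
    · exact fun v v' h => LinearMap.ext fun x => Pi.single_eq_of_ne (M := fun _ : V => _) h x
    · intro w hw
      exact (funext hw : w = 0).symm
  rw [kernelOp_apply, mul_one, map_one] at hk
  have he : edgeProd δ =
      sqvProd (piFst N V) (piSnd N V) (Pi.basis fun _ : V => latBasis N) := by
    have h1 : (⇑(Pi.basis fun _ : V => latBasis N) : (Σ _ : V, Fin (finrank ℤ N)) → _) =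
        fun x : Σ _ : V, Fin (finrank ℤ N) =>
          (fun (v : V) i => (Pi.single v (latBasis N i) : V → (N →ₗ[ℤ] ℚ))) x.1 x.2 := by
      funext x
      exact Pi.basis_apply _ _
    rw [h1, sqvProd_sigma (piFst N V) (piSnd N V) fun (v : V) (i : Fin (finrank ℤ N)) =>
      (Pi.single v (latBasis N i) : V → (N →ₗ[ℤ] ℚ))]
    refine centralProd_equiv _ _ _ (Equiv.refl V) fun v => ?_
    rw [topElt_zero, map_sqvProd]
    have e1 : δ v ∘ₗ zeroFst = piFst N V ∘ₗ LinearMap.single ℚ _ v := by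
      refine LinearMap.ext fun m => funext fun v' => ?_
      exact (Pi.apply_single (fun _ => zeroFst (N := N)) (fun _ => map_zero _) v m v').symm
    have e2 : δ v ∘ₗ zeroSnd = piSnd N V ∘ₗ LinearMap.single ℚ _ v := by
      refine LinearMap.ext fun m => funext fun v' => ?_
      exact (Pi.apply_single (fun _ => zeroSnd (N := N)) (fun _ => map_zero _) v m v').symm
    rw [e1, e2]
    rfl
  rw [← he]
  change eps (act (volProd π) (edgeProd δ)) = 1
  rw [hk, map_one]

end VertexIntegral

/-! ### The integral of a tropical curve as an integral of squared linear forms -/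

section CurveIntegrals

open ExteriorAlgebra Module

variable {N : Type u} [AddCommGroup N] {V E I : Type} [Fintype V] [Fintype E] [Fintype I]

namespace CurveType

/-- The integral attached to a tropical curve, over the positions of its vertices. -/
abbrev diagram (τ : CurveType N V E I) : Diagram τ.obj (emptyObj : Empty → Nbar N) where
  Pt := V
  Edge := E
  Int := V
  finite_pt := inferInstance
  finite_edge := inferInstance
  finite_int := inferInstance
  pd _ := Nbar.zero
  ed e := Nbar.mk (τ.w e • τ.u e)
  en e b := if b then τ.tgt e else τ.src e
  ip := id
  src := τ.leg
  tgt _ := none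
  en_le _ _ := perp_le_perp_zero _
  src_le _ := perp_le_perp_zero _
  tgt_le _ _ h := nomatch h

end CurveType

variable [Module.Free ℤ N] [Module.Finite ℤ N]

namespace CurveType

/-- The incoming marks are integrated away along the non-compact edges, so only the vertices and the
compact edges remain. -/
theorem eval_diagram_cob (τ : CurveType N V E I) : τ.cob.diagram.eval = τ.diagram.eval := by
  refine Diagram.eval_eq_of_elim τ.cob.diagram τ.diagram (X := I) (Equiv.refl (E ⊕ I))
    (Equiv.sumCongr (Equiv.refl V) (Equiv.emptySum Empty I).symm : V ⊕ I ≃ V ⊕ Empty ⊕ I)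
    (Sum.elim id (Sum.elim (fun x : Empty => x.elim) (Sum.elim τ.leg fun x : Empty => x.elim)) :
      V ⊕ Empty ⊕ (I ⊕ Empty) → V)
    (Sum.inl : V → V ⊕ Empty ⊕ (I ⊕ Empty)) ?_ ?_ ?_ ?_ ?_ ?_ ?_ ?_ ?_ ?_ ?_ ?_
  · intro p; rfl
  · intro p; rfl
  · rintro (v | x | i | x)
    · exact .inl rfl
    · exact x.elim
    · exact .inr ⟨i, rfl⟩
    · exact x.elim
  · intro i
    exact ⟨false, rfl, rfl⟩
  · intro i; rfl
  · rintro i p h; cases h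
  · rintro i i' h; cases h; rfl
  · intro e; rfl
  · intro e
    refine ⟨false, fun b => ?_⟩
    cases b <;> rfl
  · intro v; rfl
  · intro i; rfl
  · intro v; rfl

theorem eval_diagram (τ : CurveType N V E I) (z : State τ.obj) :
    τ.diagram.eval z = algebraMap ℚ _
      (vertexIntegral N V (edgeProd τ.diagram.diff * map τ.diagram.inMap z)) := by
  have h : τ.diagram.outMap = 0 := LinearMap.ext fun _ => funext fun x => x.elim
  rw [Diagram.eval_apply, h, map_zero_apply]
  rfl

end CurveType

open Classical in
/-- A linear form on the position of the vertex `v`. -/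
def pointForm (v : V) (c : Nbar N) : perp c →ₗ[ℚ] (V → (N →ₗ[ℤ] ℚ)) :=
  LinearMap.single ℚ (fun _ : V => N →ₗ[ℤ] ℚ) v ∘ₗ (perp c).subtype

theorem wsingle_comp_dblFst (v : V) (c : Nbar N) :
    wsingle (fun _ : V => (Nbar.zero : Nbar N)) v c ∘ₗ dblFst c = piFst N V ∘ₗ pointForm v c := by
  classical
  refine LinearMap.ext fun m => funext fun v' => ?_
  rw [wsingle, incl_zero]
  have h := Pi.apply_single (fun _ : V => zeroFst (N := N)) (fun _ => map_zero _) v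
    (m : N →ₗ[ℤ] ℚ) v'
  refine Eq.trans ?_ (h.symm.trans ?_)
  · change Pi.single v _ v' = _
    congr!
  · change _ = zeroFst _
    congr!

theorem wsingle_comp_dblSnd (v : V) (c : Nbar N) :
    wsingle (fun _ : V => (Nbar.zero : Nbar N)) v c ∘ₗ dblSnd c = piSnd N V ∘ₗ pointForm v c := by
  classical
  refine LinearMap.ext fun m => funext fun v' => ?_
  rw [wsingle, incl_zero]
  have h := Pi.apply_single (fun _ : V => zeroSnd (N := N)) (fun _ => map_zero _) v
    (m : N →ₗ[ℤ] ℚ) v'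
  refine Eq.trans ?_ (h.symm.trans ?_)
  · change Pi.single v _ v' = _
    congr!
  · change _ = zeroSnd _
    congr!

namespace CurveType

variable (τ : CurveType N V E I)

theorem map_inMap_tensor (z : ∀ i, Frob (τ.obj i))
    (h : ∀ i, IsCentral (map (wsingle (fun _ : V => (Nbar.zero : Nbar N)) (τ.leg i) (τ.obj i)) (z i))) :
    map τ.diagram.inMap (tensor τ.obj z) = centralProd _ h := by
  rw [← toList_prod_eq_centralProd, tensor, map_list_prod, List.map_map]
  congr 1
  refine List.map_congr_left fun i _ => ?_
  rw [Function.comp, factor, map_map', ← τ.diagram.inMap_wsingle i (τ.obj i) le_rfl, wsingle, incl_self,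
    LinearMap.comp_id]

/-- The difference of a linear form at the two ends of an edge. -/
def edgeForm (e : E) : perp (Nbar.mk (τ.w e • τ.u e)) →ₗ[ℚ] (V → (N →ₗ[ℤ] ℚ)) :=
  pointForm (τ.tgt e) _ - pointForm (τ.src e) _

theorem diff_comp_dblFst (e : E) : τ.diagram.diff e ∘ₗ dblFst _ = piFst N V ∘ₗ τ.edgeForm e := by
  rw [edgeForm, LinearMap.comp_sub, ← wsingle_comp_dblFst, ← wsingle_comp_dblFst]
  rfl

theorem diff_comp_dblSnd (e : E) : τ.diagram.diff e ∘ₗ dblSnd _ = piSnd N V ∘ₗ τ.edgeForm e := by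
  rw [edgeForm, LinearMap.comp_sub, ← wsingle_comp_dblSnd, ← wsingle_comp_dblSnd]
  rfl

/-- The linear forms on the space of positions of the vertices that express that the edges are
parallel to given directions and that the ends match given constraints. -/
def forms {k : E → ℕ} (a : ∀ e, Fin (k e) → perp (Nbar.mk (τ.w e • τ.u e)))
    {d : I → ℕ} (m : ∀ i, Fin (d i) → perp (τ.obj i)) :
    (Σ e, Fin (k e)) ⊕ (Σ i, Fin (d i)) → V → (N →ₗ[ℤ] ℚ) :=
  Sum.elim (fun x => τ.edgeForm x.1 (a x.1 x.2)) fun x => pointForm (τ.leg x.1) _ (m x.1 x.2)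

/-- Every edge element and every input is a scalar times a product of squares. Embedded into the
space of vertex positions, these become squares of forms on `N^V`, and all of them commute. -/
theorem map_cob_tensor (hg : ∀ v, τ.genus v = 0) {k : E → ℕ}
    (a : ∀ e, Fin (k e) → perp (Nbar.mk (τ.w e • τ.u e))) (s : E → ℚ)
    (ha : ∀ e, topElt (Nbar.mk (τ.w e • τ.u e)) = s e • sqvProd (dblFst _) (dblSnd _) (a e))
    {d : I → ℕ} (m : ∀ i, Fin (d i) → perp (τ.obj i)) (t : I → ℚ) (z : ∀ i, Frob (τ.obj i))
    (hz : ∀ i, z i = t i • sqvProd (dblFst _) (dblSnd _) (m i)) :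
    (multTrQFT N).map τ.cob (tensor τ.obj z) = algebraMap ℚ _ ((∏ e, s e) * (∏ i, t i) *
      vertexIntegral N V (sqvProd (piFst N V) (piSnd N V) (τ.forms a m))) := by
  have h1 : ∀ e, map (τ.diagram.diff e) (topElt (Nbar.mk (τ.w e • τ.u e))) =
      s e • sqvProd (piFst N V) (piSnd N V) fun j => τ.edgeForm e (a e j) := fun e => by
    rw [ha, map_smul, map_sqvProd, diff_comp_dblFst, diff_comp_dblSnd, sqvProd_comp]
  have h2 : ∀ i, map (wsingle (fun _ : V => (Nbar.zero : Nbar N)) (τ.leg i) (τ.obj i)) (z i) =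
      t i • sqvProd (piFst N V) (piSnd N V) fun j => pointForm (τ.leg i) _ (m i j) := fun i => by
    rw [hz, map_smul, map_sqvProd, wsingle_comp_dblFst, wsingle_comp_dblSnd, sqvProd_comp]
  have h3 : edgeProd τ.diagram.diff = (∏ e, s e) • sqvProd (piFst N V) (piSnd N V)
      fun x : Σ e, Fin (k e) => τ.edgeForm x.1 (a x.1 x.2) := by
    rw [sqvProd_sigma _ _ fun e j => τ.edgeForm e (a e j), ← centralProd_smul _ _ _ fun e =>
      (sqvProd_central _ _ _).smul _]
    exact centralProd_equiv _ _ _ (Equiv.refl E) h1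
  have h4 : map τ.diagram.inMap (tensor τ.obj z) = (∏ i, t i) • sqvProd (piFst N V) (piSnd N V)
      fun x : Σ i, Fin (d i) => pointForm (τ.leg x.1) _ (m x.1 x.2) := by
    rw [map_inMap_tensor τ z fun i => by rw [h2]; exact (sqvProd_central _ _ _).smul _,
      sqvProd_sigma _ _ fun i j => pointForm (τ.leg i) _ (m i j), ← centralProd_smul _ _ _ fun i =>
      (sqvProd_central _ _ _).smul _]
    exact centralProd_equiv _ _ _ (Equiv.refl I) h2
  change multMap τ.cob _ = _
  rw [multMap_of_genus hg, eval_diagram_cob, eval_diagram, h3, h4, smul_mul_smul_comm, map_smul,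
    forms, sqvProd_sum, smul_eq_mul]

end CurveType

end CurveIntegrals

/-! ### Comparison with the multiplicity of a tropical curve -/

section Multiplicities

open ExteriorAlgebra Module

variable {N : Type u} [AddCommGroup N] [Module.Free ℤ N] [Module.Finite ℤ N]

theorem square_smul_ιMulti {c : Nbar N} {d : ℕ} (wt : ℚ) (a : Fin d → perp c) :
    square d (wt • ιMulti ℚ d a) = wt ^ 2 • sqvProd (dblFst c) (dblSnd c) a := by
  rw [← list_ofFn_map_sqv, list_ofFn_sqv, square, map_smul, map_smul, smul_mul_smul_comm, ← sq,
    smul_comm]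

theorem finrank_of_annLattice_basis {n : N} (hn : IsPrimitiveVector N n) {k : ℕ}
    (m : Basis (Fin k) ℤ (annLattice (Submodule.span ℝ {toReal n}))) : k + 1 = finrank ℤ N := by
  obtain ⟨ν, -⟩ := hn.exists_basis m
  rw [finrank_eq_card_basis ν, Fintype.card_fin]

theorem mk_nsmul_ne_zero {n : N} (hn : IsPrimitiveVector N n) {w : ℕ} (hw : 0 < w) :
    Nbar.mk (w • n) ≠ Nbar.zero := by
  rw [Ne, mk_eq_zero, ← natCast_zsmul]
  exact smul_ne_zero (by exact_mod_cast hw.ne') hn.1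

theorem topElt_mk_nsmul {n : N} (hn : IsPrimitiveVector N n) {w : ℕ} (hw : 0 < w) {k : ℕ}
    (m : Basis (Fin k) ℤ (annLattice (Submodule.span ℝ {toReal n}))) :
    topElt (Nbar.mk (w • n)) = (w : ℚ) ^ 2 • sqvProd (dblFst _) (dblSnd _)
      fun j => (⟨toRat (m j), toRat_mem_perp (mem_annLattice_span.1 (m j).2) w⟩ :
        perp (Nbar.mk (w • n))) := by
  have hk : k = finrank ℚ (perp (Nbar.mk (w • n))) := by
    have h1 := finrank_perp (mk_nsmul_ne_zero hn hw)
    have h2 := finrank_of_annLattice_basis hn m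
    omega
  have hw' : (w : ℚ) ^ 2 ≠ 0 := pow_ne_zero _ (by exact_mod_cast hw.ne')
  rw [← list_ofFn_map_sqv, list_sqv_eq_smul_topElt hk, tr_list_sqv hn hw, smul_smul,
    mul_inv_cancel₀ hw', one_smul]

/-- This also covers contracted edges, for which `perp` is all of `M ⊗ ℚ` and the number of factors
is `r` instead of `r - 1`. -/
theorem exists_topElt_eq {n : N} {w : ℕ} (hn : 0 < w → IsPrimitiveVector N n) :
    ∃ (s : ℚ) (a : Fin (finrank ℚ (perp (Nbar.mk (w • n)))) → perp (Nbar.mk (w • n))),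
      topElt (Nbar.mk (w • n)) = s • sqvProd (dblFst _) (dblSnd _) a := by
  rcases Nat.eq_zero_or_pos w with rfl | hw
  · rw [zero_smul]
    change ∃ (s : ℚ) (a : Fin (finrank ℚ (perp (Nbar.zero : Nbar N))) → perp (Nbar.zero : Nbar N)),
      topElt (Nbar.zero : Nbar N) = s • sqvProd (dblFst _) (dblSnd _) a
    rw [finrank_perp_zero]
    exact ⟨1, fun i => toZero (latBasis N i), by rw [one_smul]; exact topElt_zero⟩
  · have h1 := finrank_perp (mk_nsmul_ne_zero (hn hw) hw)
    have h2 := finrank_of_annLattice_basis (hn hw) (finBasis ℤ _)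
    have m := finBasisOfFinrankEq ℤ (annLattice (Submodule.span ℝ {toReal n}))
      (n := finrank ℚ (perp (Nbar.mk (w • n)))) (by omega)
    exact ⟨_, _, topElt_mk_nsmul (hn hw) hw m⟩

variable {V E I : Type} [Fintype V] [Fintype E] [Fintype I]

theorem sum_card_fiber {X : Type} [Fintype X] (f : X → V) :
    ∑ v, Nat.card {x // f x = v} = Fintype.card X := by
  rw [← Nat.card_sigma, Nat.card_congr (Equiv.sigmaFiberEquiv f), Nat.card_eq_fintype_card]

open Classical in
theorem pointForm_apply (v v' : V) (c : Nbar N) (m : perp c) (n : N) :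
    pointForm v c m v' n = (m : N →ₗ[ℤ] ℚ) ((Pi.single v' n : V → N) v) := by
  have h : pointForm v c m v' = (Pi.single v (m : N →ₗ[ℤ] ℚ) : V → (N →ₗ[ℤ] ℚ)) v' := rfl
  rw [h]
  by_cases hv : v = v'
  · subst hv; rw [Pi.single_eq_same, Pi.single_eq_same]
  · rw [Pi.single_eq_of_ne (Ne.symm hv), Pi.single_eq_of_ne hv, map_zero]; rfl

namespace CurveType

variable (τ : CurveType N V E I)

/-- With all genera zero, counting flags expresses the total over-valence by the numbers of
vertices, edges and ends, and the number of ends cancels. -/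
theorem expectedDim_eq (hg : ∀ v, τ.genus v = 0) :
    τ.expectedDim = finrank ℤ N * Fintype.card V - (finrank ℤ N - 1) * Fintype.card E := by
  have h1 := sum_card_fiber τ.src
  have h2 := sum_card_fiber τ.tgt
  have h3 := sum_card_fiber τ.leg
  have h4 : ∑ v, τ.ov v = 2 * Fintype.card E + Fintype.card I - 3 * Fintype.card V := by
    have : ∀ v, τ.ov v = ((Nat.card {e // τ.src e = v} : ℕ) : ℤ) + (Nat.card {e // τ.tgt e = v} : ℕ) +
        (Nat.card {i // τ.leg i = v} : ℕ) - 3 := fun v => by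
      rw [ov, hg, val]; push_cast; ring
    simp only [this, Finset.sum_sub_distrib, Finset.sum_add_distrib, ← Nat.cast_sum, h1, h2, h3]
    simp only [Finset.sum_const, Finset.card_univ, nsmul_eq_mul]
    ring
  have h5 : τ.totalGenus = (Fintype.card E : ℤ) - Fintype.card V + 1 := by
    simp [totalGenus, hg]
  rw [expectedDim, h4, h5]
  ring

theorem finrank_positions : finrank ℚ (V → (N →ₗ[ℤ] ℚ)) = Fintype.card V * finrank ℤ N := by
  rw [finrank_pi_fintype, Finset.sum_const, Finset.card_univ, smul_eq_mul, finrank_hom]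

/-- A contracted compact edge contributes `r` linear forms instead of `r - 1`, so the total number
of forms exceeds the dimension of the space of positions. -/
theorem sqvProd_forms_eq_zero {d : I → ℕ} (hw : ∀ e, 0 < τ.w e → IsPrimitiveVector N (τ.u e))
    (hd : ∑ i, (d i : ℤ) = finrank ℤ N * Fintype.card V - (finrank ℤ N - 1) * Fintype.card E)
    {e₀ : E} (he : τ.w e₀ = 0)
    (a : ∀ e, Fin (finrank ℚ (perp (Nbar.mk (τ.w e • τ.u e)))) → perp (Nbar.mk (τ.w e • τ.u e)))
    (m : ∀ i, Fin (d i) → perp (τ.obj i)) :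
    sqvProd (piFst N V) (piSnd N V) (τ.forms a m) = 0 := by
  refine sqvProd_eq_zero ?_ _ _ _
  rw [finrank_positions]
  simp only [Fintype.card_sum, Fintype.card_sigma, Fintype.card_fin]
  have h0 : (finrank ℚ (perp (Nbar.mk (τ.w e₀ • τ.u e₀))) : ℤ) = finrank ℤ N := by
    rw [he, zero_smul]
    exact_mod_cast finrank_perp_zero
  have h1 : ∑ _e : E, ((finrank ℤ N : ℤ) - 1) <
      ∑ e, (finrank ℚ (perp (Nbar.mk (τ.w e • τ.u e))) : ℤ) := by
    refine Finset.sum_lt_sum (fun e _ => ?_) ⟨e₀, Finset.mem_univ _, by omega⟩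
    rcases Nat.eq_zero_or_pos (τ.w e) with h | h
    · have : (finrank ℚ (perp (Nbar.mk (τ.w e • τ.u e))) : ℤ) = finrank ℤ N := by
        rw [h, zero_smul]
        exact_mod_cast finrank_perp_zero
      omega
    · have := finrank_perp (mk_nsmul_ne_zero (hw e h) h)
      omega
  rw [Finset.sum_const, Finset.card_univ, nsmul_eq_mul] at h1
  zify
  linarith

/-- The index of the lattice map of a curve, in terms of the linear forms `forms`. -/
theorem index_sq_eq (A : I → AffineSubspace ℝ (ℝ ⊗[ℤ] N)) {k : E → ℕ} {d : I → ℕ}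
    (mE : ∀ e, Basis (Fin (k e)) ℤ (annLattice (Submodule.span ℝ {toReal (τ.u e)})))
    (mI : ∀ i, Basis (Fin (d i)) ℤ (annLattice (A i).direction))
    (hm : ∀ i j, toRat (mI i j : Dual ℤ N) ∈ perp (τ.obj i))
    (hcard : Fintype.card ((Σ e, Fin (k e)) ⊕ (Σ i, Fin (d i))) = Fintype.card V * finrank ℤ N) :
    vertexIntegral N V (sqvProd (piFst N V) (piSnd N V) (τ.forms
      (fun e j => ⟨toRat (mE e j), toRat_mem_perp (mem_annLattice_span.1 (mE e j).2) (τ.w e)⟩)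
      fun i j => ⟨toRat (mI i j), hm i j⟩)) =
      ((LinearMap.range (τ.Phi A)).toAddSubgroup.index : ℚ) ^ 2 := by
  classical
  let σ : (Σ e, Fin (k e)) ⊕ (Σ i, Fin (d i)) ≃ (Σ _ : V, Fin (finrank ℤ N)) :=
    Fintype.equivOfCardEq (by rw [hcard]; simp)
  choose φE hφE using fun e => exists_quotient_equiv _ (mE e)
  choose φI hφI using fun i => exists_quotient_equiv _ (mI i)
  -- Lattice bases of the annihilators are coordinates on the codomain of `Φ`; in them, the
  -- components of `Φ` are the forms `forms`.
  let φ := ((LinearEquiv.piCongrRight φE).prodCongr (LinearEquiv.piCongrRight φI)).trans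
    (((LinearEquiv.piCurry ℤ fun (e : E) (_ : Fin (k e)) => ℤ).symm.prodCongr
      (LinearEquiv.piCurry ℤ fun (i : I) (_ : Fin (d i)) => ℤ).symm).trans
      (LinearEquiv.sumArrowLequivProdArrow _ _ ℤ ℤ).symm)
  have hφ : ∀ H, φ (τ.Phi A H) = Sum.elim
      (fun x => (mE x.1 x.2 : Dual ℤ N) (H (τ.tgt x.1) - H (τ.src x.1)))
      fun x => (mI x.1 x.2 : Dual ℤ N) (H (τ.leg x.1)) := by
    intro H
    funext x
    rcases x with ⟨e, j⟩ | ⟨i, j⟩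
    · exact hφE e _ j
    · exact hφI i _ j
  -- Dual bases of `N^V` and of its rational dual, reindexed by the linear forms so that the matrix
  -- of the forms is the transpose of the matrix of `Φ`.
  let b := (Pi.basis fun _ : V => finBasis ℤ N).reindex σ.symm
  let B := (Pi.basis fun _ : V => latBasis N).reindex σ.symm
  have hb : ∀ x, b x = Pi.single (σ x).1 (finBasis ℤ N (σ x).2) := fun x => by
    simp only [b, Basis.reindex_apply, Equiv.symm_symm]
    exact Pi.basis_apply _ _
  have hB : sqvProd (piFst N V) (piSnd N V) B =
      sqvProd (piFst N V) (piSnd N V) (Pi.basis fun _ : V => latBasis N) := by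
    rw [← sqvProd_reindex σ]
    congr 1
    funext x
    simp [B]
  rw [sqvProd_eq_det _ _ B, hB, map_smul, vertexIntegral_basis, index_range_eq b φ,
    Nat.cast_natAbs, Int.cast_abs, sq_abs, smul_eq_mul, mul_one, Basis.det_apply, Int.cast_det,
    ← Matrix.det_transpose]
  congr 2
  ext x y
  have hrep : ∀ f : V → (N →ₗ[ℤ] ℚ), B.repr f y = f (σ y).1 (finBasis ℤ N (σ y).2) := by
    intro f
    simp only [B, Basis.repr_reindex_apply, Equiv.symm_symm]
    exact ratBasis_repr (finBasis ℤ N) _ _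
  rw [Matrix.transpose_apply, Basis.toMatrix_apply, hrep, Matrix.map_apply, Matrix.of_apply, hφ, hb]
  rcases x with ⟨e, j⟩ | ⟨i, j⟩
  · change pointForm (τ.tgt e) _ _ (σ y).1 _ - pointForm (τ.src e) _ _ (σ y).1 _ =
      toRat (mE e j : Dual ℤ N) (_ - _)
    rw [map_sub]
    exact congrArg₂ (· - ·) (pointForm_apply _ _ _ _ _) (pointForm_apply _ _ _ _ _)
  · exact pointForm_apply _ _ _ _ _

/-- By the codimension condition and rational slope there are exactly as many linear forms as the
dimension of the space of positions when no compact edge is contracted. The weights come out of the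
edge elements and the constraint classes, and the index out of the integral. -/
theorem map_cob_tensor_eq_mult_sq (A : I → AffineSubspace ℝ (ℝ ⊗[ℤ] N)) (wt : I → ℕ) {d : I → ℕ}
    {α : ∀ i, ExteriorAlgebra ℚ (perp (τ.obj i))} (hA : ∀ i, HasRationalSlope (A i))
    (hg : ∀ v, τ.genus v = 0)
    (hcodim : ∑ i, ((finrank ℤ N : ℤ) - finrank ℝ (A i).direction) = τ.expectedDim)
    (hα : ∀ i, IsConstraintClass (A i) (wt i) (τ.obj i) (d i) (α i)) :
    (multTrQFT N).map τ.cob (tensor τ.obj fun i => square (d i) (α i)) =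
      algebraMap ℚ _ ((τ.mult A wt : ℚ) ^ 2) := by
  choose mI hm hα using hα
  have hz : ∀ i, square (d i) (α i) = (wt i : ℚ) ^ 2 • sqvProd (dblFst _) (dblSnd _)
      fun j => (⟨toRat (mI i j), hm i j⟩ : perp (τ.obj i)) := fun i => by
    rw [hα, square_smul_ιMulti]
  have hd : ∑ i, (d i : ℤ) = finrank ℤ N * Fintype.card V - (finrank ℤ N - 1) * Fintype.card E := by
    rw [← τ.expectedDim_eq hg, ← hcodim]
    refine Finset.sum_congr rfl fun i _ => ?_
    have := card_add_finrank_of_span (hA i) (mI i)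
    omega
  by_cases hw : ∃ e, τ.w e = 0
  · obtain ⟨e₀, he₀⟩ := hw
    -- A compact edge of weight `0` makes the product of weights in the multiplicity vanish, and the
    -- excess of linear forms makes the integral vanish.
    choose s a ha using fun e => exists_topElt_eq (n := τ.u e) (w := τ.w e) (τ.primitive e)
    rw [τ.map_cob_tensor hg a s ha _ _ _ hz, τ.sqvProd_forms_eq_zero τ.primitive hd he₀,
      map_zero, mul_zero, mult, Finset.prod_eq_zero (Finset.mem_univ e₀) he₀]
    simp
  · have hw : ∀ e, 0 < τ.w e := fun e => Nat.pos_of_ne_zero fun h => hw ⟨e, h⟩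
    let mE := fun e => finBasis ℤ (annLattice (Submodule.span ℝ {toReal (τ.u e)}))
    have hcard : Fintype.card ((Σ e, Fin (finrank ℤ (annLattice (Submodule.span ℝ {toReal (τ.u e)})))) ⊕
        (Σ i, Fin (d i))) = Fintype.card V * finrank ℤ N := by
      simp only [Fintype.card_sum, Fintype.card_sigma, Fintype.card_fin]
      have h1 : ∑ e, (finrank ℤ (annLattice (Submodule.span ℝ {toReal (τ.u e)})) : ℤ) =
          ∑ _e : E, ((finrank ℤ N : ℤ) - 1) := Finset.sum_congr rfl fun e _ => by
        have := finrank_of_annLattice_basis (τ.primitive e (hw e)) (mE e)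
        omega
      rw [Finset.sum_const, Finset.card_univ, nsmul_eq_mul] at h1
      zify
      linarith
    rw [τ.map_cob_tensor hg _ _ (fun e => topElt_mk_nsmul (τ.primitive e (hw e)) (hw e) (mE e)) _ _ _ hz,
      τ.index_sq_eq A mE mI hm hcard, mult]
    congr 1
    push_cast
    rw [Finset.prod_pow, Finset.prod_pow]
    ring

end CurveType

end Multiplicities

end TropQFT

end

theorem theorem3 {N : Type*} [AddCommGroup N] [Module.Free ℤ N] [Module.Finite ℤ N] :
    (∃ F : TropQFT.TrQFT N, F.IsMult) ∧
    ∀ F : TropQFT.TrQFT N, F.IsMult →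
      ∀ (V E I : Type) [Fintype V] [Fintype E] [Fintype I]
        (τ : TropQFT.CurveType N V E I) (h : V → TensorProduct ℤ ℝ N)
        (A : I → AffineSubspace ℝ (TensorProduct ℤ ℝ N)) (wt : I → ℕ)
        (s : {i // τ.wLeg i = 0} → ℕ)
        (d : I → ℕ) (α : (i : I) → ExteriorAlgebra ℚ (TropQFT.perp (τ.obj i))),
        (∀ i, TropQFT.HasRationalSlope (A i)) → (∀ i, 0 < wt i) →
        τ.IsRigid h A s →
        (∀ i, TropQFT.IsConstraintClass (A i) (wt i) (τ.obj i) (d i) (α i)) →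
        F.map τ.cob (TropQFT.tensor τ.obj fun i => TropQFT.square (d i) (α i)) =
          algebraMap ℚ _ ((τ.mult A wt : ℚ) ^ 2) := by
  refine ⟨⟨TropQFT.multTrQFT N, TropQFT.multTrQFT_isMult N⟩, ?_⟩
  intro F hF V E I _ _ _ τ h A wt s d α hA _ hτ hα
  -- Non-superabundance excludes vertices of positive genus, so the curve is a cobordism on which
  -- the given theory agrees with the constructed one.
  have hg := hτ.nonSuperabundant.2.1
  have : IsEmpty τ.cob.Joint := inferInstanceAs (IsEmpty Empty)
  rw [TropQFT.determined_of_genus τ.cob hg F hF]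
  exact τ.map_cob_tensor_eq_mult_sq A wt hA hg hτ.codim hα
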